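/- Let $X_1,X_2,\dots$ be i.i.d. integer-valued random variables with $E X_1=0$ and $E X_1^2=\infty$, and suppose that the random walk $S^x_n=x+X_1+\cdots+X_n$ is irreducible on $\mathbb{Z}$. For $B\subset\mathbb{Z}$ let $\sigma^x_B=\inf\{n\ge 1: S^x_n\in B\}$ (with $\inf\emptyset=\infty$), and write $\sigma^x_y=\sigma^x_{\{y\}}$. Let $$a(x)=\sum_{n=0}^\infty\big(P[S^0_n=0]-P[S^0_n=-x]\big),\qquad a^\dagger(x)=\mathbf 1\{x=0\}+a(x),\qquad \bar a(x)=\tfrac12\,[a(x)+a(-x)]\qquad(x\in\mathbb{Z}),$$ the series being understood as the limit of its partial sums; this limit exists for every $x$. For real $x\ge 0$ let $m_\pm(x)=\int_0^x\int_t^\infty P[\pm X_1>u]\,du\,dt$ and $m=m_++m_-$. Below $R$ and $z$ run through the positive integers, and $p_R(x)\sim q_R(x)$ uniformly for $x\in D_R$ means that $\sup_{x\in D_R}|p_R(x)/q_R(x)-1|\to 0$ as $R\to\infty$ (in particular $q_R(x)\neq 0$ for $x\in D_R$ when $R$ is large). (i) If $\lim_{z\to\infty}a(-z)/a(z)=0$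 (where $a(z)\ne 0$ for all large $z$), then, as $R\to\infty$, $$P[\sigma^x_{(-\infty,0]}<\sigma^x_R]\sim P[\sigma^x_0<\sigma^x_R]\qquad\text{uniformly for } x\in\mathbb{Z}.$$ (ii) Suppose $m_+(x)/m(x)\to 0$ as $x\to\infty$. Then $a(z)\neq0$ for all large $z$, $\lim_{z\to\infty}a(-z)/a(z)=0$, and, as $R\to\infty$, $$P[\sigma^x_{[R,\infty)}<\sigma^x_0]\sim P[\sigma^x_R<\sigma^x_0]\sim\frac{a^\dagger(x)}{a(R)}\qquad\text{uniformly for } 0\le x<R.$$ Consequently, under the same condition, $\bar a$ is asymptotically increasing: there is a strictly increasing function $f$ on the non-negative integers such that $\bar a(x)=f(x)\{1+o(1)\}$ as $x\to\infty$. -/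

import Mathlib

open MeasureTheory ProbabilityTheory Filter Topology Asymptotics

noncomputable section

namespace PotentialWalk

variable {Ω : Type*}

/-- The walk started at `x`: `S^x_n = x + X_1 + ⋯ + X_n`; the increments `X_1, X_2, …` are
`X 0, X 1, …`. -/
def walk (X : ℕ → Ω → ℤ) (x : ℤ) (n : ℕ) (ω : Ω) : ℤ :=
  x + ∑ i ∈ Finset.range n, X i ω

/-- `σ^x_B = inf {n ≥ 1 : S^x_n ∈ B}`, the first hitting time of `B` after time `0`
(it is `⊤` if there is no such `n`). -/
def hit (X : ℕ → Ω → ℤ) (x : ℤ) (B : Set ℤ) : Ω → WithTop ℕ :=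
  hittingAfter (walk X x) B 1

variable [MeasurableSpace Ω]

/-- `P[σ^x_A < σ^x_B]`. -/
def probHitBefore (X : ℕ → Ω → ℤ) (P : Measure Ω) (x : ℤ) (A B : Set ℤ) : ℝ :=
  P.real {ω | hit X x A ω < hit X x B ω}

/-- Irreducibility of the walk on `ℤ`. By spatial homogeneity it is enough to start at `0`. -/
def WalkIrreducible (X : ℕ → Ω → ℤ) (P : Measure Ω) : Prop :=
  ∀ y : ℤ, ∃ n : ℕ, 0 < P.real {ω | walk X 0 n ω = y}

/-- `∑_{n=0}^{N} (P[S^0_n = 0] - P[S^0_n = -x])`. -/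
def potentialPartial (X : ℕ → Ω → ℤ) (P : Measure Ω) (x : ℤ) (N : ℕ) : ℝ :=
  ∑ n ∈ Finset.range (N + 1),
    (P.real {ω | walk X 0 n ω = 0} - P.real {ω | walk X 0 n ω = -x})

/-- The potential function `a(x) = ∑_{n=0}^∞ (P[S^0_n = 0] - P[S^0_n = -x])`. The series need not
converge absolutely, so it is read as the limit of its partial sums. -/
def potential (X : ℕ → Ω → ℤ) (P : Measure Ω) (x : ℤ) : ℝ :=
  limUnder atTop (potentialPartial X P x)

/-- `a†(x) = δ_{x,0} + a(x)`. -/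
def potentialDagger (X : ℕ → Ω → ℤ) (P : Measure Ω) (x : ℤ) : ℝ :=
  (if x = 0 then 1 else 0) + potential X P x

/-- `ā(x) = (a(x) + a(-x)) / 2`. -/
def potentialBar (X : ℕ → Ω → ℤ) (P : Measure Ω) (x : ℤ) : ℝ :=
  (potential X P x + potential X P (-x)) / 2

/-- `lim_{z → ∞} a(-z) / a(z) = 0`, where the quotient is required to make sense
for all large `z`. -/
def PotentialRatioVanishes (X : ℕ → Ω → ℤ) (P : Measure Ω) : Prop :=
  (∀ᶠ z : ℕ in atTop, potential X P (z : ℤ) ≠ 0) ∧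
    Tendsto (fun z : ℕ => potential X P (-(z : ℤ)) / potential X P (z : ℤ)) atTop (𝓝 0)

/-- `η(x) = ∫_x^∞ P[Y > y] dy`. -/
def tailInt (Y : Ω → ℝ) (P : Measure Ω) (x : ℝ) : ℝ :=
  ∫ y in Set.Ioi x, P.real {ω | y < Y ω}

/-- `m(x) = ∫_0^x η(t) dt`. -/
def doubleTailInt (Y : Ω → ℝ) (P : Measure Ω) (x : ℝ) : ℝ :=
  ∫ t in (0 : ℝ)..x, tailInt Y P t

/-- `m_+`, built from the right tail `P[X > y]` of the increment `X`. -/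
def mPlus (X : ℕ → Ω → ℤ) (P : Measure Ω) (x : ℝ) : ℝ :=
  doubleTailInt (fun ω => (X 0 ω : ℝ)) P x

/-- `m_-`, built from the left tail `P[X < -y]` of the increment `X`. -/
def mMinus (X : ℕ → Ω → ℤ) (P : Measure Ω) (x : ℝ) : ℝ :=
  doubleTailInt (fun ω => -(X 0 ω : ℝ)) P x

/-- The condition `m_+ / m → 0` with `m = m_+ + m_-`. -/
def RightTailNegligible (X : ℕ → Ω → ℤ) (P : Measure Ω) : Prop :=
  Tendsto (fun x : ℝ => mPlus X P x / (mPlus X P x + mMinus X P x)) atTop (𝓝 0)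

/-- `p_R(x) ∼ q_R(x)` as `R → ∞`, uniformly for `x ∈ D_R`: the ratio tends to `1` uniformly.
(It forces `q_R(x) ≠ 0` for all `x ∈ D_R` once `R` is large, since `p / 0 = 0`.) -/
def UniformEquiv (D : ℕ → Set ℤ) (p q : ℕ → ℤ → ℝ) : Prop :=
  ∀ ε : ℝ, 0 < ε → ∀ᶠ R : ℕ in atTop, ∀ x ∈ D R, |p R x / q R x - 1| < ε

end PotentialWalk

end

noncomputable section

set_option linter.unusedSectionVars false

namespace PotentialWalk

/-! Write `ν` for the step law, a for its potential and φ for its characteristic function. The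
argument has an analytic half, in which everything is a statement about averages against `ν`, and a
short probabilistic half (`probHitBefore_eq_avg`, `real_walk_eq_ret`) that identifies hitting and
return probabilities with solutions of one-step equations.

Existence of a. The partial sums are nonnegative and obey a maximum principle for increments.
Infinite variance makes |1 - φ(t)| larger than any multiple of t² near 0, so a Fourier bound gives
partial sums that are o(|x|) uniformly in n (`partialPot_le`). Every subsequential limit f satisfies
f(0) = 0, E f(x + X) = f(x) + 1{x = 0} and has sublinear increments. Such a function is unique by
the Liouville property (`harmonic_bounded_const`), so compactness yields convergence. Testing the
equation for a against a tent function shows that a is unbounded, hence that the walk is recurrent.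

Hitting probabilities. Recurrence gives a comparison principle (`payoff_comparison`): probabilities
of hitting A before B are the only bounded solutions of their one-step equation. It yields, for x ≠
R, P[σ_R < σ_0] = (a†(x) + a(-R) - a(x - R)) / (a(R) + a(-R)). Its nonnegativity is the
subadditivity of a.

Part (i). By the symmetry of the formula in `hitFirst_symm`, a(-z)/a(z) → 0 implies that from
anywhere on the negative half-line the walk visits 0 before R with probability at least 1 - δ.
Entering (-∞, 0] before R is therefore almost as hard as hitting 0 before R, and the comparison
principle turns this into a uniform relative estimate.

Part (ii). Once a(-z)/a(z) → 0 is known, |a(-R) - a(x - R)| is small compared with a†(x), and a is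
increasing up to a factor 1 + ε and a constant; the remaining claims follow from the explicit
formula and comparison. The ratio itself comes from comparing `ν` with the law `rightContLaw ν`,
which has the same negative jumps up to a factor and only unit upward jumps. Its potential vanishes
on the negative half-line, so a(-n) is a Fourier integral of 1/w - 1/v, where w = 1 - φ and v is the
symbol of the comparison law up to a factor. The difference v - w is governed by m_+ plus a bounded
term, which is o(m). Treating separately the frequencies below 1/n, the intermediate ones and the
fixed ones gives a(-n) = o(n/m(n)) (`exists_pot_neg_le`). Conversely the tent estimate and
subadditivity give a(n) ≥ c n/m(n) (`eventually_le_pot`). -/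

/-- The standing assumptions on the law of an increment. -/
structure CenteredLaw (ν : Measure ℤ) : Prop where
  integrable : Integrable (fun k : ℤ => (k : ℝ)) ν
  mean : ∫ k, (k : ℝ) ∂ν = 0
  variance : ∫⁻ k, ENNReal.ofReal ((k : ℝ) ^ 2) ∂ν = ⊤
  gen : AddSubgroup.closure {k : ℤ | ν {k} ≠ 0} = ⊤

/-! ### The averaging operator and its Liouville property -/

/-- One step of the walk acting on functions. -/
def avg (ν : Measure ℤ) (f : ℤ → ℝ) (x : ℤ) : ℝ := ∫ k, f (x + k) ∂ν

lemma integrable_of_abs_le {ν : Measure ℤ} [IsFiniteMeasure ν] {f : ℤ → ℝ} {C : ℝ}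
    (h : ∀ x, |f x| ≤ C) : Integrable f ν :=
  Integrable.of_bound (measurable_of_countable f).aestronglyMeasurable C
    (ae_of_all _ fun x => by simpa using h x)

lemma integrable_shift_of_abs_le {ν : Measure ℤ} [IsFiniteMeasure ν] {f : ℤ → ℝ} {C : ℝ}
    (h : ∀ x, |f x| ≤ C) (x : ℤ) : Integrable (fun k => f (x + k)) ν :=
  integrable_of_abs_le fun k => h (x + k)

/-- Functions of at most linear growth. -/
def LinGrowth (f : ℤ → ℝ) : Prop := ∃ C, ∀ x : ℤ, |f x| ≤ C * (1 + |(x : ℝ)|)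

lemma LinGrowth.integrable_shift {ν : Measure ℤ} [IsFiniteMeasure ν]
    (hν : Integrable (fun k : ℤ => (k : ℝ)) ν) {f : ℤ → ℝ} (hf : LinGrowth f) (x : ℤ) :
    Integrable (fun k => f (x + k)) ν := by
  obtain ⟨C, hC⟩ := hf
  have h1 : Integrable (fun k : ℤ => |C| * (1 + |(x : ℝ)| + |(k : ℝ)|)) ν :=
    ((integrable_const _).add hν.abs).const_mul _
  refine h1.mono' (measurable_of_countable _).aestronglyMeasurable (ae_of_all _ fun k => ?_)
  rw [Real.norm_eq_abs]
  refine (hC (x + k)).trans ?_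
  have h2 : |((x + k : ℤ) : ℝ)| ≤ |(x : ℝ)| + |(k : ℝ)| := by push_cast; exact abs_add_le _ _
  calc C * (1 + |((x + k : ℤ) : ℝ)|) ≤ |C| * (1 + |((x + k : ℤ) : ℝ)|) := by
        gcongr; exact le_abs_self C
    _ ≤ |C| * (1 + |(x : ℝ)| + |(k : ℝ)|) := by
        have := abs_nonneg C
        have h3 : 1 + |((x + k : ℤ) : ℝ)| ≤ 1 + |(x : ℝ)| + |(k : ℝ)| := by linarith
        gcongr

lemma avg_mono {ν : Measure ℤ} {f g : ℤ → ℝ} {x : ℤ}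
    (hf : Integrable (fun k => f (x + k)) ν) (hg : Integrable (fun k => g (x + k)) ν)
    (h : ∀ y, f y ≤ g y) : avg ν f x ≤ avg ν g x :=
  integral_mono hf hg fun k => h (x + k)

lemma avg_le_of_le {ν : Measure ℤ} [IsProbabilityMeasure ν] {f : ℤ → ℝ} {x : ℤ} {C : ℝ}
    (hf : Integrable (fun k => f (x + k)) ν) (h : ∀ y, f y ≤ C) : avg ν f x ≤ C := by
  have := integral_mono hf (integrable_const C) fun k => h (x + k)
  simpa [avg] using this

lemma le_avg_of_le {ν : Measure ℤ} [IsProbabilityMeasure ν] {f : ℤ → ℝ} {x : ℤ} {C : ℝ}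
    (hf : Integrable (fun k => f (x + k)) ν) (h : ∀ y, C ≤ f y) : C ≤ avg ν f x := by
  have := integral_mono (integrable_const C) hf fun k => h (x + k)
  simpa [avg] using this

lemma avg_nonneg {ν : Measure ℤ} {f : ℤ → ℝ} (h : ∀ y, 0 ≤ f y) (x : ℤ) : 0 ≤ avg ν f x :=
  integral_nonneg fun _ => h _

lemma abs_avg_le {ν : Measure ℤ} [IsProbabilityMeasure ν] {f : ℤ → ℝ} {C : ℝ}
    (h : ∀ y, |f y| ≤ C) (x : ℤ) : |avg ν f x| ≤ C := by
  have hf := integrable_shift_of_abs_le (ν := ν) h x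
  exact abs_le.2 ⟨le_avg_of_le hf fun y => (abs_le.1 (h y)).1,
    avg_le_of_le hf fun y => (abs_le.1 (h y)).2⟩

lemma avg_sub {ν : Measure ℤ} {f g : ℤ → ℝ} {x : ℤ}
    (hf : Integrable (fun k => f (x + k)) ν) (hg : Integrable (fun k => g (x + k)) ν) :
    avg ν (fun y => f y - g y) x = avg ν f x - avg ν g x := integral_sub hf hg

lemma avg_add {ν : Measure ℤ} {f g : ℤ → ℝ} {x : ℤ}
    (hf : Integrable (fun k => f (x + k)) ν) (hg : Integrable (fun k => g (x + k)) ν) :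
    avg ν (fun y => f y + g y) x = avg ν f x + avg ν g x := integral_add hf hg

lemma avg_comp_add (ν : Measure ℤ) (f : ℤ → ℝ) (x z : ℤ) :
    avg ν (fun y => f (y + z)) x = avg ν f (x + z) := by
  simp only [avg]
  congr 1; ext k; congr 1; ring

lemma avg_const (ν : Measure ℤ) [IsProbabilityMeasure ν] (c : ℝ) (x : ℤ) :
    avg ν (fun _ => c) x = c := by simp [avg]

lemma avg_congr_of_supp {ν : Measure ℤ} {f g : ℤ → ℝ} {x : ℤ}
    (h : ∀ k, ν {k} ≠ 0 → f (x + k) = g (x + k)) : avg ν f x = avg ν g x := by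
  refine integral_congr_ae ?_
  rw [Filter.EventuallyEq, ae_iff_of_countable]
  exact h

/-- A nonnegative function whose average vanishes is zero on the support of the step law. -/
lemma eq_zero_of_avg_eq_zero {ν : Measure ℤ} {f : ℤ → ℝ} {x : ℤ}
    (hf : Integrable (fun k => f (x + k)) ν) (h : ∀ y, 0 ≤ f y) (h0 : avg ν f x = 0)
    {k : ℤ} (hk : ν {k} ≠ 0) : f (x + k) = 0 := by
  have := (integral_eq_zero_iff_of_nonneg (fun k => h (x + k)) hf).1 h0
  rw [Filter.EventuallyEq, ae_iff_of_countable] at this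
  exact this k hk

/-- Keeping only the atom at `k` in the integral of the nonnegative function M - f(x + ·) shows how
near-maximality at x passes to x + k. -/
lemma avg_le_point {ν : Measure ℤ} [IsProbabilityMeasure ν] {f : ℤ → ℝ} {x : ℤ} {M : ℝ}
    (hf : Integrable (fun k => f (x + k)) ν) (h : ∀ y, f y ≤ M) (k : ℤ) :
    ν.real {k} * (M - f (x + k)) ≤ M - avg ν f x := by
  have h1 : M - avg ν f x = ∫ j, (M - f (x + j)) ∂ν := by
    rw [integral_sub (integrable_const M) hf]; simp [avg]
  rw [h1]
  have hi : Integrable (fun j => M - f (x + j)) ν := (integrable_const M).sub hf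
  calc ν.real {k} * (M - f (x + k)) = ∫ j in ({k} : Set ℤ), (M - f (x + j)) ∂ν := by
        rw [integral_singleton]; simp
    _ ≤ _ := setIntegral_le_integral hi (ae_of_all _ fun j => by simpa using h (x + j))

lemma real_singleton_pos {ν : Measure ℤ} [IsFiniteMeasure ν] {k : ℤ} (hk : ν {k} ≠ 0) :
    0 < ν.real {k} :=
  ENNReal.toReal_pos hk (measure_ne_top _ _)

/-- The increment in direction `k` is again bounded and harmonic. If its supremum M were positive, a
nearly maximal point would be followed by many points y, y + k, y + 2k, … where the increment is
still at least M/2, and u would outgrow its bound. -/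
lemma harmonic_increment_le {ν : Measure ℤ} [IsProbabilityMeasure ν] {u : ℤ → ℝ} {C : ℝ}
    (hC : ∀ x, |u x| ≤ C) (hu : ∀ x, avg ν u x = u x) {k : ℤ} (hk : ν {k} ≠ 0) (x : ℤ) :
    u (x + k) - u x ≤ 0 := by
  set v : ℤ → ℝ := fun x => u (x + k) - u x with hv
  have hvC : ∀ x, |v x| ≤ 2 * C := fun x => by
    have h1 := abs_le.1 (hC (x + k)); have h2 := abs_le.1 (hC x)
    rw [abs_le]; constructor <;> simp only [hv] <;> linarith
  have hvh : ∀ x, avg ν v x = v x := fun x => by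
    rw [hv, avg_sub (integrable_shift_of_abs_le (fun y => hC (y + k)) x)
      (integrable_shift_of_abs_le hC x), avg_comp_add, hu, hu]
  have hbdd : BddAbove (Set.range v) := ⟨2 * C, by rintro _ ⟨y, rfl⟩; exact (abs_le.1 (hvC y)).2⟩
  set M := ⨆ y, v y with hM
  have hvM : ∀ y, v y ≤ M := fun y => le_ciSup hbdd y
  by_contra hx
  have hMpos : 0 < M := lt_of_lt_of_le (not_le.1 hx) (hvM x)
  set p := ν.real {k} with hp
  have hp0 : 0 < p := real_singleton_pos hk
  -- J increments of size M/2 exceed 2C, the largest possible oscillation of u.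
  obtain ⟨J, hJ⟩ := exists_nat_gt (2 * (2 * C + 1) / M)
  have hJ' : 2 * (2 * C + 1) < J * M := by rwa [div_lt_iff₀ hMpos] at hJ
  have hp1 : p ≤ 1 := measureReal_le_one
  -- A step by `k` multiplies the deficit M - v by at most 1/p, so a deficit below p^J M/2 stays at
  -- most M/2 for J steps.
  obtain ⟨y, hy⟩ : ∃ y, M - p ^ J * (M / 2) < v y := by
    apply exists_lt_of_lt_ciSup
    have : 0 < p ^ J * (M / 2) := by positivity
    linarith
  have key : ∀ j : ℕ, p ^ j * (M - v (y + j * k)) ≤ p ^ J * (M / 2) := by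
    intro j
    induction j with
    | zero => simp; linarith
    | succ j ih =>
      have h1 := avg_le_point (ν := ν) (f := v) (x := y + j * k) (M := M)
        (integrable_shift_of_abs_le hvC _) hvM k
      rw [hvh] at h1
      have h2 : y + ((j + 1 : ℕ) : ℤ) * k = y + j * k + k := by push_cast; ring
      rw [h2, pow_succ]
      calc p ^ j * p * (M - v (y + j * k + k)) = p ^ j * (p * (M - v (y + j * k + k))) := by ring
        _ ≤ p ^ j * (M - v (y + j * k)) := by gcongr
        _ ≤ _ := ih
  have key2 : ∀ j : ℕ, j ≤ J → M / 2 ≤ v (y + j * k) := by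
    intro j hj
    have h1 := key j
    have h2 : p ^ J ≤ p ^ j := pow_le_pow_of_le_one hp0.le hp1 hj
    have h3 : p ^ j * (M - v (y + j * k)) ≤ p ^ j * (M / 2) :=
      h1.trans (by gcongr)
    have := le_of_mul_le_mul_left h3 (by positivity)
    linarith
  have key3 : ∀ j : ℕ, j ≤ J → j * (M / 2) ≤ u (y + j * k) - u y := by
    intro j
    induction j with
    | zero => simp
    | succ j ih =>
      intro hj
      have h1 := ih (by omega)
      have h2 := key2 j (by omega)
      have h3 : y + ((j + 1 : ℕ) : ℤ) * k = y + j * k + k := by push_cast; ring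
      rw [h3]
      simp only [hv] at h2
      push_cast; linarith
  have h1 := key3 J le_rfl
  have h2 := abs_le.1 (hC (y + J * k)); have h3 := abs_le.1 (hC y)
  linarith

/-- Bounded harmonic functions are constant. -/
theorem harmonic_bounded_const {ν : Measure ℤ} [IsProbabilityMeasure ν]
    (hgen : AddSubgroup.closure {k : ℤ | ν {k} ≠ 0} = ⊤) {u : ℤ → ℝ} {C : ℝ}
    (hC : ∀ x, |u x| ≤ C) (hu : ∀ x, avg ν u x = u x) (x : ℤ) : u x = u 0 := by
  -- The periods of u form a subgroup. It contains the support of `ν`, by the increment bound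
  -- applied to u and to -u.
  let S : AddSubgroup ℤ :=
    { carrier := {k | ∀ x, u (x + k) = u x}
      zero_mem' := by simp
      add_mem' := by
        intro a b ha hb x
        rw [← add_assoc, hb, ha]
      neg_mem' := by
        intro a ha x
        have := ha (x + -a)
        simpa using this.symm }
  have hS : AddSubgroup.closure {k : ℤ | ν {k} ≠ 0} ≤ S := by
    rw [AddSubgroup.closure_le]
    intro k hk x
    refine le_antisymm (sub_nonpos.1 (harmonic_increment_le hC hu hk x)) ?_
    have h1 : ∀ x, avg ν (fun y => -u y) x = -u x := fun x => by
      simp only [avg, integral_neg]; rw [← hu x, avg]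
    have := harmonic_increment_le (u := fun y => -u y) (C := C) (by simpa using hC) h1 hk x
    linarith
  have : x ∈ S := hS (by rw [hgen]; trivial)
  simpa using this 0

/-- The unit increment is bounded and harmonic, hence constant, so f is affine; sublinearity along
the positive integers kills the slope. -/
theorem harmonic_linGrowth_const {ν : Measure ℤ} [IsProbabilityMeasure ν]
    (hint : Integrable (fun k : ℤ => (k : ℝ)) ν)
    (hgen : AddSubgroup.closure {k : ℤ | ν {k} ≠ 0} = ⊤) {f : ℤ → ℝ} {C : ℝ}
    (hC : ∀ x, |f (x + 1) - f x| ≤ C) (hlin : LinGrowth f) (hf : ∀ x, avg ν f x = f x)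
    (ho : Tendsto (fun n : ℕ => f n / n) atTop (𝓝 0)) (x : ℤ) : f x = f 0 := by
  set u : ℤ → ℝ := fun x => f (x + 1) - f x with hu
  have hl1 : ∀ x, Integrable (fun k => f (x + k)) ν := hlin.integrable_shift hint
  have hh : ∀ x, avg ν u x = u x := fun x => by
    rw [hu, avg_sub (f := fun y => f (y + 1)) (by simpa only [add_right_comm] using hl1 (x + 1))
      (hl1 x), avg_comp_add, hf, hf]
  have hconst := harmonic_bounded_const hgen hC hh
  have hlinear : ∀ x : ℤ, f x = f 0 + u 0 * x := by
    intro x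
    induction x using Int.induction_on with
    | zero => simp
    | succ n ih =>
      have := hconst n
      simp only [hu, zero_add] at this ih ⊢
      push_cast; push_cast at ih; linarith
    | pred n ih =>
      have := hconst (-n - 1)
      simp only [hu, zero_add, sub_add_cancel] at this ih ⊢
      push_cast at ih ⊢; linarith
  have h0 : u 0 = 0 := by
    have h1 : Tendsto (fun n : ℕ => f 0 / n + u 0) atTop (𝓝 (0 + u 0)) :=
      (tendsto_const_div_atTop_nhds_zero_nat _).add_const _
    have h2 : Tendsto (fun n : ℕ => f n / n) atTop (𝓝 (0 + u 0)) := by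
      refine h1.congr' ?_
      filter_upwards [eventually_gt_atTop 0] with n hn
      have : (n : ℝ) ≠ 0 := by positivity
      rw [hlinear n]; field_simp; push_cast; ring
    have := tendsto_nhds_unique h2 ho
    linarith
  rw [hlinear x, h0]; ring

/-! ### Return probabilities -/

/-- `ret ν n x` is the probability that the walk started at `x` is at `0` at time `n`. -/
def ret (ν : Measure ℤ) : ℕ → ℤ → ℝ
  | 0 => fun x => if x = 0 then 1 else 0
  | n + 1 => avg ν (ret ν n)

/-- Expected number of visits to `0` up to time `n`. -/
def green (ν : Measure ℤ) (n : ℕ) (x : ℤ) : ℝ := ∑ i ∈ Finset.range (n + 1), ret ν i x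

section
variable {ν : Measure ℤ} [IsProbabilityMeasure ν]

lemma ret_nonneg (n : ℕ) (x : ℤ) : 0 ≤ ret ν n x := by
  induction n generalizing x with
  | zero => simp only [ret]; split_ifs <;> norm_num
  | succ n ih => exact avg_nonneg ih x

lemma abs_ret_le (n : ℕ) (x : ℤ) : |ret ν n x| ≤ 1 := by
  induction n generalizing x with
  | zero => simp only [ret]; split_ifs <;> norm_num
  | succ n ih => exact abs_avg_le ih x

lemma green_nonneg (n : ℕ) (x : ℤ) : 0 ≤ green ν n x :=
  Finset.sum_nonneg fun i _ => ret_nonneg i x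

lemma abs_green_le (n : ℕ) (x : ℤ) : |green ν n x| ≤ n + 1 := by
  refine (Finset.abs_sum_le_sum_abs _ _).trans ?_
  refine (Finset.sum_le_sum fun i _ => abs_ret_le i x).trans ?_
  simp

lemma green_succ (n : ℕ) (x : ℤ) :
    green ν (n + 1) x = (if x = 0 then 1 else 0) + avg ν (green ν n) x := by
  rw [green, Finset.sum_range_succ']
  have : avg ν (green ν n) x = ∑ i ∈ Finset.range (n + 1), ret ν (i + 1) x := by
    simp only [avg, green, ret]
    exact integral_finsetSum _ fun i _ => integrable_shift_of_abs_le (abs_ret_le i) x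
  rw [this, add_comm]; rfl

lemma green_mono {m n : ℕ} (h : m ≤ n) (x : ℤ) : green ν m x ≤ green ν n x := by
  refine Finset.sum_le_sum_of_subset_of_nonneg ?_ fun i _ _ => ret_nonneg i x
  exact Finset.range_subset_range.2 (by omega)

lemma green_zero (x : ℤ) : green ν 0 x = if x = 0 then 1 else 0 := by simp [green, ret]

/-- Away from 0 no visit is counted at time 0, so the count is an average of counts over one step
fewer. -/
lemma green_le_green_zero (n : ℕ) (x : ℤ) : green ν n x ≤ green ν n 0 := by
  induction n generalizing x with
  | zero => simp only [green_zero]; split_ifs <;> norm_num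
  | succ n ih =>
    by_cases hx : x = 0
    · rw [hx]
    · rw [green_succ, if_neg hx, zero_add]
      exact (avg_le_of_le (integrable_shift_of_abs_le (abs_green_le n) x) ih).trans
        (green_mono (Nat.le_succ n) 0)

/-- Partial sums of the potential series. -/
def partialPot (ν : Measure ℤ) (n : ℕ) (x : ℤ) : ℝ := green ν n 0 - green ν n x

lemma partialPot_nonneg (n : ℕ) (x : ℤ) : 0 ≤ partialPot ν n x :=
  sub_nonneg.2 (green_le_green_zero n x)

lemma partialPot_zero_right (n : ℕ) : partialPot ν n 0 = 0 := sub_self _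

/-- A maximum principle in n. At x = 0 the increment is `partialPot ν n z`; elsewhere it is an
average of earlier increments, minus 1 if x + z = 0. Thus a uniform bound at the single point z
controls the increments by z everywhere. -/
lemma partialPot_increment_le {z : ℤ} {C : ℝ} (hC : ∀ n, partialPot ν n z ≤ C) (n : ℕ) (x : ℤ) :
    partialPot ν n (x + z) - partialPot ν n x ≤ C := by
  have hrw : ∀ n x, partialPot ν n (x + z) - partialPot ν n x = green ν n x - green ν n (x + z) :=
    fun n x => by simp only [partialPot]; ring
  have hC0 : 0 ≤ C := (partialPot_nonneg 0 z).trans (hC 0)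
  by_cases hx : x = 0
  · subst hx; simpa [partialPot_zero_right] using hC n
  induction n generalizing x with
  | zero =>
    rw [hrw, green_zero, green_zero, if_neg hx]
    split_ifs <;> linarith
  | succ n ih =>
    have ih' : ∀ x, green ν n x - green ν n (x + z) ≤ C := fun x => by
      rw [← hrw]
      by_cases hx : x = 0
      · subst hx; simpa [partialPot_zero_right] using hC n
      · exact ih x hx
    rw [hrw, green_succ, green_succ, if_neg hx, ← avg_comp_add]
    have h1 := avg_sub (g := fun y => green ν n (y + z))
      (integrable_shift_of_abs_le (ν := ν) (abs_green_le (ν := ν) n) x)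
      (integrable_shift_of_abs_le (f := fun y => green ν n (y + z))
        (fun y => abs_green_le (ν := ν) n (y + z)) x)
    have h2 : avg ν (fun y => green ν n y - green ν n (y + z)) x ≤ C :=
      avg_le_of_le ((integrable_shift_of_abs_le (abs_green_le n) x).sub
        (integrable_shift_of_abs_le (f := fun y => green ν n (y + z))
        (fun y => abs_green_le n (y + z)) x)) ih'
    split_ifs <;> linarith

/-- This is the equation of the potential with an error `ret ν (n + 1) x`, which disappears in the
limit. -/
lemma avg_partialPot (n : ℕ) (x : ℤ) :
    avg ν (partialPot ν n) x = partialPot ν n x + (if x = 0 then 1 else 0) - ret ν (n + 1) x := by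
  have h1 : avg ν (partialPot ν n) x = green ν n 0 - avg ν (green ν n) x := by
    rw [show partialPot ν n = fun y => green ν n 0 - green ν n y from rfl,
      avg_sub (integrable_const _) (integrable_shift_of_abs_le (abs_green_le n) x), avg_const]
  have h2 := green_succ (ν := ν) n x
  have h3 : green ν (n + 1) x = green ν n x + ret ν (n + 1) x := by
    rw [green, Finset.sum_range_succ]; rfl
  rw [h1, partialPot]; linarith

/-- A bounded nonnegative function that is subharmonic for the walk killed on a nonempty set
vanishes, provided the expected number of visits to each point is infinite. -/
theorem killed_subharmonic_eq_zero
    (hgen : AddSubgroup.closure {k : ℤ | ν {k} ≠ 0} = ⊤)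
    (hrec : ∀ x, Tendsto (fun n => green ν n x) atTop atTop)
    {D : Set ℤ} (hD : D.Nonempty) {v : ℤ → ℝ} {C : ℝ}
    (h0 : ∀ x, 0 ≤ v x) (hC : ∀ x, v x ≤ C) (hv : ∀ x, v x ≤ avg ν (Dᶜ.indicator v) x) (x : ℤ) :
    v x = 0 := by
  set w := Dᶜ.indicator v with hw
  have hw0 : ∀ x, 0 ≤ w x := fun x => Set.indicator_nonneg (fun y _ => h0 y) x
  have hwv : ∀ x, w x ≤ v x := fun x => Set.indicator_le_self' (fun _ _ => h0 _) x
  have hwC : ∀ x, |w x| ≤ C := fun x => by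
    rw [abs_of_nonneg (hw0 x)]; exact (hwv x).trans (hC x)
  have hint : ∀ x, Integrable (fun k => w (x + k)) ν := integrable_shift_of_abs_le hwC
  have hsub : ∀ x, w x ≤ avg ν w x := fun x => (hwv x).trans (hv x)
  -- A strict gain b at y would be collected at each visit to y. Hence w plus b times the expected
  -- number of visits to y would stay bounded, against recurrence.
  have key : ∀ y, avg ν w y - w y ≤ 0 := by
    intro y
    by_contra hb
    set b := avg ν w y - w y with hbdef
    have hb0 : 0 < b := not_le.1 hb
    have hind : ∀ n x, w x + b * green ν n (x - y) ≤ C := by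
      intro n
      have hstep : ∀ x, w x + b * (if x - y = 0 then 1 else 0) ≤ avg ν w x := by
        intro x
        split_ifs with hxy
        · have : x = y := by omega
          subst this
          linarith
        · simpa using hsub x
      induction n with
      | zero =>
        intro x
        rw [green_zero]
        exact (hstep x).trans ((le_abs_self _).trans (abs_avg_le hwC x))
      | succ n ih =>
        intro x
        have hgi : Integrable (fun k => green ν n (x - y + k)) ν :=
          integrable_shift_of_abs_le (abs_green_le n) _
        have h1 : avg ν w x + b * avg ν (green ν n) (x - y) ≤ C := by
          have h2 : avg ν w x + b * avg ν (green ν n) (x - y)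
              = ∫ k, (w (x + k) + b * green ν n (x - y + k)) ∂ν := by
            rw [integral_add (hint x) (hgi.const_mul b), integral_const_mul]; rfl
          rw [h2]
          have h3 := integral_mono ((hint x).add (hgi.const_mul b)) (integrable_const C)
            (fun k => by
              have := ih (x + k)
              rwa [show x + k - y = x - y + k by ring] at this)
          simpa using h3
        have h4 := hstep x
        rw [green_succ]
        nlinarith
    have ht := (hrec (y - y)).const_mul_atTop hb0
    obtain ⟨n, hn⟩ := (ht.eventually (eventually_gt_atTop C)).exists
    have := hind n y
    linarith [hw0 y]
  -- So w is bounded and harmonic, hence constant, and it vanishes on D.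
  have hharm : ∀ x, avg ν w x = w x := fun x => le_antisymm (by linarith [key x]) (hsub x)
  obtain ⟨d, hd⟩ := hD
  have hconst := harmonic_bounded_const hgen hwC hharm
  have hwd : w d = 0 := by simp [hw, hd]
  have hwx : ∀ x, w x = 0 := fun x => by rw [hconst x, ← hconst d, hwd]
  exact le_antisymm ((hv x).trans (by rw [hharm, hwx])) (h0 x)

end

/-! ### Characteristic function -/

/-- `e^{iu}`. -/
def cis (u : ℝ) : ℂ := Complex.exp (u * Complex.I)

lemma cis_re (u : ℝ) : (cis u).re = Real.cos u := Complex.exp_ofReal_mul_I_re u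
lemma cis_im (u : ℝ) : (cis u).im = Real.sin u := Complex.exp_ofReal_mul_I_im u
lemma norm_cis (u : ℝ) : ‖cis u‖ = 1 := Complex.norm_exp_ofReal_mul_I u
lemma cis_add (u v : ℝ) : cis (u + v) = cis u * cis v := by
  simp only [cis, Complex.ofReal_add, add_mul, Complex.exp_add]
lemma cis_zero : cis 0 = 1 := by simp [cis]

lemma continuous_cis : Continuous cis := by
  unfold cis; fun_prop

/-- The characteristic function of the step law. -/
def chf (ν : Measure ℤ) (t : ℝ) : ℂ := ∫ k : ℤ, cis (t * k) ∂ν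

section
variable {ν : Measure ℤ} [IsProbabilityMeasure ν]

lemma integrable_cis (t : ℝ) : Integrable (fun k : ℤ => cis (t * k)) ν :=
  Integrable.of_bound (measurable_of_countable _).aestronglyMeasurable 1
    (ae_of_all _ fun _ => (norm_cis _).le)

lemma norm_chf_le (t : ℝ) : ‖chf ν t‖ ≤ 1 := by
  refine (norm_integral_le_integral_norm _).trans ?_
  simp [norm_cis]

lemma continuous_chf : Continuous (chf ν) := by
  refine continuous_of_dominated (bound := fun _ => 1)
    (fun t => (measurable_of_countable _).aestronglyMeasurable)
    (fun t => ae_of_all _ fun k => (norm_cis _).le) (integrable_const _)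
    (ae_of_all _ fun k => ?_)
  exact continuous_cis.comp (by fun_prop)

lemma chf_re (t : ℝ) : (chf ν t).re = ∫ k : ℤ, Real.cos (t * k) ∂ν := by
  have := integral_re (integrable_cis (ν := ν) t)
  simp only [RCLike.re_eq_complex_re, cis_re] at this
  exact this.symm

lemma continuous_ret_integrand (n : ℕ) (x : ℤ) :
    Continuous fun t : ℝ => (cis (t * x) * chf ν t ^ n).re :=
  Complex.continuous_re.comp
    ((continuous_cis.comp (by fun_prop)).mul (continuous_chf.pow n))

/-- Fourier inversion for the return probabilities. -/
theorem ret_eq_integral (n : ℕ) (x : ℤ) :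
    ret ν n x = (1 / Real.pi) * ∫ t in (0 : ℝ)..Real.pi, (cis (t * x) * chf ν t ^ n).re := by
  induction n generalizing x with
  | zero =>
    simp only [ret, pow_zero, mul_one, cis_re]
    split_ifs with hx
    · subst hx; simp
    · have hx' : (x : ℝ) ≠ 0 := by exact_mod_cast hx
      rw [intervalIntegral.integral_comp_mul_right (fun u => Real.cos u) hx']
      simp [mul_comm Real.pi, Real.sin_int_mul_pi]
  | succ n ih =>
    have h1 : ret ν (n + 1) x = ∫ k : ℤ, (1 / Real.pi) *
        (∫ t in (0 : ℝ)..Real.pi, (cis (t * (x + k : ℤ)) * chf ν t ^ n).re) ∂ν := by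
      simp only [ret, avg]; exact integral_congr_ae (ae_of_all _ fun k => ih (x + k))
    rw [h1, integral_const_mul]
    congr 1
    rw [← intervalIntegral_integral_swap]
    · refine intervalIntegral.integral_congr fun t _ => ?_
      have h2 : ∀ k : ℤ, cis (t * (x + k : ℤ)) * chf ν t ^ n
          = (cis (t * x) * chf ν t ^ n) * cis (t * k) := fun k => by
        push_cast; rw [mul_add, cis_add]; ring
      have h3 := integral_re ((integrable_cis (ν := ν) t).const_mul (cis (t * x) * chf ν t ^ n))
      simp only [RCLike.re_eq_complex_re] at h3
      simp only [h2]
      rw [h3, integral_const_mul, pow_succ, chf]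
      ring_nf
    · have : IsFiniteMeasure (volume.restrict (Set.uIoc 0 Real.pi)) :=
        ⟨by simp [Set.uIoc, Real.volume_Ioc]⟩
      refine Integrable.of_bound (C := 1) ?_ (ae_of_all _ fun p => ?_)
      · refine Measurable.aestronglyMeasurable ?_
        refine measurable_from_prod_countable_left fun k => ?_
        exact (continuous_ret_integrand n (x + k)).measurable
      · refine (Complex.abs_re_le_norm _).trans ?_
        rw [norm_mul, norm_cis, one_mul, norm_pow]
        exact pow_le_one₀ (norm_nonneg _) (norm_chf_le _)

lemma cis_eq_one_of_chf_eq_one {t : ℝ} (h : chf ν t = 1) {k : ℤ} (hk : ν {k} ≠ 0) :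
    cis (t * k) = 1 := by
  have hre : ∫ j : ℤ, (1 - Real.cos (t * j)) ∂ν = 0 := by
    rw [integral_sub (integrable_const _), ← chf_re, h]
    · simp
    · exact integrable_of_abs_le fun j => Real.abs_cos_le_one _
  have h2 := (integral_eq_zero_iff_of_nonneg
    (fun j => sub_nonneg.2 (Real.cos_le_one _))
    (integrable_of_abs_le (C := 2) fun j => by
      have := Real.cos_le_one (t * j); have := Real.neg_one_le_cos (t * j)
      rw [abs_le]; constructor <;> linarith)).1 hre
  rw [Filter.EventuallyEq, ae_iff_of_countable] at h2
  have h3 : 1 - Real.cos (t * k) = 0 := h2 k hk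
  have h4 : Real.cos (t * k) = 1 := by linarith
  have h5 : Real.sin (t * k) = 0 := Real.sin_eq_zero_iff_cos_eq.2 (Or.inl h4)
  apply Complex.ext <;> simp [cis_re, cis_im, h4, h5]

/-- φ(t) = 1 forces exp(itk) = 1 on the support, hence on the subgroup it generates. That subgroup
contains 1, which excludes 0 < t ≤ π. -/
lemma chf_ne_one (hν : CenteredLaw ν) {t : ℝ} (h0 : 0 < t) (hπ : t ≤ Real.pi) : chf ν t ≠ 1 := by
  intro h
  let S : AddSubgroup ℤ :=
    { carrier := {k | cis (t * k) = 1}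
      zero_mem' := by simp [cis_zero]
      add_mem' := by
        intro a b ha hb
        simp only [Set.mem_ofPred_eq] at ha hb ⊢
        push_cast; rw [mul_add, cis_add, ha, hb, one_mul]
      neg_mem' := by
        intro a ha
        simp only [Set.mem_ofPred_eq] at ha ⊢
        have := cis_add (t * a) (t * (-a : ℤ))
        rw [ha, one_mul] at this
        rw [← this]; push_cast; rw [← mul_add]; simp [cis_zero] }
  have hS : AddSubgroup.closure {k : ℤ | ν {k} ≠ 0} ≤ S := by
    rw [AddSubgroup.closure_le]
    exact fun k hk => cis_eq_one_of_chf_eq_one h hk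
  have h1 : (1 : ℤ) ∈ S := hS (by rw [hν.gen]; trivial)
  have h2 : cis (t * (1 : ℤ)) = 1 := h1
  have h3 := congrArg Complex.re h2
  rw [cis_re] at h3
  simp only [Int.cast_one, mul_one, Complex.one_re] at h3
  have h4 := Real.cos_lt_cos_of_nonneg_of_le_pi le_rfl hπ h0
  rw [Real.cos_zero] at h4
  linarith

lemma not_ae_zero (hν : CenteredLaw ν) : ¬ ∀ᵐ k ∂ν, k = 0 := by
  intro h
  have : ∫⁻ k, ENNReal.ofReal ((k : ℝ) ^ 2) ∂ν = 0 := by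
    rw [lintegral_eq_zero_iff (measurable_of_countable _)]
    filter_upwards [h] with k hk
    simp [hk]
  rw [hν.variance] at this
  exact ENNReal.top_ne_zero this

lemma exists_pos_supp (hν : CenteredLaw ν) : ∃ k : ℤ, 0 < k ∧ ν {k} ≠ 0 := by
  by_contra! hcon
  apply not_ae_zero hν
  have h1 : ∀ᵐ k : ℤ ∂ν, (0 : ℝ) ≤ -(k : ℝ) := by
    rw [ae_iff_of_countable]
    intro k hk
    by_contra hk'
    refine hk (hcon k ?_)
    have : (0 : ℝ) < k := by linarith
    exact_mod_cast this
  have h2 := (integral_eq_zero_iff_of_nonneg_ae h1 hν.integrable.neg).1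
    (by simpa [hν.mean] using integral_neg (μ := ν) (fun k : ℤ => (k : ℝ)))
  filter_upwards [h2] with k hk
  simpa using hk

lemma exists_neg_supp (hν : CenteredLaw ν) : ∃ k : ℤ, k < 0 ∧ ν {k} ≠ 0 := by
  by_contra! hcon
  apply not_ae_zero hν
  have h1 : ∀ᵐ k : ℤ ∂ν, (0 : ℝ) ≤ (k : ℝ) := by
    rw [ae_iff_of_countable]
    intro k hk
    by_contra hk'
    refine hk (hcon k ?_)
    have : (k : ℝ) < 0 := by linarith
    exact_mod_cast this
  have h2 := (integral_eq_zero_iff_of_nonneg_ae h1 hν.integrable).1 hν.mean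
  filter_upwards [h2] with k hk
  simpa using hk

/-- Equality in the triangle inequality would make exp(itk) agree at a positive and at a negative
support point, which happens only for countably many t. Periodic walks are allowed, so exceptional t
may exist. -/
lemma ae_norm_chf_lt_one (hν : CenteredLaw ν) : ∀ᵐ t : ℝ, ‖chf ν t‖ < 1 := by
  obtain ⟨k, hk0, hk⟩ := exists_pos_supp hν
  obtain ⟨l, hl0, hl⟩ := exists_neg_supp hν
  have hd : ((k - l : ℤ) : ℝ) ≠ 0 := by
    have : k - l ≠ 0 := by omega
    exact_mod_cast this
  have hcount : (Set.range fun n : ℤ => n * (2 * Real.pi) / ((k - l : ℤ) : ℝ)).Countable :=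
    Set.countable_range _
  refine (hcount.ae_notMem volume).mono fun t ht => ?_
  have := ae_eq_const_or_norm_integral_lt_of_norm_le_const (μ := ν) (C := 1)
    (f := fun k : ℤ => cis (t * k)) (ae_of_all _ fun k => (norm_cis _).le)
  rcases this with h | h
  · exfalso
    apply ht
    rw [Filter.EventuallyEq, ae_iff_of_countable] at h
    have h1 : cis (t * k) = cis (t * l) := (h k hk).trans (h l hl).symm
    rw [cis, cis, Complex.exp_eq_exp_iff_exists_int] at h1
    obtain ⟨n, hn⟩ := h1
    refine ⟨n, ?_⟩
    have h2 := congrArg Complex.im hn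
    simp at h2
    rw [div_eq_iff hd]; push_cast; linarith
  · simpa [chf] using h

/-- Dominated convergence in the inversion formula, since |φ| < 1 almost everywhere; aperiodicity is
not needed. -/
theorem tendsto_ret (hν : CenteredLaw ν) (x : ℤ) :
    Tendsto (fun n => ret ν n x) atTop (𝓝 0) := by
  have h0 : Tendsto (fun n => ∫ t in (0 : ℝ)..Real.pi, (cis (t * x) * chf ν t ^ n).re) atTop
      (𝓝 (∫ t in (0 : ℝ)..Real.pi, (0 : ℝ))) := by
    refine intervalIntegral.tendsto_integral_filter_of_dominated_convergence (fun _ => 1)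
      (Eventually.of_forall fun n => (continuous_ret_integrand n x).aestronglyMeasurable)
      (Eventually.of_forall fun n => ae_of_all _ fun t _ => ?_)
      (by simp) ?_
    · refine (Complex.abs_re_le_norm _).trans ?_
      rw [norm_mul, norm_cis, one_mul, norm_pow]
      exact pow_le_one₀ (norm_nonneg _) (norm_chf_le _)
    · filter_upwards [ae_norm_chf_lt_one hν] with t ht _
      have h1 : Tendsto (fun n => chf ν t ^ n) atTop (𝓝 0) :=
        tendsto_pow_atTop_nhds_zero_of_norm_lt_one ht
      have h2 := (Complex.continuous_re.tendsto _).comp (h1.const_mul (cis (t * x)))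
      simpa [Function.comp_def] using h2
  have h1 := h0.const_mul (1 / Real.pi)
  simp only [ret_eq_integral]
  simpa using h1

/-! ### Lower bounds for `1 - φ` -/

lemma one_sub_chf_re (t : ℝ) : (1 - chf ν t).re = ∫ k : ℤ, (1 - Real.cos (t * k)) ∂ν := by
  rw [integral_sub (integrable_const _), ← chf_re]
  · simp
  · exact integrable_of_abs_le fun j => Real.abs_cos_le_one _

lemma exists_truncated_variance_ge (hν : CenteredLaw ν) (L : ℝ) :
    ∃ n : ℕ, L ≤ ∫ k in Set.Icc (-n : ℤ) n, (k : ℝ) ^ 2 ∂ν := by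
  have hc : AECover ν atTop fun n : ℕ => Set.Icc (-n : ℤ) n :=
    aecover_Icc (tendsto_neg_atTop_atBot.comp tendsto_natCast_atTop_atTop)
      tendsto_natCast_atTop_atTop
  have h := hc.lintegral_tendsto_of_countably_generated
    (f := fun k : ℤ => ENNReal.ofReal ((k : ℝ) ^ 2)) (measurable_of_countable _).aemeasurable
  rw [hν.variance] at h
  obtain ⟨n, hn⟩ := (h.eventually (lt_mem_nhds (ENNReal.ofReal_lt_top (r := L)))).exists
  refine ⟨n, ?_⟩
  have hint : IntegrableOn (fun k : ℤ => (k : ℝ) ^ 2) (Set.Icc (-n : ℤ) n) ν := by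
    refine Measure.integrableOn_of_bounded (M := (n : ℝ) ^ 2) (measure_ne_top _ _)
      (measurable_of_countable _).aestronglyMeasurable ?_
    refine (ae_restrict_mem measurableSet_Icc).mono fun k hk => ?_
    have h1 : (-n : ℝ) ≤ k := by exact_mod_cast hk.1
    have h2 : (k : ℝ) ≤ n := by exact_mod_cast hk.2
    rw [Real.norm_eq_abs, abs_of_nonneg (sq_nonneg _)]
    exact sq_le_sq' h1 h2
  have h3 := ofReal_integral_eq_lintegral_ofReal hint (ae_of_all _ fun k => sq_nonneg _)
  rw [← h3] at hn
  exact (ENNReal.ofReal_le_ofReal_iff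
    (integral_nonneg fun k => sq_nonneg _)).1 hn.le

/-- Since the variance is infinite, `|1 - φ(t)|` is of larger order than `t²`. -/
theorem exists_sq_le_norm_one_sub_chf (hν : CenteredLaw ν) (L : ℝ) :
    ∃ δ > 0, ∀ t : ℝ, |t| ≤ δ → L * t ^ 2 ≤ ‖1 - chf ν t‖ := by
  -- The factor π²/2 compensates 1 - cos u ≥ 2u²/π², valid for |u| ≤ π; the choice of δ below keeps
  -- |tk| ≤ π for |k| ≤ n.
  obtain ⟨n, hn⟩ := exists_truncated_variance_ge hν (L * (Real.pi ^ 2 / 2))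
  refine ⟨Real.pi / (n + 1), by positivity, fun t ht => ?_⟩
  refine le_trans ?_ ((le_abs_self _).trans (Complex.abs_re_le_norm _))
  rw [one_sub_chf_re]
  have hi : Integrable (fun k : ℤ => 1 - Real.cos (t * k)) ν :=
    integrable_of_abs_le (C := 2) fun j => by
      have := Real.cos_le_one (t * j); have := Real.neg_one_le_cos (t * j)
      rw [abs_le]; constructor <;> linarith
  have h1 : ∫ k in Set.Icc (-n : ℤ) n, (2 / Real.pi ^ 2 * t ^ 2) * (k : ℝ) ^ 2 ∂ν
      ≤ ∫ k in Set.Icc (-n : ℤ) n, (1 - Real.cos (t * k)) ∂ν := by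
    refine setIntegral_mono_on_ae ?_ hi.integrableOn measurableSet_Icc (ae_of_all _ fun k hk => ?_)
    · refine Integrable.const_mul ?_ _
      refine Measure.integrableOn_of_bounded (M := (n : ℝ) ^ 2) (measure_ne_top _ _)
        (measurable_of_countable _).aestronglyMeasurable ?_
      refine (ae_restrict_mem measurableSet_Icc).mono fun k hk => ?_
      have h1 : (-n : ℝ) ≤ k := by exact_mod_cast hk.1
      have h2 : (k : ℝ) ≤ n := by exact_mod_cast hk.2
      rw [Real.norm_eq_abs, abs_of_nonneg (sq_nonneg _)]
      exact sq_le_sq' h1 h2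
    · have h1 : (-n : ℝ) ≤ k := by exact_mod_cast hk.1
      have h2 : (k : ℝ) ≤ n := by exact_mod_cast hk.2
      have h3 : |t * k| ≤ Real.pi := by
        rw [abs_mul]
        calc |t| * |(k : ℝ)| ≤ Real.pi / (n + 1) * (n + 1) := by
              gcongr; exact (abs_le.2 ⟨h1, h2⟩).trans (by linarith)
          _ = Real.pi := by field_simp
      have := Real.cos_le_one_sub_mul_cos_sq h3
      calc 2 / Real.pi ^ 2 * t ^ 2 * (k : ℝ) ^ 2 = 2 / Real.pi ^ 2 * (t * k) ^ 2 := by ring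
        _ ≤ _ := by linarith
  rw [integral_const_mul] at h1
  have h2 : ∫ k in Set.Icc (-n : ℤ) n, (1 - Real.cos (t * k)) ∂ν ≤ ∫ k : ℤ, (1 - Real.cos (t * k)) ∂ν :=
    setIntegral_le_integral hi (ae_of_all _ fun k => sub_nonneg.2 (Real.cos_le_one _))
  have h3 : L * t ^ 2 = (2 / Real.pi ^ 2 * t ^ 2) * (L * (Real.pi ^ 2 / 2)) := by
    field_simp
  rw [h3]
  exact (mul_le_mul_of_nonneg_left hn (by positivity)).trans (h1.trans h2)

/-- Near 0 this is the infinite-variance bound; on the rest of (0, π] it is compactness together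
with φ ≠ 1. -/
theorem exists_norm_one_sub_chf_ge (hν : CenteredLaw ν) :
    ∃ c > 0, ∀ t : ℝ, 0 < t → t ≤ Real.pi → c * t ^ 2 ≤ ‖1 - chf ν t‖ := by
  obtain ⟨δ, hδ, h⟩ := exists_sq_le_norm_one_sub_chf hν 1
  have hcont : Continuous fun t => ‖1 - chf ν t‖ := (continuous_const.sub continuous_chf).norm
  by_cases hδπ : Real.pi ≤ δ
  · refine ⟨1, one_pos, fun t h0 hπ => h t ?_⟩
    rw [abs_of_pos h0]; linarith
  obtain ⟨t0, ht0, hmin⟩ := (isCompact_Icc (a := δ) (b := Real.pi)).exists_isMinOn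
    ⟨δ, le_rfl, (not_le.1 hδπ).le⟩ hcont.continuousOn
  have hpos : 0 < ‖1 - chf ν t0‖ :=
    norm_pos_iff.2 (sub_ne_zero.2 (chf_ne_one hν (hδ.trans_le ht0.1) ht0.2).symm)
  refine ⟨min 1 (‖1 - chf ν t0‖ / Real.pi ^ 2), by positivity, fun t h0 hπ => ?_⟩
  rcases le_total t δ with htd | htd
  · refine le_trans ?_ (h t (by rwa [abs_of_pos h0]))
    gcongr; exact min_le_left _ _
  · refine le_trans ?_ (hmin ⟨htd, hπ⟩ : ‖1 - chf ν t0‖ ≤ _)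
    calc min 1 (‖1 - chf ν t0‖ / Real.pi ^ 2) * t ^ 2
        ≤ (‖1 - chf ν t0‖ / Real.pi ^ 2) * Real.pi ^ 2 := by
          gcongr; exact min_le_right _ _
      _ = _ := by field_simp

/-! ### Upper bounds for the partial sums of the potential -/

lemma one_sub_cos_le (u : ℝ) : 1 - Real.cos u ≤ u ^ 2 / 2 := by
  have := Real.one_sub_sq_div_two_le_cos (x := u); linarith

/-- The factor t² cancels the lower bound for |1 - φ(t)|, and what remains is the derivative of an
arctangent, with integral O(|x|). -/
lemma one_sub_cos_div_le (x t : ℝ) :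
    1 - Real.cos (t * x) ≤ t ^ 2 * (4 * x ^ 2 * (1 + (t * x) ^ 2)⁻¹) := by
  have h1 := one_sub_cos_le (t * x)
  have h2 := Real.neg_one_le_cos (t * x)
  have h3 : 0 < 1 + (t * x) ^ 2 := by positivity
  rw [show t ^ 2 * (4 * x ^ 2 * (1 + (t * x) ^ 2)⁻¹) = (4 * (t * x) ^ 2) / (1 + (t * x) ^ 2) by
    field_simp, le_div_iff₀ h3]
  set u := (t * x) ^ 2
  have hu : 0 ≤ u := sq_nonneg _
  by_cases h : u ≤ 1
  · nlinarith
  · nlinarith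

lemma integral_fejer_le (x : ℝ) :
    ∫ t in (0 : ℝ)..Real.pi, 4 * x ^ 2 * (1 + (t * x) ^ 2)⁻¹ ≤ 2 * Real.pi * |x| := by
  by_cases hx : x = 0
  · simp [hx]
  rw [intervalIntegral.integral_const_mul,
    intervalIntegral.integral_comp_mul_right (fun u => (1 + u ^ 2)⁻¹) hx, integral_inv_one_add_sq]
  simp only [zero_mul, Real.arctan_zero, sub_zero, smul_eq_mul]
  have h1 : 4 * x ^ 2 * (x⁻¹ * Real.arctan (Real.pi * x)) = 4 * (x * Real.arctan (Real.pi * x)) := by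
    field_simp
  rw [h1]
  have h2 : |Real.arctan (Real.pi * x)| ≤ Real.pi / 2 :=
    abs_le.2 ⟨(Real.neg_pi_div_two_lt_arctan _).le, (Real.arctan_lt_pi_div_two _).le⟩
  have h3 : x * Real.arctan (Real.pi * x) ≤ |x| * (Real.pi / 2) := by
    refine (le_abs_self _).trans ?_
    rw [abs_mul]; gcongr
  linarith

lemma green_eq_integral (n : ℕ) (x : ℤ) :
    green ν n x = (1 / Real.pi) * ∫ t in (0 : ℝ)..Real.pi,
      (cis (t * x) * ∑ i ∈ Finset.range (n + 1), chf ν t ^ i).re := by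
  simp only [green, ret_eq_integral, Finset.mul_sum, Complex.re_sum]
  rw [intervalIntegral.integral_finsetSum, Finset.mul_sum]
  exact fun i _ => (continuous_ret_integrand i x).intervalIntegrable _ _

/-- Adding the values at x and -x cancels the sine terms and leaves 1 - cos, which is of second
order at t = 0. -/
lemma partialPot_add_neg (n : ℕ) (x : ℤ) :
    partialPot ν n x + partialPot ν n (-x) = (1 / Real.pi) * ∫ t in (0 : ℝ)..Real.pi,
      2 * (1 - Real.cos (t * x)) * (∑ i ∈ Finset.range (n + 1), chf ν t ^ i).re := by
  have hc : ∀ x : ℤ, IntervalIntegrable (fun t : ℝ =>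
      (cis (t * x) * ∑ i ∈ Finset.range (n + 1), chf ν t ^ i).re) volume 0 Real.pi := fun x => by
    apply Continuous.intervalIntegrable
    exact Complex.continuous_re.comp ((continuous_cis.comp (by fun_prop)).mul
      (continuous_finsetSum _ fun i _ => continuous_chf.pow i))
  have h1 : partialPot ν n x + partialPot ν n (-x)
      = 2 * green ν n 0 - (green ν n x + green ν n (-x)) := by simp only [partialPot]; ring
  rw [h1, green_eq_integral, green_eq_integral, green_eq_integral, ← mul_add,
    ← intervalIntegral.integral_add (hc x) (hc (-x)), mul_left_comm,
    ← intervalIntegral.integral_const_mul, ← mul_sub, ← intervalIntegral.integral_sub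
    ((hc 0).const_mul 2) ((hc x).add (hc (-x)))]
  congr 1
  refine intervalIntegral.integral_congr fun t _ => ?_
  simp only [Complex.mul_re, cis_re, cis_im]
  simp
  ring

/-- The absolute Fourier integral controlling `a(x) + a(-x)`. -/
def fourierBound (ν : Measure ℤ) (x : ℤ) : ℝ :=
  ∫ t in (0 : ℝ)..Real.pi, (1 - Real.cos (t * x)) / ‖1 - chf ν t‖

lemma intervalIntegrable_fourierBound (hν : CenteredLaw ν) (x : ℤ) :
    IntervalIntegrable (fun t : ℝ => (1 - Real.cos (t * x)) / ‖1 - chf ν t‖) volume 0 Real.pi := by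
  obtain ⟨c, hc, h⟩ := exists_norm_one_sub_chf_ge hν
  rw [intervalIntegrable_iff_integrableOn_Ioc_of_le Real.pi_pos.le]
  refine Measure.integrableOn_of_bounded (M := x ^ 2 / 2 / c) (by simp)
    ((measurable_const.sub (Real.measurable_cos.comp (measurable_id.mul_const _))).div
      (continuous_const.sub continuous_chf).norm.measurable).aestronglyMeasurable ?_
  refine (ae_restrict_mem measurableSet_Ioc).mono fun t ht => ?_
  have h1 := h t ht.1 ht.2
  have h2 : 0 < c * t ^ 2 := by have := ht.1; positivity
  rw [Real.norm_eq_abs, abs_of_nonneg (div_nonneg (sub_nonneg.2 (Real.cos_le_one _)) (norm_nonneg _)),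
    div_le_iff₀ (h2.trans_le h1)]
  calc 1 - Real.cos (t * x) ≤ (t * x) ^ 2 / 2 := one_sub_cos_le _
    _ = x ^ 2 / 2 / c * (c * t ^ 2) := by field_simp
    _ ≤ _ := by gcongr

/-- The geometric sum of powers of φ is at most 2/|1 - φ| in modulus whatever its length, so the
bound is uniform in n. -/
theorem partialPot_add_neg_le (hν : CenteredLaw ν) (n : ℕ) (x : ℤ) :
    partialPot ν n x + partialPot ν n (-x) ≤ (4 / Real.pi) * fourierBound ν x := by
  rw [partialPot_add_neg, fourierBound, show 4 / Real.pi = (1 / Real.pi) * 4 by ring, mul_assoc]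
  refine mul_le_mul_of_nonneg_left ?_ (by positivity : (0 : ℝ) ≤ 1 / Real.pi)
  rw [← intervalIntegral.integral_const_mul]
  refine intervalIntegral.integral_mono_on_of_le_Ioo Real.pi_pos.le ?_
    ((intervalIntegrable_fourierBound hν x).const_mul 4) fun t ht => ?_
  · apply Continuous.intervalIntegrable
    exact (by fun_prop : Continuous fun t : ℝ => 2 * (1 - Real.cos (t * x))).mul
      (Complex.continuous_re.comp (continuous_finsetSum _ fun i _ => continuous_chf.pow i))
  · have hne : chf ν t ≠ 1 := chf_ne_one hν ht.1 ht.2.le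
    have h1 : (∑ i ∈ Finset.range (n + 1), chf ν t ^ i).re ≤ 2 / ‖1 - chf ν t‖ := by
      refine (Complex.re_le_norm _).trans ?_
      rw [geom_sum_eq hne, norm_div, norm_sub_rev (chf ν t) 1]
      gcongr
      refine (norm_sub_le _ _).trans ?_
      rw [norm_pow, norm_one]
      have := pow_le_one₀ (n := n + 1) (norm_nonneg _) (norm_chf_le (ν := ν) t)
      linarith
    have h2 : 0 ≤ 1 - Real.cos (t * x) := sub_nonneg.2 (Real.cos_le_one _)
    calc 2 * (1 - Real.cos (t * x)) * (∑ i ∈ Finset.range (n + 1), chf ν t ^ i).re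
        ≤ 2 * (1 - Real.cos (t * x)) * (2 / ‖1 - chf ν t‖) := by gcongr
      _ = _ := by ring

theorem fourierBound_le (hν : CenteredLaw ν) {ε : ℝ} (hε : 0 < ε) :
    ∃ C, ∀ x : ℤ, fourierBound ν x ≤ ε * |(x : ℝ)| + C := by
  obtain ⟨c, hc, h⟩ := exists_norm_one_sub_chf_ge hν
  -- With the constant 2π/ε the low frequencies contribute at most ε/(2π) times 2π|x|; frequencies
  -- above δ contribute a constant.
  obtain ⟨δ, hδ, hL⟩ := exists_sq_le_norm_one_sub_chf hν (2 * Real.pi / ε)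
  have hπ := Real.pi_pos
  refine ⟨Real.pi * (2 / (c * δ ^ 2)), fun x => ?_⟩
  set F : ℝ → ℝ := fun t => 4 * (x : ℝ) ^ 2 * (1 + (t * x) ^ 2)⁻¹ with hF
  have hFc : Continuous F := by
    refine continuous_const.mul (Continuous.inv₀ (by fun_prop) fun t => ?_)
    positivity
  have hF0 : ∀ t, 0 ≤ F t := fun t => by positivity
  have hi1 : IntervalIntegrable (fun t => ε / (2 * Real.pi) * F t) volume 0 Real.pi :=
    (continuous_const.mul hFc).intervalIntegrable _ _
  have h1 : fourierBound ν x
      ≤ ∫ t in (0 : ℝ)..Real.pi, (ε / (2 * Real.pi) * F t + 2 / (c * δ ^ 2)) := by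
    refine intervalIntegral.integral_mono_on_of_le_Ioo Real.pi_pos.le
      (intervalIntegrable_fourierBound hν x) (hi1.add (by simp)) fun t ht => ?_
    have h0 : 0 ≤ 1 - Real.cos (t * x) := sub_nonneg.2 (Real.cos_le_one _)
    have ht0 := ht.1
    rcases le_total t δ with htd | htd
    · have h2 := hL t (by rwa [abs_of_pos ht.1])
      have h3 : 0 < 2 * Real.pi / ε * t ^ 2 := by positivity
      have h4 := one_sub_cos_div_le x t
      calc (1 - Real.cos (t * x)) / ‖1 - chf ν t‖
          ≤ (t ^ 2 * F t) / (2 * Real.pi / ε * t ^ 2) := by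
            gcongr
        _ = ε / (2 * Real.pi) * F t := by field_simp
        _ ≤ _ := by
            have : 0 ≤ 2 / (c * δ ^ 2) := by positivity
            linarith
    · have h2 := h t ht.1 ht.2.le
      have h3 := Real.neg_one_le_cos (t * x)
      have h4 : (1 - Real.cos (t * x)) / ‖1 - chf ν t‖ ≤ 2 / (c * δ ^ 2) := by
        gcongr
        · linarith
        · exact le_trans (by gcongr) h2
      have : 0 ≤ ε / (2 * Real.pi) * F t := mul_nonneg (by positivity) (hF0 t)
      linarith
  refine h1.trans ?_
  rw [intervalIntegral.integral_add hi1 (by simp), intervalIntegral.integral_const_mul,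
    intervalIntegral.integral_const, sub_zero, smul_eq_mul]
  have h5 := integral_fejer_le x
  have h6 : ε / (2 * Real.pi) * ∫ t in (0 : ℝ)..Real.pi, F t
      ≤ ε / (2 * Real.pi) * (2 * Real.pi * |(x : ℝ)|) := by gcongr
  have h7 : ε / (2 * Real.pi) * (2 * Real.pi * |(x : ℝ)|) = ε * |(x : ℝ)| := by field_simp
  linarith

theorem partialPot_le (hν : CenteredLaw ν) {ε : ℝ} (hε : 0 < ε) :
    ∃ C, ∀ n x, partialPot ν n x ≤ ε * |(x : ℝ)| + C := by
  obtain ⟨C, hC⟩ := fourierBound_le hν (ε := ε * Real.pi / 4) (by positivity)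
  refine ⟨4 / Real.pi * C, fun n x => ?_⟩
  have h1 := partialPot_add_neg_le hν n x
  have h2 := partialPot_nonneg (ν := ν) n (-x)
  have h3 : 4 / Real.pi * fourierBound ν x ≤ 4 / Real.pi * (ε * Real.pi / 4 * |(x : ℝ)| + C) := by
    gcongr; exact hC x
  have h4 : 4 / Real.pi * (ε * Real.pi / 4 * |(x : ℝ)| + C) = ε * |(x : ℝ)| + 4 / Real.pi * C := by
    field_simp
  linarith

end

/-! ### Convergence of the potential series -/

/-- Functions that are `o(|x|)` at infinity. -/
def SubLinear (f : ℤ → ℝ) : Prop := ∀ ε > 0, ∃ C, ∀ x : ℤ, |f x| ≤ ε * |(x : ℝ)| + C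

lemma SubLinear.linGrowth {f : ℤ → ℝ} (h : SubLinear f) : LinGrowth f := by
  obtain ⟨C, hC⟩ := h 1 one_pos
  have h0 : 0 ≤ C := by have := hC 0; simp at this; exact (abs_nonneg _).trans this
  refine ⟨1 + C, fun x => (hC x).trans ?_⟩
  have := abs_nonneg (x : ℝ)
  nlinarith

lemma SubLinear.tendsto_div {f : ℤ → ℝ} (h : SubLinear f) :
    Tendsto (fun n : ℕ => f n / n) atTop (𝓝 0) := by
  rw [Metric.tendsto_atTop]
  intro ε hε
  obtain ⟨C, hC⟩ := h (ε / 2) (half_pos hε)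
  obtain ⟨N, hN⟩ := exists_nat_gt (2 * C / ε)
  refine ⟨N + 1, fun n hn => ?_⟩
  have hn0 : (0 : ℝ) < n := by exact_mod_cast (by omega : 0 < n)
  have hn1 : (N : ℝ) < n := by exact_mod_cast (by omega : N < n)
  rw [Real.dist_eq, sub_zero, abs_div, abs_of_pos hn0, div_lt_iff₀ hn0]
  have h1 := hC n
  rw [Int.cast_natCast, abs_of_pos hn0] at h1
  have h2 : 2 * C / ε < n := hN.trans hn1
  rw [div_lt_iff₀ hε] at h2
  nlinarith

section
variable {ν : Measure ℤ} [IsProbabilityMeasure ν]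

theorem harmonic_subLinear_const (hν : CenteredLaw ν) {f : ℤ → ℝ} {C : ℝ}
    (hC : ∀ x, |f (x + 1) - f x| ≤ C) (hs : SubLinear f) (hf : ∀ x, avg ν f x = f x) (x : ℤ) :
    f x = f 0 :=
  harmonic_linGrowth_const hν.integrable hν.gen hC hs.linGrowth hf hs.tendsto_div x

lemma tendsto_avg (hν : CenteredLaw ν) {f : ℕ → ℤ → ℝ} {g : ℤ → ℝ} {C : ℝ}
    (hC : ∀ n x, |f n x| ≤ C * (1 + |(x : ℝ)|)) (hf : ∀ x, Tendsto (fun n => f n x) atTop (𝓝 (g x)))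
    (x : ℤ) : Tendsto (fun n => avg ν (f n) x) atTop (𝓝 (avg ν g x)) := by
  refine tendsto_integral_of_dominated_convergence
    (fun k : ℤ => C * (1 + |((x + k : ℤ) : ℝ)|))
    (fun n => (measurable_of_countable _).aestronglyMeasurable) ?_
    (fun n => ae_of_all _ fun k => by simpa using hC n (x + k)) (ae_of_all _ fun k => hf (x + k))
  have hlin : LinGrowth fun y : ℤ => C * (1 + |(y : ℝ)|) := by
    refine ⟨|C|, fun y => ?_⟩
    rw [abs_mul, abs_of_nonneg (by positivity : (0 : ℝ) ≤ 1 + |(y : ℝ)|)]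
  exact hlin.integrable_shift hν.integrable x

/-- The one-sided maximum principle is used for z and for -z; the pointwise bound it needs at these
points is sublinear and uniform in n. -/
lemma partialPot_increment_bound (hν : CenteredLaw ν) {ε : ℝ} (hε : 0 < ε) :
    ∃ C, ∀ n x z, |partialPot ν n (x + z) - partialPot ν n x| ≤ ε * |(z : ℝ)| + C := by
  obtain ⟨C, hC⟩ := partialPot_le hν hε
  refine ⟨C, fun n x z => abs_le.2 ⟨?_, partialPot_increment_le (fun m => hC m z) n x⟩⟩
  have h1 := partialPot_increment_le (fun m => hC m (-z)) n (x + z)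
  rw [add_neg_cancel_right] at h1
  push_cast at h1
  rw [abs_neg] at h1
  linarith

lemma partialPot_abs_le (hν : CenteredLaw ν) {ε : ℝ} (hε : 0 < ε) :
    ∃ C, ∀ n x, |partialPot ν n x| ≤ ε * |(x : ℝ)| + C := by
  obtain ⟨C, hC⟩ := partialPot_le hν hε
  exact ⟨C, fun n x => by rw [abs_of_nonneg (partialPot_nonneg n x)]; exact hC n x⟩

/-- The properties shared by all subsequential limits of the potential series. -/
structure IsPot (ν : Measure ℤ) (f : ℤ → ℝ) : Prop where
  zero : f 0 = 0
  nonneg : ∀ x, 0 ≤ f x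
  increment : ∀ ε > 0, ∃ C, ∀ x z : ℤ, |f (x + z) - f x| ≤ ε * |(z : ℝ)| + C
  avg_eq : ∀ x, avg ν f x = f x + if x = 0 then 1 else 0

lemma IsPot.subLinear {f : ℤ → ℝ} (hf : IsPot ν f) : SubLinear f := fun ε hε => by
  obtain ⟨C, hC⟩ := hf.increment ε hε
  exact ⟨C, fun x => by simpa [hf.zero] using hC 0 x⟩

/-- The linear majorant is integrable because the steps have a mean, so the averages pass to the
limit, and the error term of `avg_partialPot` tends to 0. -/
lemma isPot_of_subseq (hν : CenteredLaw ν) {ψ : ℕ → ℕ} (hψ : Tendsto ψ atTop atTop) {f : ℤ → ℝ}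
    (hf : ∀ x, Tendsto (fun n => partialPot ν (ψ n) x) atTop (𝓝 (f x))) : IsPot ν f := by
  refine ⟨?_, fun x => ge_of_tendsto' (hf x) fun n => partialPot_nonneg _ x, fun ε hε => ?_,
    fun x => ?_⟩
  · refine tendsto_nhds_unique (hf 0) ?_
    simp [partialPot_zero_right]
  · obtain ⟨C, hC⟩ := partialPot_increment_bound hν hε
    exact ⟨C, fun x z => le_of_tendsto' ((hf (x + z)).sub (hf x)).abs fun n => hC _ x z⟩
  · obtain ⟨C, hC⟩ := partialPot_abs_le hν one_pos
    have hC0 : 0 ≤ C := by have := hC 0 0; simp [partialPot_zero_right] at this; exact this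
    have h1 := tendsto_avg hν (f := fun n => partialPot ν (ψ n)) (C := 1 + C) (fun n x => by
      refine (hC _ x).trans ?_
      have := abs_nonneg (x : ℝ)
      nlinarith) hf x
    refine tendsto_nhds_unique h1 ?_
    simp only [avg_partialPot]
    have h2 := (tendsto_ret hν x).comp ((tendsto_add_atTop_nat 1).comp hψ)
    simpa [Function.comp_def] using ((hf x).add_const (if x = 0 then (1 : ℝ) else 0)).sub h2

/-- The difference of two solutions is harmonic, as the sources at 0 cancel. It is sublinear with
bounded increments, hence constant, and it vanishes at 0. -/
lemma IsPot.unique (hν : CenteredLaw ν) {f g : ℤ → ℝ} (hf : IsPot ν f) (hg : IsPot ν g) : f = g := by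
  obtain ⟨C, hC⟩ := hf.increment 1 one_pos
  obtain ⟨C', hC'⟩ := hg.increment 1 one_pos
  have hs : SubLinear fun x => f x - g x := fun ε hε => by
    obtain ⟨A, hA⟩ := hf.subLinear (ε / 2) (half_pos hε)
    obtain ⟨A', hA'⟩ := hg.subLinear (ε / 2) (half_pos hε)
    refine ⟨A + A', fun x => (abs_sub _ _).trans ?_⟩
    linarith [hA x, hA' x]
  have hi : ∀ {h : ℤ → ℝ}, IsPot ν h → ∀ x, Integrable (fun k => h (x + k)) ν :=
    fun h => h.subLinear.linGrowth.integrable_shift hν.integrable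
  have h1 := harmonic_subLinear_const hν (f := fun x => f x - g x)
    (C := (1 * |((1 : ℤ) : ℝ)| + C) + (1 * |((1 : ℤ) : ℝ)| + C')) (fun x => by
      have h2 := abs_sub (f (x + 1) - f x) (g (x + 1) - g x)
      have h3 := hC x 1
      have h4 := hC' x 1
      rw [show f (x + 1) - g (x + 1) - (f x - g x) = (f (x + 1) - f x) - (g (x + 1) - g x) by ring]
      linarith) hs
    (fun x => by rw [avg_sub (hi hf x) (hi hg x), hf.avg_eq, hg.avg_eq]; ring)
  funext x
  have := h1 x
  simp only [hf.zero, hg.zero, sub_zero] at this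
  linarith

/-- A sequence of functions bounded pointwise has a pointwise convergent subsequence. -/
lemma exists_subseq_tendsto {f : ℕ → ℤ → ℝ} {B : ℤ → ℝ} (h : ∀ n x, |f n x| ≤ B x) :
    ∃ g : ℤ → ℝ, ∃ ψ : ℕ → ℕ, StrictMono ψ ∧ ∀ x, Tendsto (fun n => f (ψ n) x) atTop (𝓝 (g x)) := by
  have hK : IsCompact (Set.univ.pi fun x : ℤ => Set.Icc (-B x) (B x)) :=
    isCompact_univ_pi fun x => isCompact_Icc
  obtain ⟨g, -, ψ, hψ, hg⟩ := hK.tendsto_subseq (x := f) fun n x _ => abs_le.1 (h n x)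
  exact ⟨g, ψ, hψ, fun x => (tendsto_pi_nhds.1 hg) x⟩

/-- The potential function of the walk with step law `ν`. -/
def pot (ν : Measure ℤ) (x : ℤ) : ℝ := limUnder atTop fun n => partialPot ν n x

/-- Pointwise compactness plus uniqueness of the subsequential limit. -/
theorem tendsto_partialPot (hν : CenteredLaw ν) (x : ℤ) :
    Tendsto (fun n => partialPot ν n x) atTop (𝓝 (pot ν x)) := by
  obtain ⟨C, hC⟩ := partialPot_abs_le hν one_pos
  obtain ⟨f, ψ, hψ, hf⟩ := exists_subseq_tendsto hC
  have hpot := isPot_of_subseq hν hψ.tendsto_atTop hf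
  have : Tendsto (fun n => partialPot ν n x) atTop (𝓝 (f x)) := by
    refine tendsto_of_subseq_tendsto fun ns hns => ?_
    obtain ⟨g, χ, hχ, hg⟩ := exists_subseq_tendsto (f := fun n => partialPot ν (ns n))
      fun n => hC (ns n)
    have hg' := isPot_of_subseq hν (hns.comp hχ.tendsto_atTop) hg
    refine ⟨χ, ?_⟩
    rw [hpot.unique hν hg']
    exact hg x
  exact tendsto_nhds_limUnder ⟨_, this⟩

theorem isPot_pot (hν : CenteredLaw ν) : IsPot ν (pot ν) :=
  isPot_of_subseq hν tendsto_id (tendsto_partialPot hν)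

lemma pot_zero (hν : CenteredLaw ν) : pot ν 0 = 0 := (isPot_pot hν).zero
lemma pot_nonneg (hν : CenteredLaw ν) (x : ℤ) : 0 ≤ pot ν x := (isPot_pot hν).nonneg x
lemma avg_pot (hν : CenteredLaw ν) (x : ℤ) :
    avg ν (pot ν) x = pot ν x + if x = 0 then 1 else 0 := (isPot_pot hν).avg_eq x
lemma subLinear_pot (hν : CenteredLaw ν) : SubLinear (pot ν) := (isPot_pot hν).subLinear
lemma linGrowth_pot (hν : CenteredLaw ν) : LinGrowth (pot ν) := (subLinear_pot hν).linGrowth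
lemma integrable_pot_shift (hν : CenteredLaw ν) (x : ℤ) :
    Integrable (fun k => pot ν (x + k)) ν := (linGrowth_pot hν).integrable_shift hν.integrable x

/-- Since the variance is infinite, the increments of the potential vanish at infinity. -/
theorem tendsto_pot_increment (hν : CenteredLaw ν) (z : ℤ) :
    Tendsto (fun y : ℤ => pot ν (y + z) - pot ν y) (atBot ⊔ atTop) (𝓝 0) := by
  refine tendsto_of_subseq_tendsto fun ns hns => ?_
  have hP := isPot_pot hν
  obtain ⟨C, hC⟩ := hP.increment 1 one_pos
  -- D is a profile of the potential seen from far away. Its source has escaped to infinity, so D is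
  -- harmonic; being sublinear it is constant, with value D 0 = 0.
  obtain ⟨D, χ, hχ, hD⟩ := exists_subseq_tendsto (f := fun n z => pot ν (ns n + z) - pot ν (ns n))
    fun n z => hC (ns n) z
  refine ⟨χ, ?_⟩
  suffices D z = 0 by rw [← this]; exact hD z
  have hC0 : 0 ≤ C := by simpa using hC 0 0
  have hs : SubLinear D := fun ε hε => by
    obtain ⟨C, hC⟩ := hP.increment ε hε
    exact ⟨C, fun x => le_of_tendsto' (hD x).abs fun n => hC _ x⟩
  have h0 : D 0 = 0 := tendsto_nhds_unique (hD 0) (by simp)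
  have hh : ∀ x, avg ν D x = D x := fun x => by
    have h1 := tendsto_avg hν (f := fun n z => pot ν (ns (χ n) + z) - pot ν (ns (χ n)))
      (C := 1 + C) (fun n x => by
        refine (hC _ x).trans ?_
        have := abs_nonneg (x : ℝ)
        nlinarith) hD x
    refine tendsto_nhds_unique h1 ((hD x).congr' ?_)
    have h2 : ∀ᶠ y : ℤ in atBot ⊔ atTop, y ≠ -x :=
      eventually_sup.2 ⟨eventually_ne_atBot _, eventually_ne_atTop _⟩
    filter_upwards [(hns.comp hχ.tendsto_atTop).eventually h2] with n hn
    have h3 : avg ν (fun z => pot ν (ns (χ n) + z)) x = avg ν (pot ν) (ns (χ n) + x) := by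
      simp only [avg, add_assoc]
    have hn' : ns (χ n) + x ≠ 0 := fun h => hn (by simp only [Function.comp]; omega)
    rw [avg_sub (f := fun z => pot ν (ns (χ n) + z))
      (by simpa only [add_assoc] using integrable_pot_shift hν (ns (χ n) + x))
      (integrable_const _), h3, avg_const, avg_pot hν, if_neg hn', add_zero]
  have h3 := harmonic_subLinear_const hν (C := 1 * |((1 : ℤ) : ℝ)| + C) (fun x => by
    refine le_of_tendsto' ((hD (x + 1)).sub (hD x)).abs fun n => ?_
    have := hC (ns (χ n) + x) 1
    rw [← add_assoc, sub_sub_sub_cancel_right]; exact this) hs hh z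
  rw [h3, h0]

/-! ### A lower bound from a tent function, and recurrence -/

/-- The truncated second moment `E[|X| min(|X|, N)]`. -/
def truncMoment (ν : Measure ℤ) (N : ℝ) : ℝ := ∫ k : ℤ, |(k : ℝ)| * min |(k : ℝ)| N ∂ν

lemma integrable_truncMoment {ν : Measure ℤ} (hint : Integrable (fun k : ℤ => (k : ℝ)) ν) {N : ℝ}
    (hN : 0 ≤ N) : Integrable (fun k : ℤ => |(k : ℝ)| * min |(k : ℝ)| N) ν := by
  refine (hint.abs.mul_const N).mono' (measurable_of_countable _).aestronglyMeasurable
    (ae_of_all _ fun k => ?_)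
  rw [Real.norm_eq_abs, abs_of_nonneg (mul_nonneg (abs_nonneg _) (le_min (abs_nonneg _) hN))]
  gcongr
  exact min_le_right _ _

/-- A discrete Taylor estimate at the zeros 0 and 1, by induction in both directions on the pair
(first difference, value). -/
lemma second_difference_bound {c : ℤ → ℝ} {K : ℝ} {N : ℕ} (h0 : c 0 = 0) (h1 : c 1 = 0)
    (h2 : ∀ j : ℤ, |j| ≤ N → |c (j + 2) - 2 * c (j + 1) + c j| ≤ K) (k : ℤ) (hk : |k| ≤ N) :
    |c k| ≤ K * (k : ℝ) ^ 2 := by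
  have hK : 0 ≤ K := (abs_nonneg _).trans (h2 0 (by simp))
  have hpos : ∀ j : ℕ, j ≤ N → |c (j + 1) - c j| ≤ K * j ∧ |c j| ≤ K * (j : ℝ) ^ 2 := by
    intro j
    induction j with
    | zero => intro _; simp [h0, h1]
    | succ j ih =>
      intro hj
      obtain ⟨ih1, ih2⟩ := ih (by omega)
      have h3 := h2 j (by rw [abs_of_nonneg (by omega)]; exact_mod_cast (by omega : j ≤ N))
      rw [abs_le] at *
      push_cast
      rw [show (j : ℤ) + 1 + 1 = j + 2 by ring]
      refine ⟨⟨by linarith, by linarith⟩, ?_⟩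
      rw [abs_le]
      constructor <;> nlinarith
  have hneg : ∀ j : ℕ, j ≤ N → |c (-j + 1) - c (-j)| ≤ K * j ∧ |c (-j)| ≤ K * (j : ℝ) ^ 2 := by
    intro j
    induction j with
    | zero => intro _; simp [h0, h1]
    | succ j ih =>
      intro hj
      obtain ⟨ih1, ih2⟩ := ih (by omega)
      have h3 := h2 (-(j + 1)) (by rw [abs_neg, abs_of_nonneg (by omega)]; exact_mod_cast hj)
      rw [show -((j : ℤ) + 1) + 2 = -j + 1 by ring, show -((j : ℤ) + 1) + 1 = -j by ring] at h3
      rw [abs_le] at *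
      push_cast
      rw [show -((j : ℤ) + 1) + 1 = -j by ring]
      refine ⟨⟨by linarith, by linarith⟩, ?_⟩
      rw [abs_le]
      constructor <;> nlinarith
  rcases le_total 0 k with hk0 | hk0
  · lift k to ℕ using hk0
    have : k ≤ N := by rw [abs_of_nonneg (by omega)] at hk; exact_mod_cast hk
    exact_mod_cast (hpos k this).2
  · obtain ⟨j, rfl⟩ : ∃ j : ℕ, k = -j := ⟨k.natAbs, by omega⟩
    have : j ≤ N := by rw [abs_neg, abs_of_nonneg (by omega)] at hk; exact_mod_cast hk
    simpa using (hneg j this).2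

/-- The equation for a is summed against the tent of width N. The sources contribute N in total,
while the sum has second differences that telescope to three values of a, so a Taylor bound turns a
bound M on a into a bound by M times the truncated moment. -/
theorem le_truncMoment_of_isPot (hν : CenteredLaw ν) {a : ℤ → ℝ} (hlin : LinGrowth a)
    (havg : ∀ x, avg ν a x = a x + if x = 0 then 1 else 0) {N : ℕ} (hN : 0 < N) {M : ℝ}
    (hM : ∀ x : ℤ, |x| ≤ 3 * N → |a x| ≤ M)
    (hM' : ∀ x k : ℤ, |a (x + k) - a x| ≤ M * (|(k : ℝ)| / N + 1)) :
    (N : ℝ) ≤ 4 * M * truncMoment ν N := by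
  have hM0 : 0 ≤ M := (abs_nonneg _).trans (hM 0 (by simp))
  have hN0 : (0 : ℝ) < N := by exact_mod_cast hN
  -- The double sum over i - l carries tent weights. For each l exactly one i satisfies i = l, so
  -- every l contributes 1 to the mean of b.
  set b : ℤ → ℝ := fun k => ∑ l ∈ Finset.range N, ∑ i ∈ Finset.range N,
    (a ((i : ℤ) - l + k) - a ((i : ℤ) - l)) with hb
  have hint : ∀ x, Integrable (fun k => a (x + k)) ν := hlin.integrable_shift hν.integrable
  have hterm : ∀ x, Integrable (fun k => a (x + k) - a x) ν := fun x =>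
    (hint x).sub (integrable_const _)
  have hrow : ∀ l : ℕ, Integrable (fun k => ∑ i ∈ Finset.range N,
      (a ((i : ℤ) - l + k) - a ((i : ℤ) - l))) ν := fun l =>
    integrable_finsetSum _ fun i _ => hterm ((i : ℤ) - l)
  have hbint : Integrable b ν := integrable_finsetSum _ fun l _ => hrow l
  have hbsum : ∫ k, b k ∂ν = N := by
    rw [integral_finsetSum _ fun l _ => hrow l]
    have : ∀ l ∈ Finset.range N, ∫ k, ∑ i ∈ Finset.range N,
        (a ((i : ℤ) - l + k) - a ((i : ℤ) - l)) ∂ν = 1 := by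
      intro l hl
      rw [integral_finsetSum _ fun (i : ℕ) _ => hterm ((i : ℤ) - l)]
      have h1 : ∀ i ∈ Finset.range N, ∫ k, (a ((i : ℤ) - l + k) - a ((i : ℤ) - l)) ∂ν
          = if i = l then 1 else 0 := by
        intro i _
        rw [integral_sub (hint _) (integrable_const _)]
        have := havg ((i : ℤ) - l)
        rw [avg] at this
        rw [this]
        have h2 : ((i : ℤ) - l = 0) ↔ i = l := by omega
        simp [h2]
      rw [Finset.sum_congr rfl h1, Finset.sum_ite_eq' _ l, if_pos hl]
    rw [Finset.sum_congr rfl this]; simp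
  have hb0 : b 0 = 0 := by simp [hb]
  have hβ : ∀ j, b (j + 1) - b j = ∑ l ∈ Finset.range N, (a ((N : ℤ) - l + j) - a (-(l : ℤ) + j)) := by
    intro j
    simp only [hb, ← Finset.sum_sub_distrib]
    refine Finset.sum_congr rfl fun l _ => ?_
    have h1 := Finset.sum_range_sub (fun i : ℕ => a ((i : ℤ) - l + j)) N
    simp only [Nat.cast_zero, zero_sub] at h1
    rw [← h1]
    refine Finset.sum_congr rfl fun i _ => ?_
    rw [show (i : ℤ) - l + (j + 1) = ((i + 1 : ℕ) : ℤ) - l + j by push_cast; ring]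
    ring
  have hβ2 : ∀ j, b (j + 2) - 2 * b (j + 1) + b j
      = a (N + j + 1) - 2 * a (j + 1) + a (j + 1 - N) := by
    intro j
    have h1 : b (j + 2) - 2 * b (j + 1) + b j = (b (j + 1 + 1) - b (j + 1)) - (b (j + 1) - b j) := by
      rw [show j + 1 + 1 = j + 2 by ring]; ring
    rw [h1, hβ, hβ, ← Finset.sum_sub_distrib]
    have h2 := Finset.sum_range_sub' (fun l : ℕ => a ((N : ℤ) - l + (j + 1)) - a (-(l : ℤ) + (j + 1))) N
    simp only [Nat.cast_zero, sub_zero, sub_self, neg_zero, zero_add] at h2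
    rw [show a (N + j + 1) - 2 * a (j + 1) + a (j + 1 - N)
      = a (N + (j + 1)) - a (j + 1) - (a (j + 1) - a (-(N : ℤ) + (j + 1))) by
        rw [show (N : ℤ) + j + 1 = N + (j + 1) by ring, show j + 1 - (N : ℤ) = -N + (j + 1) by ring]
        ring, ← h2]
    refine Finset.sum_congr rfl fun l _ => ?_
    rw [show (N : ℤ) - ((l + 1 : ℕ) : ℤ) + (j + 1) = N - l + j by push_cast; ring,
      show -((l + 1 : ℕ) : ℤ) + (j + 1) = -l + j by push_cast; ring]
  have hb1 : |b 1| ≤ 2 * M * N := by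
    have h1 := hβ 0
    rw [hb0, sub_zero, zero_add] at h1
    rw [h1]
    refine (Finset.abs_sum_le_sum_abs _ _).trans ?_
    have h2 : ∀ l ∈ Finset.range N, |a ((N : ℤ) - l + 0) - a (-(l : ℤ) + 0)| ≤ 2 * M := by
      intro l hl
      have hl' := Finset.mem_range.1 hl
      have h3 := hM ((N : ℤ) - l + 0) (by rw [abs_le]; omega)
      have h4 := hM (-(l : ℤ) + 0) (by rw [abs_le]; omega)
      have h5 := abs_sub (a ((N : ℤ) - l + 0)) (a (-(l : ℤ) + 0))
      linarith
    refine (Finset.sum_le_sum h2).trans ?_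
    simp; linarith
  -- Subtracting a linear function does not change the mean, since the steps are centred, and makes
  -- c vanish at both 0 and 1.
  set c : ℤ → ℝ := fun k => b k - k * b 1 with hc
  have hcint : ∫ k, c k ∂ν = N := by
    rw [hc, integral_sub hbint (hν.integrable.mul_const _), hbsum, integral_mul_const, hν.mean]
    ring
  have hcb : ∀ k : ℤ, |c k| ≤ 4 * M * (|(k : ℝ)| * min |(k : ℝ)| N) := by
    intro k
    rcases le_or_gt |k| (N : ℤ) with hk | hk
    · have hkN : |(k : ℝ)| ≤ N := by exact_mod_cast hk
      rw [min_eq_left hkN, ← sq, sq_abs]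
      refine second_difference_bound (N := N) (by simp [hc, hb0]) (by simp [hc]) (fun j hj => ?_) k hk
      have h1 : c (j + 2) - 2 * c (j + 1) + c j = b (j + 2) - 2 * b (j + 1) + b j := by
        simp only [hc]; push_cast; ring
      rw [h1, hβ2]
      rw [abs_le] at hj
      have hN1 : (1 : ℤ) ≤ N := by omega
      have h3 := abs_le.1 (hM (N + j + 1) (by rw [abs_le]; omega))
      have h4 := abs_le.1 (hM (j + 1) (by rw [abs_le]; omega))
      have h5 := abs_le.1 (hM (j + 1 - N) (by rw [abs_le]; omega))
      rw [abs_le]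
      constructor <;> linarith
    · have hkN : (N : ℝ) ≤ |(k : ℝ)| := by exact_mod_cast hk.le
      rw [min_eq_right hkN]
      have h1 : |b k| ≤ 2 * M * N * |(k : ℝ)| := by
        have h2 : ∀ l ∈ Finset.range N, |∑ i ∈ Finset.range N,
            (a ((i : ℤ) - l + k) - a ((i : ℤ) - l))| ≤ 2 * M * |(k : ℝ)| := by
          intro l _
          refine (Finset.abs_sum_le_sum_abs _ _).trans ?_
          refine (Finset.sum_le_sum fun (i : ℕ) _ => hM' ((i : ℤ) - l) k).trans ?_
          simp only [Finset.sum_const, Finset.card_range, nsmul_eq_mul]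
          have : (N : ℝ) * (M * (|(k : ℝ)| / N + 1)) = M * (|(k : ℝ)| + N) := by field_simp
          rw [this]
          nlinarith
        refine (Finset.abs_sum_le_sum_abs _ _).trans ?_
        refine (Finset.sum_le_sum h2).trans ?_
        simp; linarith
      have h3 : |(k : ℝ) * b 1| ≤ |(k : ℝ)| * (2 * M * N) := by
        rw [abs_mul]; gcongr
      have h4 := abs_sub (b k) (k * b 1)
      simp only [hc]
      linarith
  have hN' : (0 : ℝ) ≤ N := hN0.le
  calc (N : ℝ) = ∫ k, c k ∂ν := hcint.symm
    _ ≤ ∫ k : ℤ, 4 * M * (|(k : ℝ)| * min |(k : ℝ)| N) ∂ν :=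
        integral_mono (hbint.sub (hν.integrable.mul_const _))
          ((integrable_truncMoment hν.integrable hN').const_mul _)
          fun k => (le_abs_self _).trans (hcb k)
    _ = _ := by rw [integral_const_mul, truncMoment]

lemma tendsto_truncMoment_div (hν : CenteredLaw ν) :
    Tendsto (fun N : ℕ => truncMoment ν N / N) atTop (𝓝 0) := by
  have h1 : Tendsto (fun N : ℕ => ∫ k : ℤ, |(k : ℝ)| * min |(k : ℝ)| N / N ∂ν) atTop
      (𝓝 (∫ k : ℤ, (0 : ℝ) ∂ν)) := by
    refine tendsto_integral_of_dominated_convergence (fun k : ℤ => |(k : ℝ)|)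
      (fun n => (measurable_of_countable _).aestronglyMeasurable) hν.integrable.abs
      (fun n => ae_of_all _ fun k => ?_) (ae_of_all _ fun k => ?_)
    · have hmin : 0 ≤ min |(k : ℝ)| (n : ℝ) := le_min (abs_nonneg _) (Nat.cast_nonneg _)
      rw [Real.norm_eq_abs, abs_of_nonneg (by positivity), mul_div_assoc]
      refine mul_le_of_le_one_right (abs_nonneg _) ?_
      exact div_le_one_of_le₀ (min_le_right _ _) (Nat.cast_nonneg _)
    · have h2 : Tendsto (fun n : ℕ => |(k : ℝ)| * |(k : ℝ)| / n) atTop (𝓝 0) :=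
        tendsto_const_div_atTop_nhds_zero_nat _
      refine squeeze_zero (fun n => ?_) (fun n => ?_) h2
      · have hmin : 0 ≤ min |(k : ℝ)| (n : ℝ) := le_min (abs_nonneg _) (Nat.cast_nonneg _)
        positivity
      · gcongr; exact min_le_left _ _
  simpa [truncMoment, integral_div] using h1

/-- If a were bounded, the tent estimate would give N ≤ const · E[|X| min(|X|, N)], whose right side
is o(N) because E|X| is finite. -/
theorem pot_unbounded (hν : CenteredLaw ν) (B : ℝ) : ∃ x, B < pot ν x := by
  by_contra! hB
  have hB0 : 0 ≤ B := (pot_nonneg hν 0).trans (hB 0)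
  have h1 : ∀ N : ℕ, 0 < N → (N : ℝ) ≤ 4 * B * truncMoment ν N := fun N hN => by
    refine le_truncMoment_of_isPot hν (linGrowth_pot hν) (avg_pot hν) hN
      (fun x _ => by rw [abs_of_nonneg (pot_nonneg hν x)]; exact hB x) fun x k => ?_
    have h2 : |pot ν (x + k) - pot ν x| ≤ B := by
      rw [abs_le]
      constructor <;> linarith [pot_nonneg hν x, pot_nonneg hν (x + k), hB x, hB (x + k)]
    have h3 : 0 ≤ |(k : ℝ)| / N := by positivity
    nlinarith
  have h2 := ((tendsto_truncMoment_div hν).const_mul (4 * B))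
  rw [mul_zero] at h2
  obtain ⟨N, hN, hN0⟩ := ((h2.eventually (gt_mem_nhds one_pos)).and (eventually_gt_atTop 0)).exists
  have hN' : (0 : ℝ) < N := by exact_mod_cast hN0
  rw [← mul_div_assoc, div_lt_one hN'] at hN
  linarith [h1 N hN0]

/-- The potential is at most the supremum of the Green function at 0, so its unboundedness is
recurrence. Other starting points differ by a bounded amount. -/
theorem tendsto_green (hν : CenteredLaw ν) (x : ℤ) :
    Tendsto (fun n => green ν n x) atTop atTop := by
  have h0 : Tendsto (fun n => green ν n 0) atTop atTop := by
    refine tendsto_atTop_atTop.2 fun B => ?_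
    by_contra! hB
    have hB' : ∀ n, green ν n 0 ≤ B := fun n => by
      obtain ⟨m, hm, hlt⟩ := hB n
      exact (green_mono hm 0).trans hlt.le
    obtain ⟨y, hy⟩ := pot_unbounded hν B
    refine absurd (le_of_tendsto' (tendsto_partialPot hν y) fun n => ?_) (not_le.2 hy)
    exact (sub_le_self _ (green_nonneg n y)).trans (hB' n)
  obtain ⟨C, hC⟩ := partialPot_le hν one_pos
  refine tendsto_atTop_mono (fun n => ?_) (tendsto_atTop_add_const_right _ (-(1 * |(x : ℝ)| + C)) h0)
  have := hC n x
  rw [partialPot] at this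
  linarith

end

/-! ### Hitting probabilities as solutions of a one-step equation -/

open Classical in
/-- The payoff of the game "hit `A` before `B`" after one step: win on `A`, lose on `B`, and
continue with value `h` elsewhere. -/
def payoff (A B : Set ℤ) (h : ℤ → ℝ) (y : ℤ) : ℝ :=
  if y ∈ B then 0 else if y ∈ A then 1 else h y

lemma payoff_of_mem_right {A B : Set ℤ} {h : ℤ → ℝ} {y : ℤ} (hy : y ∈ B) : payoff A B h y = 0 :=
  if_pos hy

lemma payoff_of_mem_left {A B : Set ℤ} {h : ℤ → ℝ} {y : ℤ} (hB : y ∉ B) (hA : y ∈ A) :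
    payoff A B h y = 1 := by rw [payoff, if_neg hB, if_pos hA]

lemma payoff_of_notMem {A B : Set ℤ} {h : ℤ → ℝ} {y : ℤ} (hB : y ∉ B) (hA : y ∉ A) :
    payoff A B h y = h y := by rw [payoff, if_neg hB, if_neg hA]

lemma payoff_self_right (A : Set ℤ) (b : ℤ) (h : ℤ → ℝ) : payoff A {b} h b = 0 :=
  payoff_of_mem_right (Set.mem_singleton b)

lemma payoff_self_left {a b : ℤ} (hab : a ≠ b) (h : ℤ → ℝ) : payoff {a} {b} h a = 1 :=
  payoff_of_mem_left (Set.mem_singleton_iff.not.2 hab) (Set.mem_singleton a)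

lemma payoff_of_ne {a b y : ℤ} (hb : y ≠ b) (ha : y ≠ a) (h : ℤ → ℝ) :
    payoff {a} {b} h y = h y :=
  payoff_of_notMem (Set.mem_singleton_iff.not.2 hb) (Set.mem_singleton_iff.not.2 ha)

lemma linGrowth_of_abs_le {f : ℤ → ℝ} {C : ℝ} (h : ∀ x, |f x| ≤ C) : LinGrowth f := by
  refine ⟨C, fun x => (h x).trans ?_⟩
  have h0 : 0 ≤ C := (abs_nonneg _).trans (h 0)
  have := abs_nonneg (x : ℝ)
  nlinarith

lemma LinGrowth.payoff {f : ℤ → ℝ} (hf : LinGrowth f) (A B : Set ℤ) : LinGrowth (payoff A B f) := by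
  obtain ⟨C, hC⟩ := hf
  refine ⟨|C| + 1, fun x => ?_⟩
  have h1 : C ≤ |C| := le_abs_self C
  have h2 := abs_nonneg C
  have h3 := abs_nonneg (x : ℝ)
  have h4 : 0 ≤ |C| * |(x : ℝ)| := by positivity
  have h5 := hC x
  unfold PotentialWalk.payoff
  split_ifs
  · rw [abs_zero]; positivity
  · rw [abs_one]; nlinarith
  · nlinarith

section
variable {ν : Measure ℤ} [IsProbabilityMeasure ν]

/-- Comparison principle for the one-step equation. -/
theorem payoff_comparison (hν : CenteredLaw ν) {A B : Set ℤ} (hAB : (A ∪ B).Nonempty)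
    {h v : ℤ → ℝ} {C : ℝ} (hh : LinGrowth h) (hv : LinGrowth v) (hC : ∀ x, h x - v x ≤ C)
    (hsub : ∀ x, h x ≤ avg ν (payoff A B h) x) (hsup : ∀ x, avg ν (payoff A B v) x ≤ v x) (x : ℤ) :
    h x ≤ v x := by
  -- The positive part of h - v is subharmonic for the walk killed on A ∪ B. Only h - v has to be
  -- bounded above, so unbounded v, such as multiples of a†, are admissible.
  have key := killed_subharmonic_eq_zero hν.gen (tendsto_green hν) hAB
    (v := fun y => max (h y - v y) 0) (C := max C 0) (fun y => le_max_right _ _)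
    (fun y => max_le_max_right _ (hC y)) (fun y => ?_) x
  · have := le_max_left (h x - v x) 0
    rw [key] at this
    linarith
  · have hb : ∀ z, |(A ∪ B)ᶜ.indicator (fun y => max (h y - v y) 0) z| ≤ max C 0 := fun z => by
      rw [abs_of_nonneg (Set.indicator_nonneg (fun _ _ => le_max_right _ _) _)]
      refine (Set.indicator_le_self' (fun _ _ => le_max_right _ _) z).trans ?_
      exact max_le_max_right _ (hC z)
    refine max_le ?_ (avg_nonneg (fun z => Set.indicator_nonneg (fun _ _ => le_max_right _ _) z) y)
    have hi1 := (hh.payoff A B).integrable_shift hν.integrable y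
    have hi2 := (hv.payoff A B).integrable_shift hν.integrable y
    calc h y - v y ≤ avg ν (payoff A B h) y - avg ν (payoff A B v) y := by
          linarith [hsub y, hsup y]
      _ = avg ν (fun z => payoff A B h z - payoff A B v z) y := (avg_sub hi1 hi2).symm
      _ ≤ _ := by
          refine avg_mono (hi1.sub hi2) (integrable_shift_of_abs_le hb y) fun z => ?_
          by_cases hB : z ∈ B
          · simp [payoff_of_mem_right hB, hB]
          by_cases hA : z ∈ A
          · simp [payoff_of_mem_left hB hA, hA]
          · have hz : z ∈ (A ∪ B)ᶜ := by simp [hA, hB]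
            rw [payoff_of_notMem hB hA, payoff_of_notMem hB hA, Set.indicator_of_mem hz]
            exact le_max_left _ _

theorem payoff_unique (hν : CenteredLaw ν) {A B : Set ℤ} (hAB : (A ∪ B).Nonempty)
    {h v : ℤ → ℝ} {C C' : ℝ} (hh : ∀ x, |h x| ≤ C) (hv : ∀ x, |v x| ≤ C')
    (hh' : ∀ x, h x = avg ν (payoff A B h) x) (hv' : ∀ x, v x = avg ν (payoff A B v) x) (x : ℤ) :
    h x = v x := by
  have hl := linGrowth_of_abs_le hh
  have hl' := linGrowth_of_abs_le hv
  refine le_antisymm ?_ ?_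
  · refine payoff_comparison hν hAB (C := C + C') hl hl' (fun x => ?_) (fun x => (hh' x).le)
      (fun x => (hv' x).ge) x
    linarith [(abs_le.1 (hh x)).2, (abs_le.1 (hv x)).1]
  · refine payoff_comparison hν hAB (C := C + C') hl' hl (fun x => ?_) (fun x => (hv' x).le)
      (fun x => (hh' x).ge) x
    linarith [(abs_le.1 (hh x)).1, (abs_le.1 (hv x)).2]

/-! ### The probability of hitting `R` before `0` in terms of the potential -/

/-- `a†`. -/
def potDag (ν : Measure ℤ) (x : ℤ) : ℝ := (if x = 0 then 1 else 0) + pot ν x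

/-- Twice the symmetrised potential. -/
def potSum (ν : Measure ℤ) (x : ℤ) : ℝ := pot ν x + pot ν (-x)

/-- The probability that the walk started at `x` visits `R` before `0`. -/
def hitFirst (ν : Measure ℤ) (R x : ℤ) : ℝ :=
  (potDag ν x + pot ν (-R) - pot ν (x - R) - if x = R then 1 else 0) / potSum ν R

lemma potDag_eq_avg (hν : CenteredLaw ν) (x : ℤ) : potDag ν x = avg ν (pot ν) x := by
  rw [avg_pot hν, potDag, add_comm]

lemma pot_le_potDag (x : ℤ) : pot ν x ≤ potDag ν x := by
  rw [potDag]; split_ifs <;> linarith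

lemma potDag_of_ne {x : ℤ} (hx : x ≠ 0) : potDag ν x = pot ν x := by simp [potDag, hx]

lemma potDag_zero (hν : CenteredLaw ν) : potDag ν 0 = 1 := by simp [potDag, pot_zero hν]

lemma linGrowth_potDag (hν : CenteredLaw ν) : LinGrowth (potDag ν) := by
  obtain ⟨C, hC⟩ := linGrowth_pot hν
  refine ⟨C + 1, fun x => ?_⟩
  have h1 := hC x
  have h2 := abs_nonneg (x : ℝ)
  have h3 : |potDag ν x| ≤ 1 + |pot ν x| := by
    rw [potDag]
    refine (abs_add_le _ _).trans ?_
    gcongr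
    split_ifs <;> simp
  nlinarith

lemma avg_pot_difference (hν : CenteredLaw ν) (R x : ℤ) :
    avg ν (fun y => pot ν y - pot ν (y - R) + pot ν (-R)) x
      = potDag ν x + pot ν (-R) - pot ν (x - R) - if x = R then 1 else 0 := by
  have h1 : Integrable (fun k => pot ν (x + k - R)) ν := by
    simpa only [add_sub_right_comm] using integrable_pot_shift hν (x - R)
  have h2 : avg ν (fun y => pot ν (y - R)) x = avg ν (pot ν) (x - R) :=
    avg_comp_add ν (pot ν) x (-R)
  rw [avg_add (f := fun y => pot ν y - pot ν (y - R))
    ((integrable_pot_shift hν x).sub h1) (integrable_const _), avg_const,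
    avg_sub (integrable_pot_shift hν x) h1, h2, avg_pot hν (x - R), potDag_eq_avg hν]
  have h3 : x - R = 0 ↔ x = R := sub_eq_zero
  simp only [h3]
  ring

lemma abs_pot_difference_le (hν : CenteredLaw ν) (R : ℤ) :
    ∃ C, ∀ y, |pot ν y - pot ν (y - R) + pot ν (-R)| ≤ C := by
  obtain ⟨C, hC⟩ := (isPot_pot hν).increment 1 one_pos
  refine ⟨1 * |(R : ℝ)| + C + |pot ν (-R)|, fun y => (abs_add_le _ _).trans ?_⟩
  have := hC (y - R) R
  rw [sub_add_cancel] at this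
  linarith

/-- If a(R) = a(-R) = 0, then u vanishes at 0 and R and is harmonic elsewhere. The modulus of its
average is then subharmonic for the walk killed at {0, R}, hence zero, whereas its value at 0 is 1.
-/
theorem potSum_pos (hν : CenteredLaw ν) {R : ℤ} (hR : R ≠ 0) : 0 < potSum ν R := by
  have h0 : 0 ≤ potSum ν R := add_nonneg (pot_nonneg hν _) (pot_nonneg hν _)
  refine lt_of_le_of_ne h0 fun hZ => ?_
  rw [potSum] at hZ
  have hR0 : pot ν R = 0 := by linarith [pot_nonneg hν R, pot_nonneg hν (-R)]
  have hR1 : pot ν (-R) = 0 := by linarith [pot_nonneg hν R, pot_nonneg hν (-R)]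
  obtain ⟨C, hC⟩ := abs_pot_difference_le hν R
  set u : ℤ → ℝ := fun y => pot ν y - pot ν (y - R) + pot ν (-R) with hu
  have hd : ∀ x, avg ν u x = potDag ν x + pot ν (-R) - pot ν (x - R) - if x = R then 1 else 0 :=
    avg_pot_difference hν R
  have huD : ∀ y, u y = ({0, R} : Set ℤ)ᶜ.indicator (avg ν u) y := by
    intro y
    by_cases hy0 : y = 0
    · subst hy0; simp [hu, pot_zero hν]
    by_cases hyR : y = R
    · subst hyR; simp [hu, pot_zero hν, hR0, hR1]
    · rw [Set.indicator_of_mem (by simp [hy0, hyR]), hd, if_neg hyR, potDag_of_ne hy0]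
      simp only [hu]; ring
  have hCd : ∀ x, |avg ν u x| ≤ C := abs_avg_le hC
  have key := killed_subharmonic_eq_zero hν.gen (tendsto_green hν) (D := {0, R}) ⟨0, by simp⟩
    (v := fun x => |avg ν u x|) (fun x => abs_nonneg _) hCd (fun x => ?_) 0
  · simp only [hd, potDag_zero hν, hR1, zero_sub, if_neg hR.symm] at key
    norm_num at key
  · have h1 : (({0, R} : Set ℤ)ᶜ.indicator fun x => |avg ν u x|) = fun y => |u y| := by
      funext y
      rw [huD y]
      by_cases hy : y ∈ ({0, R} : Set ℤ)ᶜ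
      · rw [Set.indicator_of_mem hy, Set.indicator_of_mem hy]
      · rw [Set.indicator_of_notMem hy, Set.indicator_of_notMem hy, abs_zero]
    rw [h1]
    exact abs_integral_le_integral_abs

/-- A single function takes the boundary values 0 at 0 and 1 at R, and its average produces exactly
the two indicator corrections in `hitFirst`. This is why the formula solves the one-step equation.
-/
lemma payoff_hitFirst (hν : CenteredLaw ν) {R : ℤ} (hR : R ≠ 0) (y : ℤ) :
    payoff {R} {0} (hitFirst ν R) y
      = (pot ν y - pot ν (y - R) + pot ν (-R)) / potSum ν R := by
  by_cases hy0 : y = 0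
  · subst hy0; rw [payoff_self_right]; simp [pot_zero hν]
  by_cases hyR : y = R
  · subst hyR
    rw [payoff_self_left hy0, sub_self, pot_zero hν, sub_zero, ← potSum,
      div_self (potSum_pos hν hR).ne']
  · rw [payoff_of_ne hy0 hyR, hitFirst, if_neg hyR, potDag_of_ne hy0]
    ring

lemma hitFirst_eq_avg (hν : CenteredLaw ν) {R : ℤ} (hR : R ≠ 0) (x : ℤ) :
    hitFirst ν R x = avg ν (payoff {R} {0} (hitFirst ν R)) x := by
  rw [show payoff {R} {0} (hitFirst ν R)
    = fun y => (pot ν y - pot ν (y - R) + pot ν (-R)) / potSum ν R from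
    funext (payoff_hitFirst hν hR)]
  have : avg ν (fun y => (pot ν y - pot ν (y - R) + pot ν (-R)) / potSum ν R) x
      = avg ν (fun y => pot ν y - pot ν (y - R) + pot ν (-R)) x / potSum ν R :=
    integral_div _ _
  rw [this, avg_pot_difference hν, hitFirst]

lemma abs_hitFirst_le (hν : CenteredLaw ν) {R : ℤ} (hR : R ≠ 0) : ∃ C, ∀ x, |hitFirst ν R x| ≤ C := by
  obtain ⟨C, hC⟩ := abs_pot_difference_le hν R
  refine ⟨C / potSum ν R, fun x => ?_⟩
  rw [hitFirst_eq_avg hν hR]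
  refine abs_avg_le (fun y => ?_) x
  rw [payoff_hitFirst hν hR, abs_div, abs_of_pos (potSum_pos hν hR)]
  have := (potSum_pos hν hR).le
  gcongr
  exact hC y

lemma hitFirst_nonneg (hν : CenteredLaw ν) {R : ℤ} (hR : R ≠ 0) (x : ℤ) : 0 ≤ hitFirst ν R x := by
  obtain ⟨C, hC⟩ := abs_hitFirst_le hν hR
  refine payoff_comparison hν (A := {R}) (B := {0}) (h := fun _ => 0) (v := hitFirst ν R) (C := C)
    ⟨0, by simp⟩ (linGrowth_of_abs_le (C := 0) (by simp)) (linGrowth_of_abs_le hC) (fun x => ?_)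
    (fun x => avg_nonneg (fun y => ?_) x) (fun x => (hitFirst_eq_avg hν hR x).ge) x
  · linarith [(abs_le.1 (hC x)).1]
  · unfold payoff; split_ifs <;> norm_num

/-- The average of a/a(R) is a†/a(R), and a/a(R) equals 0 at 0 and 1 at R. Thus a†/a(R) is a
supersolution, although possibly unbounded, of the same one-step equation. -/
lemma hitFirst_le (hν : CenteredLaw ν) {R : ℤ} (hR : R ≠ 0) (hpos : 0 < pot ν R) (x : ℤ) :
    hitFirst ν R x ≤ potDag ν x / pot ν R := by
  obtain ⟨C, hC⟩ := abs_hitFirst_le hν hR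
  have hv0 : ∀ x, 0 ≤ potDag ν x / pot ν R := fun x =>
    div_nonneg ((pot_nonneg hν x).trans (pot_le_potDag x)) hpos.le
  have hlin : LinGrowth fun x => potDag ν x / pot ν R := by
    obtain ⟨K, hK⟩ := linGrowth_potDag hν
    refine ⟨K / pot ν R, fun x => ?_⟩
    rw [abs_div, abs_of_pos hpos, div_mul_eq_mul_div]
    gcongr
    exact hK x
  refine payoff_comparison hν (A := {R}) (B := {0}) (h := hitFirst ν R)
    (v := fun x => potDag ν x / pot ν R) (C := C)
    ⟨0, by simp⟩ (linGrowth_of_abs_le hC) hlin (fun x => ?_)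
    (fun x => (hitFirst_eq_avg hν hR x).le) (fun x => ?_) x
  · linarith [(abs_le.1 (hC x)).2, hv0 x]
  · have h1 : avg ν (fun y => pot ν y / pot ν R) x = potDag ν x / pot ν R := by
      rw [potDag_eq_avg hν]; exact integral_div _ _
    rw [← h1]
    refine avg_mono ((hlin.payoff _ _).integrable_shift hν.integrable x)
      ((integrable_pot_shift hν x).div_const _) fun y => ?_
    by_cases hy0 : y = 0
    · subst hy0; rw [payoff_self_right, pot_zero hν, zero_div]
    by_cases hyR : y = R
    · subst hyR; rw [payoff_self_left hy0, div_self hpos.ne']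
    · rw [payoff_of_ne hy0 hyR, potDag_of_ne hy0]

/-- Subadditivity is the nonnegativity of the probability of hitting -y before 0 from x. -/
theorem pot_add_le (hν : CenteredLaw ν) (x y : ℤ) : pot ν (x + y) ≤ pot ν x + pot ν y := by
  by_cases hy : y = 0
  · subst hy; simp [pot_zero hν]
  by_cases hx : x = 0
  · subst hx; simp [pot_zero hν]
  have h := hitFirst_nonneg hν (R := -y) (by simpa using hy) x
  have hp := potSum_pos hν (R := -y) (by simpa using hy)
  rw [hitFirst, le_div_iff₀ hp, zero_mul, potDag_of_ne hx, neg_neg, sub_neg_eq_add] at h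
  split_ifs at h <;> linarith

lemma pot_sub_le (hν : CenteredLaw ν) (x y : ℤ) : pot ν x ≤ pot ν y + pot ν (x - y) := by
  have := pot_add_le hν y (x - y)
  rwa [add_sub_cancel] at this

/-- The symmetrised potential tends to infinity. -/
theorem tendsto_potSum (hν : CenteredLaw ν) : Tendsto (potSum ν) (atBot ⊔ atTop) atTop := by
  refine tendsto_atTop.2 fun B => ?_
  obtain ⟨x, hx⟩ := pot_unbounded hν (B + 1)
  have hneg : Tendsto (fun y : ℤ => -y) (atBot ⊔ atTop) (atBot ⊔ atTop) :=
    tendsto_sup.2 ⟨tendsto_neg_atBot_atTop.mono_right le_sup_right,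
      tendsto_neg_atTop_atBot.mono_right le_sup_left⟩
  have h1 := (tendsto_pot_increment hν x).comp hneg
  filter_upwards [h1.eventually (gt_mem_nhds one_pos)] with R hR
  -- a(x) ≤ a(R) + a(x - R), and a(x - R) is within 1 of a(-R) for |R| large, so a(R) + a(-R)
  -- exceeds a(x) - 1.
  have h2 := pot_sub_le hν x R
  simp only [Function.comp] at hR
  rw [show -R + x = x - R by ring] at hR
  rw [potSum]
  linarith

lemma add_eq_of_hitFirst_eq_zero (hν : CenteredLaw ν) {R x : ℤ} (hR : R ≠ 0) (hx : x ≠ 0)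
    (hxR : x ≠ R) (h : hitFirst ν R x = 0) : pot ν (x - R) = pot ν x + pot ν (-R) := by
  rw [hitFirst, div_eq_zero_iff, or_iff_left (potSum_pos hν hR).ne', if_neg hxR,
    potDag_of_ne hx] at h
  linarith

/-- If the steps from the set `S` never leave `S` other than through `0`, then the walk started in
`S` does not hit a point outside `S` before `0`. -/
lemma hitFirst_eq_zero_of_trap (hν : CenteredLaw ν) {S : Set ℤ} {R : ℤ} (hR : R ≠ 0) (hRS : R ∉ S)
    (h0S : (0 : ℤ) ∉ S)
    (hS : ∀ x ∈ S, ∀ k, ν {k} ≠ 0 → x + k ∈ S ∨ x + k = 0) {x : ℤ} (hx : x ∈ S) :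
    hitFirst ν R x = 0 := by
  obtain ⟨C, hC⟩ := abs_hitFirst_le hν hR
  have h0 := hitFirst_nonneg hν hR
  have key := killed_subharmonic_eq_zero hν.gen (tendsto_green hν) (D := {0, R}) ⟨0, by simp⟩
    (v := S.indicator (hitFirst ν R)) (C := C)
    (fun y => Set.indicator_nonneg (fun _ _ => h0 _) y)
    (fun y => (Set.indicator_le_self' (fun _ _ => h0 _) y).trans (abs_le.1 (hC y)).2)
    (fun y => ?_) x
  · rwa [Set.indicator_of_mem hx] at key
  · by_cases hy : y ∈ S
    · rw [Set.indicator_of_mem hy, hitFirst_eq_avg hν hR]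
      refine (avg_congr_of_supp fun k hk => ?_).le
      rcases hS y hy k hk with h | h
      · have hne0 : y + k ≠ 0 := fun e => h0S (e ▸ h)
        have hneR : y + k ≠ R := fun e => hRS (e ▸ h)
        rw [payoff_of_ne hne0 hneR, Set.indicator_of_mem (by simp [hne0, hneR]),
          Set.indicator_of_mem h]
      · rw [h, payoff_self_right, Set.indicator_of_notMem (by simp)]
    · rw [Set.indicator_of_notMem hy]
      exact avg_nonneg (fun z => Set.indicator_nonneg
        (fun _ _ => Set.indicator_nonneg (fun _ _ => h0 _) _) z) y

/-- Additivity makes f linear along the multiples of s, and sublinear growth leaves only the zero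
slope. -/
lemma eq_zero_of_additive {f : ℤ → ℝ} {s : ℤ}
    (hadd : ∀ n : ℕ, 0 < n → f (s * (n + 1)) = f (s * n) + f s)
    (hlim : Tendsto (fun n : ℕ => f (s * n) / n) atTop (𝓝 0)) (h0 : f 0 = 0) (n : ℕ) :
    f (s * n) = 0 := by
  have hlin : ∀ n : ℕ, f (s * n) = n * f s := by
    intro n
    induction n with
    | zero => simp [h0]
    | succ n ih =>
      rcases Nat.eq_zero_or_pos n with rfl | hn
      · simp
      · push_cast; rw [hadd n hn, ih]; ring
  have : f s = 0 := by
    refine tendsto_nhds_unique (tendsto_const_nhds.congr' ?_) hlim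
    filter_upwards [eventually_gt_atTop 0] with n hn
    have : (n : ℝ) ≠ 0 := by positivity
    rw [hlin n]; field_simp
  rw [hlin, this, mul_zero]

lemma tendsto_pot_neg_div (hν : CenteredLaw ν) :
    Tendsto (fun n : ℕ => pot ν (-1 * n) / n) atTop (𝓝 0) := by
  have h : SubLinear fun x => pot ν (-x) := fun ε hε => by
    obtain ⟨C, hC⟩ := subLinear_pot hν ε hε
    exact ⟨C, fun x => by simpa using hC (-x)⟩
  simpa using h.tendsto_div

/-- For a right-continuous walk the potential vanishes on the negative half-line. -/
theorem pot_neg_eq_zero_of_rightContinuous (hν : CenteredLaw ν) (h : ∀ k, ν {k} ≠ 0 → k ≤ 1)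
    (n : ℕ) : pot ν (-n) = 0 := by
  have := eq_zero_of_additive (f := pot ν) (s := -1) (fun m hm => ?_)
    (tendsto_pot_neg_div hν) (pot_zero hν) n
  · simpa using this
  -- With upward jumps of size at most 1 the walk cannot pass from the negatives to 1 without
  -- visiting 0. The vanishing of this probability is additivity of a on the negative half-line.
  · have h1 := hitFirst_eq_zero_of_trap hν (S := Set.Iio 0) (R := 1) one_ne_zero (by simp)
      (by simp) (fun x hx k hk => by
        have := h k hk
        simp only [Set.mem_Iio] at hx ⊢
        omega) (x := -m) (by simpa using hm)
    have h2 := add_eq_of_hitFirst_eq_zero hν one_ne_zero (by omega) (by omega) h1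
    rw [show (-1 : ℤ) * (m + 1) = -m - 1 by ring, neg_one_mul]
    exact h2

/-- For a left-continuous walk the potential vanishes on the positive half-line. -/
theorem pot_eq_zero_of_leftContinuous (hν : CenteredLaw ν) (h : ∀ k, ν {k} ≠ 0 → -1 ≤ k)
    (n : ℕ) : pot ν n = 0 := by
  have := eq_zero_of_additive (f := pot ν) (s := 1) (fun m hm => ?_)
    (by simpa using (subLinear_pot hν).tendsto_div) (pot_zero hν) n
  · simpa using this
  · have h1 := hitFirst_eq_zero_of_trap hν (S := Set.Ioi 0) (R := -1) (by norm_num) (by simp)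
      (by simp) (fun x hx k hk => by
        have := h k hk
        simp only [Set.mem_Ioi] at hx ⊢
        omega) (x := m) (by simpa using hm)
    have h2 := add_eq_of_hitFirst_eq_zero hν (by norm_num) (by omega) (by omega) h1
    rw [sub_neg_eq_add, neg_neg] at h2
    rw [one_mul, one_mul, h2]

end

/-! ### Consequences of `a(-z)/a(z) → 0` -/

/-- `a(-z)/a(z) → 0`, with `a(z) ≠ 0` for large `z`. -/
def NegPotNegligible (ν : Measure ℤ) : Prop :=
  (∀ᶠ z : ℕ in atTop, pot ν z ≠ 0) ∧
    Tendsto (fun z : ℕ => pot ν (-z) / pot ν z) atTop (𝓝 0)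

section
variable {ν : Measure ℤ} [IsProbabilityMeasure ν]

lemma NegPotNegligible.eventually_le (hν : CenteredLaw ν) (hr : NegPotNegligible ν) {ε : ℝ}
    (hε : 0 < ε) : ∀ᶠ n : ℕ in atTop, pot ν (-n) ≤ ε * pot ν n := by
  filter_upwards [hr.1, hr.2.eventually (gt_mem_nhds hε)] with n h0 h1
  have : 0 < pot ν n := lt_of_le_of_ne (pot_nonneg hν n) h0.symm
  exact ((div_lt_iff₀ this).1 h1).le

lemma NegPotNegligible.exists_le (hν : CenteredLaw ν) (hr : NegPotNegligible ν) {ε : ℝ}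
    (hε : 0 < ε) : ∃ C, 0 ≤ C ∧ ∀ n : ℕ, pot ν (-n) ≤ ε * pot ν n + C := by
  obtain ⟨N, hN⟩ := eventually_atTop.1 (hr.eventually_le hν hε)
  have h0 : ∀ i : ℕ, 0 ≤ pot ν (-i) := fun i => pot_nonneg hν _
  refine ⟨∑ i ∈ Finset.range N, pot ν (-i), Finset.sum_nonneg fun i _ => h0 i, fun n => ?_⟩
  rcases le_or_gt N n with hn | hn
  · have := Finset.sum_nonneg fun i (_ : i ∈ Finset.range N) => h0 i
    linarith [hN n hn]
  · have h1 := Finset.single_le_sum (f := fun i : ℕ => pot ν (-i)) (fun i _ => h0 i)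
      (Finset.mem_range.2 hn)
    have h2 := mul_nonneg hε.le (pot_nonneg hν n)
    linarith

lemma tendsto_potSum_nat (hν : CenteredLaw ν) : Tendsto (fun n : ℕ => potSum ν n) atTop atTop :=
  ((tendsto_potSum hν).mono_left le_sup_right).comp tendsto_natCast_atTop_atTop

lemma NegPotNegligible.tendsto_pot (hν : CenteredLaw ν) (hr : NegPotNegligible ν) :
    Tendsto (fun n : ℕ => pot ν n) atTop atTop := by
  obtain ⟨C, -, hC⟩ := hr.exists_le hν one_pos
  have h := ((tendsto_atTop_add_const_right _ (-C) (tendsto_potSum_nat hν)).atTop_div_const two_pos)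
  refine tendsto_atTop_mono (fun n => ?_) h
  have := hC n
  rw [potSum]
  linarith

lemma NegPotNegligible.eventually_lt (hν : CenteredLaw ν) (hr : NegPotNegligible ν) (B : ℝ) :
    ∀ᶠ n : ℕ in atTop, B < pot ν n := (hr.tendsto_pot hν).eventually (eventually_gt_atTop B)

/-- The potential is increasing on the positive half-line up to a small error. -/
theorem NegPotNegligible.pot_le (hν : CenteredLaw ν) (hr : NegPotNegligible ν) {ε : ℝ}
    (hε : 0 < ε) : ∃ C, 0 ≤ C ∧ ∀ m n : ℕ, m ≤ n → pot ν m ≤ (1 + ε) * pot ν n + C := by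
  set δ := ε / (1 + ε) with hδ
  have hδ0 : 0 < δ := by positivity
  have hδ1 : (1 + ε) * (1 - δ) = 1 := by rw [hδ]; field_simp; ring
  obtain ⟨C, hC0, hC⟩ := hr.exists_le hν hδ0
  refine ⟨(1 + ε) * C, by positivity, fun m n hmn => ?_⟩
  -- At the maximiser j of a on [0, n], subadditivity gives a(j) ≤ a(n) + a(j - n), and a(j - n) ≤ δ
  -- a(n - j) + C ≤ δ a(j) + C.
  obtain ⟨j, hj, hmax⟩ := Finset.exists_max_image (Finset.range (n + 1)) (fun i : ℕ => pot ν i)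
    ⟨0, by simp⟩
  have hjn : j ≤ n := by have := Finset.mem_range.1 hj; omega
  have h1 := pot_sub_le hν j n
  have h2 := hC (n - j)
  have h3 := hmax (n - j) (Finset.mem_range.2 (by omega))
  have h4 := hmax m (Finset.mem_range.2 (by omega))
  rw [Nat.cast_sub hjn, neg_sub] at h2
  rw [Nat.cast_sub hjn] at h3
  have h5 : (1 - δ) * pot ν j ≤ pot ν n + C := by nlinarith
  have h6 : (1 + ε) * ((1 - δ) * pot ν j) ≤ (1 + ε) * (pot ν n + C) := by gcongr
  rw [← mul_assoc, hδ1] at h6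
  linarith

/-- The additive constant of the previous bound is absorbed because a(R) → ∞. -/
lemma NegPotNegligible.eventually_pot_le (hν : CenteredLaw ν) (hr : NegPotNegligible ν) {ε : ℝ}
    (hε : 0 < ε) : ∀ᶠ R : ℕ in atTop, ∀ n : ℕ, R ≤ n → pot ν R ≤ (1 + ε) * pot ν n := by
  set δ := min (ε / 4) (1 / 4) with hδ
  have hδ0 : 0 < δ := by positivity
  have hδ1 : δ ≤ ε / 4 := min_le_left _ _
  have hδ2 : δ ≤ 1 / 4 := min_le_right _ _
  obtain ⟨C, hC0, hC⟩ := hr.pot_le hν hδ0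
  filter_upwards [hr.eventually_lt hν (C / δ)] with R hR n hn
  rw [div_lt_iff₀ hδ0] at hR
  have h1 := hC R n hn
  have h2 : (1 - δ) * pot ν R ≤ (1 + δ) * pot ν n := by linarith
  have h3 : (1 + δ) ≤ (1 + ε) * (1 - δ) := by nlinarith
  have h4 := pot_nonneg hν n
  have h5 : (1 - δ) * pot ν R ≤ (1 - δ) * ((1 + ε) * pot ν n) := by nlinarith
  exact le_of_mul_le_mul_left h5 (by linarith)

/-- Both sides equal a(-w) + a(-R) - a(-w - R), which is symmetric in w and R. -/
lemma hitFirst_symm (hν : CenteredLaw ν) {w R : ℕ} (hw : 0 < w) (hR : 0 < R) :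
    hitFirst ν R (-w) * potSum ν R = hitFirst ν w (-R) * potSum ν w := by
  have hR' : (R : ℤ) ≠ 0 := by omega
  have hw' : (w : ℤ) ≠ 0 := by omega
  rw [hitFirst, hitFirst, div_mul_cancel₀ _ (potSum_pos hν hR').ne',
    div_mul_cancel₀ _ (potSum_pos hν hw').ne', potDag_of_ne (by omega), potDag_of_ne (by omega),
    if_neg (by omega), if_neg (by omega), show -(w : ℤ) - R = -R - w by ring]
  ring

/-- From the negative half-line the walk visits `0` before `R` with high probability. -/
theorem NegPotNegligible.hitFirst_neg_le (hν : CenteredLaw ν) (hr : NegPotNegligible ν) {ε : ℝ}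
    (hε : 0 < ε) : ∀ᶠ R : ℕ in atTop, ∀ w : ℕ, 0 < w → hitFirst ν R (-w) ≤ ε := by
  obtain ⟨C, hC0, hC⟩ := hr.exists_le hν one_pos
  filter_upwards [hr.eventually_lt hν 0, hr.eventually_lt hν ((1 + C) / ε),
    hr.eventually_le hν (show 0 < ε / (2 + C) by positivity), eventually_gt_atTop 0]
    with R hR0 hR1 hR2 hRpos w hw
  have hR' : (R : ℤ) ≠ 0 := by omega
  have hw' : (w : ℤ) ≠ 0 := by omega
  have hZ := potSum_pos hν hR'
  have hZR : pot ν R ≤ potSum ν R := by rw [potSum]; linarith [pot_nonneg hν (-R)]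
  -- If a(w) ≥ 1, the symmetry moves the start to -R, where the numerator is a(-R), which is small
  -- against a(R). If a(w) < 1, then a(-w) is bounded and a(R) → ∞ suffices.
  rcases le_or_gt 1 (pot ν w) with h1 | h1
  · have h2 := hitFirst_symm hν hw hRpos
    have h3 := hitFirst_le hν hw' (by linarith) (-R)
    rw [potDag_of_ne (by omega)] at h3
    have h4 : potSum ν w ≤ (2 + C) * pot ν w := by
      rw [potSum]
      nlinarith [hC w]
    have h5 : hitFirst ν R (-w) * potSum ν R ≤ (2 + C) * pot ν (-R) := by
      rw [h2]
      calc hitFirst ν w (-R) * potSum ν w ≤ pot ν (-R) / pot ν w * ((2 + C) * pot ν w) := by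
            gcongr
            · exact (potSum_pos hν hw').le
            · exact div_nonneg (pot_nonneg hν _) (by linarith)
        _ = _ := by field_simp
    have h6 : (2 + C) * pot ν (-R) ≤ ε * pot ν R := by
      calc (2 + C) * pot ν (-R) ≤ (2 + C) * (ε / (2 + C) * pot ν R) := by gcongr
        _ = _ := by field_simp
    have h7 : hitFirst ν R (-w) * potSum ν R ≤ ε * potSum ν R :=
      h5.trans (h6.trans (by gcongr))
    exact le_of_mul_le_mul_right h7 hZ
  · have h2 := hitFirst_le hν hR' hR0 (-w)
    rw [potDag_of_ne (by omega)] at h2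
    refine h2.trans ?_
    rw [div_le_iff₀ hR0]
    rw [div_lt_iff₀ hε] at hR1
    have := hC w
    linarith

/-- By harmonicity a zero of a at x > 0 propagates along any positive step of the support, which
contradicts a(n) → ∞. -/
lemma NegPotNegligible.pot_pos (hν : CenteredLaw ν) (hr : NegPotNegligible ν) {x : ℤ}
    (hx : 0 < x) : 0 < pot ν x := by
  refine lt_of_le_of_ne (pot_nonneg hν x) fun h0 => ?_
  obtain ⟨k, hk0, hk⟩ := exists_pos_supp hν
  have hz : ∀ j : ℕ, pot ν (x + j * k) = 0 := by
    intro j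
    induction j with
    | zero => simpa using h0.symm
    | succ j ih =>
      have hne : x + j * k ≠ 0 := by positivity
      have h1 := avg_pot hν (x + j * k)
      rw [ih, if_neg hne, add_zero] at h1
      have := eq_zero_of_avg_eq_zero (integrable_pot_shift hν _) (pot_nonneg hν) h1 hk
      rw [← this]; congr 1; push_cast; ring
  obtain ⟨N, hN⟩ := eventually_atTop.1 (hr.eventually_lt hν 0)
  have h1 : (N : ℤ) ≤ x + N * k := by nlinarith
  have h2 := hN (x + N * k).toNat (by omega)
  rw [Int.toNat_of_nonneg (by omega), hz] at h2
  exact lt_irrefl _ h2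

lemma NegPotNegligible.potDag_pos (hν : CenteredLaw ν) (hr : NegPotNegligible ν) {x : ℤ}
    (hx : 0 ≤ x) : 0 < potDag ν x := by
  rcases hx.eq_or_lt with rfl | hx
  · rw [potDag_zero hν]; exact one_pos
  · exact (hr.pot_pos hν hx).trans_le (pot_le_potDag x)

/-- `|a(-R) - a(x - R)|` is small compared with `a†(x)`, uniformly in `0 ≤ x < R`. -/
theorem NegPotNegligible.abs_sub_le (hν : CenteredLaw ν) (hr : NegPotNegligible ν) {ε : ℝ}
    (hε : 0 < ε) : ∀ᶠ R : ℕ in atTop, ∀ x : ℤ, 0 ≤ x → x < R →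
      |pot ν (-R) - pot ν (x - R)| ≤ ε * potDag ν x := by
  obtain ⟨N, hN⟩ := eventually_atTop.1 (((hr.hitFirst_neg_le hν (half_pos hε)).and
    (hr.eventually_le hν (show 0 < min ε 1 by positivity))).and (eventually_gt_atTop 0))
  -- For the finitely many small x the increments of a at -∞ vanish; the hitting estimate is used
  -- for x ≥ N only.
  have hsmall : ∀ᶠ R : ℕ in atTop, ∀ n ∈ Finset.range N,
      |pot ν (-R) - pot ν ((n : ℤ) - R)| ≤ ε * potDag ν n := by
    rw [Filter.eventually_all_finset]
    intro n _
    have h1 : Tendsto (fun R : ℕ => -(R : ℤ)) atTop (atBot ⊔ atTop) :=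
      (tendsto_neg_atTop_atBot.comp tendsto_natCast_atTop_atTop).mono_right le_sup_left
    have h2 := ((tendsto_pot_increment hν n).comp h1).abs
    rw [abs_zero] at h2
    filter_upwards [h2.eventually (gt_mem_nhds (mul_pos hε
      (hr.potDag_pos hν (Int.natCast_nonneg n))))] with R hR
    simp only [Function.comp] at hR
    rw [abs_sub_comm, show (n : ℤ) - R = -R + n by ring]
    exact hR.le
  filter_upwards [hsmall] with R hR x hx0 hxR
  lift x to ℕ using hx0
  rcases lt_or_ge x N with hxN | hxN
  · exact hR x (Finset.mem_range.2 hxN)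
  obtain ⟨⟨h1, h2⟩, hx⟩ := hN x hxN
  have hx' : (x : ℤ) ≠ 0 := by omega
  have hpx := pot_nonneg hν x
  have h2' : pot ν (-x) ≤ pot ν x := h2.trans (by nlinarith [min_le_right ε 1])
  have h2'' : pot ν (-x) ≤ ε * pot ν x := h2.trans (by nlinarith [min_le_left ε 1])
  -- With w = R - x, the small probability of hitting x before 0 from -w bounds a(x - R) - a(-R)
  -- from above. The other direction is subadditivity and a(-x) ≤ ε a(x).
  obtain ⟨w, hw, hwR⟩ : ∃ w : ℕ, 0 < w ∧ (R : ℤ) = w + x := ⟨R - x, by omega, by omega⟩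
  have h3 := h1 w hw
  rw [hitFirst, div_le_iff₀ (potSum_pos hν hx'), potDag_of_ne (by omega), if_neg (by omega),
    potSum] at h3
  have h4 := pot_sub_le hν (-R) (x - R)
  rw [show -(R : ℤ) - (x - R) = -x by ring] at h4
  rw [potDag_of_ne hx', abs_le, hwR]
  rw [hwR] at h4
  rw [show (x : ℤ) - (w + x) = -w by ring, show -((w : ℤ) + x) = -w - x by ring] at *
  constructor <;> nlinarith [pot_nonneg hν (-x)]

/-- `P_x[σ_R < σ_0] ∼ a†(x) / a(R)` uniformly for `0 ≤ x < R`. -/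
theorem NegPotNegligible.hitFirst_equiv (hν : CenteredLaw ν) (hr : NegPotNegligible ν) :
    UniformEquiv (fun R => Set.Ico 0 (R : ℤ)) (fun R x => hitFirst ν R x)
      (fun R x => potDag ν x / pot ν R) := by
  intro ε hε
  set δ := min (ε / 4) (1 / 2) with hδ
  have hδ0 : 0 < δ := by positivity
  have hδ1 : δ ≤ ε / 4 := min_le_left _ _
  have hδ2 : δ ≤ 1 / 2 := min_le_right _ _
  filter_upwards [hr.abs_sub_le hν hδ0, hr.eventually_le hν hδ0, hr.eventually_lt hν 0,
    eventually_gt_atTop 0] with R h1 h2 h3 h4 x hx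
  have hd := hr.potDag_pos hν hx.1
  have h5 := abs_le.1 (h1 x hx.1 hx.2)
  have hZ : 0 < potSum ν R := potSum_pos hν (by omega)
  have hn := pot_nonneg hν (-R)
  have heq : hitFirst ν R x / (potDag ν x / pot ν R) - 1
      = ((pot ν (-R) - pot ν (x - R)) * pot ν R - potDag ν x * pot ν (-R))
        / (potDag ν x * potSum ν R) := by
    rw [hitFirst, if_neg hx.2.ne]
    rw [div_div_div_eq, div_sub_one (by positivity)]
    congr 1
    · rw [potSum]; ring
    · ring
  have hden : 0 < potDag ν x * potSum ν R := by positivity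
  rw [heq, abs_div, abs_of_pos hden, div_lt_iff₀ hden]
  have h6 : |(pot ν (-R) - pot ν (x - R)) * pot ν R - potDag ν x * pot ν (-R)|
      ≤ 2 * δ * potDag ν x * pot ν R := by
    rw [abs_le]; constructor <;> nlinarith [mul_pos hd h3]
  refine h6.trans_lt ?_
  rw [potSum]
  have h7 : 0 < potDag ν x * pot ν R := by positivity
  have h8 : 0 ≤ potDag ν x * pot ν (-R) := by positivity
  nlinarith

/-- `P_x[σ_{[R,∞)} < σ_0] ∼ P_x[σ_R < σ_0]` uniformly for `0 ≤ x < R`. -/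
theorem NegPotNegligible.hitRay_equiv (hν : CenteredLaw ν) (hr : NegPotNegligible ν)
    {h : ℕ → ℤ → ℝ} (h0 : ∀ R x, 0 ≤ h R x) (h1 : ∀ R x, h R x ≤ 1)
    (heq : ∀ R x, h R x = avg ν (payoff (Set.Ici (R : ℤ)) {0} (h R)) x) :
    UniformEquiv (fun R => Set.Ico 0 (R : ℤ)) h (fun R x => hitFirst ν R x) := by
  intro ε hε
  set δ := min (ε / 4) (1 / 4) with hδ
  have hδ0 : 0 < δ := by positivity
  have hδ1 : δ ≤ ε / 4 := min_le_left _ _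
  have hδ2 : δ ≤ 1 / 4 := min_le_right _ _
  filter_upwards [hr.hitFirst_equiv hν δ hδ0, hr.eventually_pot_le hν hδ0, hr.eventually_lt hν 0,
    eventually_gt_atTop 0] with R hF hmono hR0 hRpos x hx
  have hR' : (R : ℤ) ≠ 0 := by omega
  have habs : ∀ x, |h R x| ≤ 1 := fun x => abs_le.2 ⟨by linarith [h0 R x], h1 R x⟩
  have hlin : LinGrowth (h R) := linGrowth_of_abs_le habs
  obtain ⟨C, hC⟩ := abs_hitFirst_le hν hR'
  have hlow : hitFirst ν R x ≤ h R x := by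
    refine payoff_comparison hν (A := {(R : ℤ)}) (B := {0}) (C := C) ⟨0, by simp⟩
      (linGrowth_of_abs_le hC) hlin (fun y => ?_) (fun y => (hitFirst_eq_avg hν hR' y).le)
      (fun y => ?_) x
    · linarith [(abs_le.1 (hC y)).2, h0 R y]
    · rw [heq R y]
      refine avg_mono ((hlin.payoff _ _).integrable_shift hν.integrable y)
        ((hlin.payoff _ _).integrable_shift hν.integrable y) fun z => ?_
      by_cases hz0 : z = 0
      · subst hz0; rw [payoff_self_right, payoff_self_right]
      by_cases hzR : z = R
      · subst hzR; rw [payoff_self_left hz0, payoff_of_mem_left (by simpa using hz0) (by simp)]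
      · rw [payoff_of_ne hz0 hzR]
        by_cases hzm : z ∈ Set.Ici (R : ℤ)
        · rw [payoff_of_mem_left (by simpa using hz0) hzm]; exact h1 R z
        · rw [payoff_of_notMem (by simpa using hz0) hzm]
  -- This is a supersolution for hitting [R, ∞): by approximate monotonicity (1 + δ) a(z) ≥ a(R) for
  -- all z ≥ R.
  set v : ℤ → ℝ := fun y => (1 + δ) / pot ν R * potDag ν y with hv
  have hv0 : ∀ y, 0 ≤ v y := fun y =>
    mul_nonneg (by positivity) ((pot_nonneg hν y).trans (pot_le_potDag y))
  have hvlin : LinGrowth v := by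
    obtain ⟨K, hK⟩ := linGrowth_potDag hν
    refine ⟨(1 + δ) / pot ν R * K, fun y => ?_⟩
    rw [hv, abs_mul, abs_of_pos (by positivity : 0 < (1 + δ) / pot ν R), mul_assoc]
    gcongr
    exact hK y
  have hup : h R x ≤ v x := by
    refine payoff_comparison hν (A := Set.Ici (R : ℤ)) (B := {0}) (C := 1) ⟨0, by simp⟩
      hlin hvlin (fun y => ?_) (fun y => (heq R y).le) (fun y => ?_) x
    · linarith [hv0 y, h1 R y]
    · have h2 : avg ν (fun z => (1 + δ) / pot ν R * pot ν z) y = v y := by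
        rw [hv]; simp only; rw [potDag_eq_avg hν]; exact integral_const_mul _ _
      rw [← h2]
      refine avg_mono ((hvlin.payoff _ _).integrable_shift hν.integrable y)
        ((integrable_pot_shift hν y).const_mul _) fun z => ?_
      by_cases hz0 : z = 0
      · subst hz0; rw [payoff_self_right, pot_zero hν, mul_zero]
      by_cases hzm : z ∈ Set.Ici (R : ℤ)
      · rw [payoff_of_mem_left (by simpa using hz0) hzm, div_mul_eq_mul_div, le_div_iff₀ hR0, one_mul]
        have hz : (R : ℤ) ≤ z := hzm
        have := hmono z.toNat (by omega)
        rwa [Int.toNat_of_nonneg (by omega)] at this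
      · rw [payoff_of_notMem (by simpa using hz0) hzm, hv]
        simp only
        rw [potDag_of_ne hz0]
  have hF' := abs_lt.1 (hF x hx)
  have hd := hr.potDag_pos hν hx.1
  have hq : 0 < potDag ν x / pot ν R := by positivity
  have hF1 : (1 - δ) * (potDag ν x / pot ν R) ≤ hitFirst ν R x := by
    have h3 : 1 - δ ≤ hitFirst ν R x / (potDag ν x / pot ν R) := by linarith [hF'.1]
    exact (le_div_iff₀ hq).1 h3
  have hvx : v x = (1 + δ) * (potDag ν x / pot ν R) := by rw [hv]; ring
  have hFpos : 0 < hitFirst ν R x := lt_of_lt_of_le (by nlinarith) hF1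
  rw [abs_lt]
  constructor
  · have : 1 ≤ h R x / hitFirst ν R x := (one_le_div hFpos).2 hlow
    linarith
  · have : h R x / hitFirst ν R x < 1 + ε := by
      rw [div_lt_iff₀ hFpos]
      refine (hup.trans_eq hvx).trans_lt ?_
      nlinarith
    linarith

/-! ### Hitting a half-line before a far point -/

lemma payoff_one_sub_hitFirst {R : ℤ} (hR : R ≠ 0) (y : ℤ) :
    payoff {0} {R} (fun x => 1 - hitFirst ν R x) y = 1 - payoff {R} {0} (hitFirst ν R) y := by
  by_cases hy0 : y = 0
  · subst hy0; rw [payoff_self_right, payoff_self_left hR.symm, sub_zero]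
  by_cases hyR : y = R
  · subst hyR; rw [payoff_self_right, payoff_self_left hR, sub_self]
  · rw [payoff_of_ne hyR hy0, payoff_of_ne hy0 hyR]

lemma one_sub_hitFirst_eq_avg (hν : CenteredLaw ν) {R : ℤ} (hR : R ≠ 0) (x : ℤ) :
    1 - hitFirst ν R x = avg ν (payoff {0} {R} fun x => 1 - hitFirst ν R x) x := by
  obtain ⟨C, hC⟩ := abs_hitFirst_le hν hR
  rw [show payoff {0} {R} (fun x => 1 - hitFirst ν R x)
    = fun y => 1 - payoff {R} {0} (hitFirst ν R) y from funext (payoff_one_sub_hitFirst hR),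
    avg_sub (integrable_const _)
      (((linGrowth_of_abs_le hC).payoff _ _).integrable_shift hν.integrable x), avg_const,
    ← hitFirst_eq_avg hν hR]

/-- Otherwise the walk is left-continuous and a vanishes on the positive half-line, against the
hypothesis. -/
lemma NegPotNegligible.exists_jump_le_neg_two (hν : CenteredLaw ν) (hr : NegPotNegligible ν) :
    ∃ k : ℤ, k ≤ -2 ∧ ν {k} ≠ 0 := by
  by_contra! hcon
  have h0 := pot_eq_zero_of_leftContinuous hν fun k hk => by
    by_contra hk'
    exact hk (hcon k (by omega))
  obtain ⟨n, hn⟩ := hr.1.exists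
  exact hn (h0 n)

/-- If `0` is visited before `R` with positive probability from the negative half-line, and the
walk can jump to the left over points, then this holds from every starting point. -/
theorem hit_zero_first_pos (hν : CenteredLaw ν) {R : ℤ} (hR : 0 < R) {f : ℤ → ℝ}
    (hf0 : ∀ x, 0 ≤ f x) (hf1 : ∀ x, f x ≤ 1) (hf : ∀ x, f x = avg ν (payoff {0} {R} f) x)
    (hneg : ∀ x < 0, 0 < f x) {k₀ : ℤ} (hk₀ : k₀ ≤ -2) (hk₀' : ν {k₀} ≠ 0) (x : ℤ) : 0 < f x := by
  have hlin : LinGrowth f :=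
    linGrowth_of_abs_le (C := 1) fun x => abs_le.2 ⟨by linarith [hf0 x], hf1 x⟩
  have hp0 : ∀ y, 0 ≤ payoff {0} {R} f y := fun y => by
    unfold payoff; split_ifs <;> first | exact le_rfl | exact zero_le_one | exact hf0 y
  -- A zero of f is passed on by every possible step, except a step that lands on R.
  have hstep : ∀ y k, f y = 0 → ν {k} ≠ 0 → y + k = R ∨ f (y + k) = 0 := by
    intro y k hy hk
    have h1 := eq_zero_of_avg_eq_zero ((hlin.payoff {0} {R}).integrable_shift hν.integrable y) hp0
      (by rw [← hf, hy]) hk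
    by_contra! hcon
    by_cases h0 : y + k = 0
    · rw [h0, payoff_self_left hR.ne] at h1
      exact one_ne_zero h1
    · rw [payoff_of_ne hcon.1 h0] at h1
      exact hcon.2 h1
  -- From y ≤ R, repeated jumps by k₀ stay below R and end on the negative half-line, where f is
  -- positive.
  have hleft : ∀ y ≤ R, 0 < f y := by
    intro y hy
    refine lt_of_le_of_ne (hf0 y) fun h0 => ?_
    have hz : ∀ j : ℕ, f (y + j * k₀) = 0 := by
      intro j
      induction j with
      | zero => simpa using h0.symm
      | succ j ih =>
        have h1 := hstep _ k₀ ih hk₀'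
        rw [show y + j * k₀ + k₀ = y + ((j + 1 : ℕ) : ℤ) * k₀ by push_cast; ring] at h1
        refine h1.resolve_left ?_
        have : ((j + 1 : ℕ) : ℤ) * k₀ < 0 := by
          apply mul_neg_of_pos_of_neg <;> [positivity; linarith]
        linarith
    have h1 := hz (R.toNat + 1)
    have h2 := hneg (y + ((R.toNat + 1 : ℕ) : ℤ) * k₀) (by
      push_cast; rw [Int.toNat_of_nonneg hR.le]; nlinarith)
    exact h2.ne' h1
  rcases le_or_gt x R with hxR | hxR
  · exact hleft x hxR
  refine lt_of_le_of_ne (hf0 x) fun h0 => ?_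
  have hge : ∀ y k, f y = 0 → ν {k} ≠ 0 → R ≤ y + k := by
    intro y k hy hk
    rcases hstep y k hy hk with h | h
    · exact h.ge
    · by_contra hcon
      exact (hleft _ (not_le.1 hcon).le).ne' h
  -- From a zero above R, repeated jumps by k₀ can never go below R, so they must land exactly on R,
  -- and k₀ divides y - R.
  have hdiv : ∀ n : ℕ, ∀ y, y = R + n → f y = 0 → k₀ ∣ y - R := by
    intro n
    induction n using Nat.strong_induction_on with
    | _ n ih =>
      intro y hyn hy
      have h1 := hge y k₀ hy hk₀'
      rcases hstep y k₀ hy hk₀' with h | h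
      · exact ⟨-1, by linarith⟩
      · obtain ⟨m, hm⟩ : ∃ m : ℕ, y + k₀ = R + m := ⟨(y + k₀ - R).toNat, by omega⟩
        obtain ⟨c, hc⟩ := ih m (by omega) (y + k₀) hm h
        exact ⟨c - 1, by linarith⟩
  have hdiv' : ∀ y, R < y → f y = 0 → k₀ ∣ y - R := fun y hy h =>
    hdiv (y - R).toNat y (by omega) h
  have hup : ∀ k, 0 < k → ν {k} ≠ 0 → ∀ y, R < y → f y = 0 → f (y + k) = 0 := by
    intro k hk0 hk y hy h
    exact (hstep y k h hk).resolve_left (by omega)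
  -- Climbing by positive steps leaves room for any step k to stay above R. The zeros before and
  -- after that step are both congruent to R, so k₀ divides k; as k₀ ≤ -2 this contradicts that the
  -- support generates ℤ.
  have hall : ∀ k, ν {k} ≠ 0 → k₀ ∣ k := by
    intro k hk
    obtain ⟨p, hp0, hp⟩ := exists_pos_supp hν
    have hz : ∀ j : ℕ, f (x + j * p) = 0 ∧ R < x + j * p := by
      intro j
      induction j with
      | zero => simpa using ⟨h0.symm, hxR⟩
      | succ j ih =>
        have := hup p hp0 hp _ ih.2 ih.1
        rw [show x + ((j + 1 : ℕ) : ℤ) * p = x + j * p + p by push_cast; ring]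
        exact ⟨this, by linarith [ih.2]⟩
    obtain ⟨hz1, hz2⟩ := hz k.natAbs
    have h1 : R < x + k.natAbs * p + k := by
      have : (k.natAbs : ℤ) ≤ k.natAbs * p := by nlinarith [Int.natCast_nonneg k.natAbs]
      omega
    have h2 := (hstep _ k hz1 hk).resolve_left (by omega)
    have h3 := dvd_sub (hdiv' _ h1 h2) (hdiv' _ hz2 hz1)
    rwa [show x + k.natAbs * p + k - R - (x + k.natAbs * p - R) = k by ring] at h3
  have hle : AddSubgroup.closure {k : ℤ | ν {k} ≠ 0} ≤ AddSubgroup.zmultiples k₀ := by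
    rw [AddSubgroup.closure_le]
    exact fun k hk => Int.mem_zmultiples_iff.2 (hall k hk)
  have h1 : (1 : ℤ) ∈ AddSubgroup.zmultiples k₀ := hle (by rw [hν.gen]; trivial)
  have h2 := Int.isUnit_iff.1 (isUnit_of_dvd_one (Int.mem_zmultiples_iff.1 h1))
  omega

/-- `P_x[σ_{(-∞,0]} < σ_R] ∼ P_x[σ_0 < σ_R]` uniformly in `x`. -/
theorem NegPotNegligible.hitLeftRay_equiv (hν : CenteredLaw ν) (hr : NegPotNegligible ν)
    {g f : ℕ → ℤ → ℝ} (hg0 : ∀ R x, 0 ≤ g R x) (hg1 : ∀ R x, g R x ≤ 1)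
    (hg : ∀ R x, g R x = avg ν (payoff (Set.Iic 0) {(R : ℤ)} (g R)) x)
    (hf0 : ∀ R x, 0 ≤ f R x) (hf1 : ∀ R x, f R x ≤ 1)
    (hf : ∀ R x, f R x = avg ν (payoff {0} {(R : ℤ)} (f R)) x) :
    UniformEquiv (fun _ => Set.univ) g f := by
  intro ε hε
  set δ := min (ε / 4) (1 / 4) with hδ
  have hδ0 : 0 < δ := by positivity
  have hδ1 : δ ≤ ε / 4 := min_le_left _ _
  have hδ2 : δ ≤ 1 / 4 := min_le_right _ _
  obtain ⟨k₀, hk₀, hk₀'⟩ := hr.exists_jump_le_neg_two hν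
  filter_upwards [hr.hitFirst_neg_le hν hδ0, eventually_gt_atTop 0] with R hF hRpos x _
  have hR' : (R : ℤ) ≠ 0 := by omega
  have habs : ∀ {h : ℕ → ℤ → ℝ}, (∀ R x, 0 ≤ h R x) → (∀ R x, h R x ≤ 1) → ∀ x, |h R x| ≤ 1 :=
    fun h0 h1 x => abs_le.2 ⟨by linarith [h0 R x], h1 R x⟩
  obtain ⟨C, hC⟩ := abs_hitFirst_le hν hR'
  have hfF : ∀ y, f R y = 1 - hitFirst ν R y :=
    payoff_unique hν (A := {0}) (B := {(R : ℤ)}) ⟨0, by simp⟩ (habs hf0 hf1)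
      (v := fun y => 1 - hitFirst ν R y) (C' := 1 + C)
      (fun y => by
        have := abs_le.1 (hC y)
        have hC0 : 0 ≤ C := (abs_nonneg _).trans (hC y)
        rw [abs_le]; constructor <;> linarith) (hf R)
      (one_sub_hitFirst_eq_avg hν hR')
  have hneg : ∀ y < 0, 1 - δ ≤ f R y := by
    intro y hy
    have := hF y.natAbs (by omega)
    rw [show -(y.natAbs : ℤ) = y by omega] at this
    rw [hfF]; linarith
  have hpos : ∀ y, 0 < f R y := hit_zero_first_pos hν (by omega) (hf0 R) (hf1 R) (hf R)
    (fun y hy => by linarith [hneg y hy]) hk₀ hk₀'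
  have hlf := linGrowth_of_abs_le (habs hf0 hf1)
  have hlg := linGrowth_of_abs_le (habs hg0 hg1)
  have hlow : f R x ≤ g R x := by
    refine payoff_comparison hν (A := {0}) (B := {(R : ℤ)}) (C := 1) ⟨0, by simp⟩ hlf hlg
      (fun y => by linarith [hf1 R y, hg0 R y]) (fun y => (hf R y).le) (fun y => ?_) x
    rw [hg R y]
    refine avg_mono ((hlg.payoff _ _).integrable_shift hν.integrable y)
      ((hlg.payoff _ _).integrable_shift hν.integrable y) fun z => ?_
    by_cases hzR : z = R
    · subst hzR; rw [payoff_self_right, payoff_self_right]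
    by_cases hz0 : z = 0
    · subst hz0; rw [payoff_self_left hR'.symm, payoff_of_mem_left (by simpa using hzR) (by simp)]
    · rw [payoff_of_ne hzR hz0]
      by_cases hzm : z ∈ Set.Iic (0 : ℤ)
      · rw [payoff_of_mem_left (by simpa using hzR) hzm]; exact hg1 R z
      · rw [payoff_of_notMem (by simpa using hzR) hzm]
  have hδ' : 0 < 1 - δ := by linarith
  -- On the negative half-line f ≥ 1 - δ, so this multiple of f pays at least 1 there and is a
  -- supersolution for entering (-∞, 0].
  set v : ℤ → ℝ := fun y => (1 - δ)⁻¹ * f R y with hv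
  have hv0 : ∀ y, 0 ≤ v y := fun y => mul_nonneg (by positivity) (hf0 R y)
  have hvlin : LinGrowth v := linGrowth_of_abs_le (C := (1 - δ)⁻¹ * 1) fun y => by
    rw [hv, abs_mul, abs_of_pos (by positivity : 0 < (1 - δ)⁻¹)]
    gcongr
    exact habs hf0 hf1 y
  have hup : g R x ≤ v x := by
    refine payoff_comparison hν (A := Set.Iic 0) (B := {(R : ℤ)}) (C := 1) ⟨0, by simp⟩ hlg hvlin
      (fun y => by linarith [hg1 R y, hv0 y]) (fun y => (hg R y).le) (fun y => ?_) x
    have h2 : avg ν (fun z => (1 - δ)⁻¹ * payoff {0} {(R : ℤ)} (f R) z) y = v y := by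
      rw [hv]; simp only; rw [hf R y]; exact integral_const_mul _ _
    rw [← h2]
    refine avg_mono ((hvlin.payoff _ _).integrable_shift hν.integrable y)
      (((hlf.payoff _ _).integrable_shift hν.integrable y).const_mul _) fun z => ?_
    have hinv : 1 ≤ (1 - δ)⁻¹ := (one_le_inv₀ hδ').2 (by linarith)
    by_cases hzR : z = R
    · subst hzR; rw [payoff_self_right, payoff_self_right, mul_zero]
    by_cases hz0 : z = 0
    · subst hz0
      rw [payoff_self_left hR'.symm, payoff_of_mem_left (by simpa using hzR) (by simp)]
      linarith
    · rw [payoff_of_ne hzR hz0]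
      by_cases hzm : z ∈ Set.Iic (0 : ℤ)
      · rw [payoff_of_mem_left (by simpa using hzR) hzm, ← div_eq_inv_mul, le_div_iff₀ hδ', one_mul]
        exact hneg z (lt_of_le_of_ne hzm hz0)
      · rw [payoff_of_notMem (by simpa using hzR) hzm]
  have hfx := hpos x
  rw [abs_lt]
  constructor
  · have : 1 ≤ g R x / f R x := (one_le_div hfx).2 hlow
    linarith
  · have : g R x / f R x < 1 + ε := by
      rw [div_lt_iff₀ hfx]
      refine hup.trans_lt ?_
      rw [hv]
      simp only
      rw [← div_eq_inv_mul, div_lt_iff₀ hδ']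
      have : 1 < (1 + ε) * (1 - δ) := by nlinarith
      nlinarith
    linarith

/-- The symmetrised potential is asymptotically increasing. -/
theorem NegPotNegligible.exists_strictMono_equiv (hν : CenteredLaw ν) (hr : NegPotNegligible ν) :
    ∃ f : ℕ → ℝ, StrictMono f ∧ (fun n : ℕ => potSum ν n / 2) ~[atTop] f := by
  -- The running maximum of a is monotone and equivalent to a by approximate monotonicity.
  set S : ℕ → ℝ := fun n => (Finset.range (n + 1)).sup' ⟨0, by simp⟩ fun m : ℕ => pot ν m with hS
  have hSmono : Monotone S := fun m n hmn =>
    Finset.sup'_mono _ (Finset.range_subset_range.2 (by omega)) _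
  have hle : ∀ n : ℕ, pot ν n ≤ S n := fun n =>
    Finset.le_sup' (fun m : ℕ => pot ν m) (Finset.mem_range.2 (Nat.lt_succ_self n))
  have hSle : ∀ (n : ℕ) (B : ℝ), (∀ m : ℕ, m ≤ n → pot ν m ≤ B) → S n ≤ B := fun n B hB =>
    Finset.sup'_le _ _ fun m hm => hB m (by have := Finset.mem_range.1 hm; omega)
  -- The bounded second term makes the function strictly increasing and is negligible since a(n) →
  -- ∞; the factor 1/2 appears because a(-n) is negligible in the symmetrised potential.
  refine ⟨fun n => S n / 2 + (1 - 1 / ((n : ℝ) + 1)), ?_, ?_⟩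
  · refine strictMono_nat_of_lt_succ fun n => ?_
    have h1 := hSmono (Nat.le_succ n)
    have h2 : 1 / (((n + 1 : ℕ) : ℝ) + 1) < 1 / ((n : ℝ) + 1) := by
      push_cast
      apply one_div_lt_one_div_of_lt <;> [positivity; linarith]
    simp only [Nat.succ_eq_add_one] at h1
    linarith
  · rw [IsEquivalent, isLittleO_iff]
    intro c hc
    obtain ⟨C, hC0, hC⟩ := hr.pot_le hν (show 0 < c / 4 by positivity)
    filter_upwards [hr.eventually_lt hν (4 * (C + 2) / c), hr.eventually_lt hν 0,
      hr.eventually_le hν (show 0 < c / 4 by positivity)] with n hn hn0 hneg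
    rw [div_lt_iff₀ hc] at hn
    have h1 := hle n
    have h2 := hSle n _ fun m hm => hC m n hm
    have h3 : 0 ≤ 1 - 1 / ((n : ℝ) + 1) := by
      rw [sub_nonneg, div_le_one (by positivity)]; linarith [Nat.cast_nonneg (α := ℝ) n]
    have h4 : 1 - 1 / ((n : ℝ) + 1) ≤ 1 := by
      have : 0 ≤ 1 / ((n : ℝ) + 1) := by positivity
      linarith
    have h5 := pot_nonneg hν (-n)
    simp only [Pi.sub_apply, Real.norm_eq_abs, potSum]
    rw [abs_of_nonneg (a := S n / 2 + (1 - 1 / ((n : ℝ) + 1))) (by linarith)]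
    rw [abs_le]
    constructor <;> nlinarith

end

/-! ### Hitting and return probabilities of the walk: conditioning on the first step -/

/-- The path `s` of increments leads from `x` to `A` strictly before visiting `B`. -/
def Visits (A B : Set ℤ) (x : ℤ) (s : ℕ → ℤ) : Prop :=
  ∃ k : ℕ, 1 ≤ k ∧ x + ∑ i ∈ Finset.range k, s i ∈ A ∧
    ∀ j : ℕ, 1 ≤ j → j ≤ k → x + ∑ i ∈ Finset.range j, s i ∉ B

/-- B is tested before A because the comparison of hitting times is strict; this is the order built
into `payoff`. -/
lemma visits_iff (A B : Set ℤ) (x : ℤ) (s : ℕ → ℤ) :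
    Visits A B x s ↔
      x + s 0 ∉ B ∧ (x + s 0 ∈ A ∨ Visits A B (x + s 0) fun i => s (i + 1)) := by
  have hs : ∀ k, x + ∑ i ∈ Finset.range (k + 1), s i
      = x + s 0 + ∑ i ∈ Finset.range k, s (i + 1) := fun k => by
    rw [Finset.sum_range_succ']; ring
  constructor
  · rintro ⟨k, hk, hA, hB⟩
    have h1 := hB 1 le_rfl hk
    have h2 := hs 0
    simp only [zero_add, Finset.range_zero, Finset.sum_empty, add_zero] at h2
    refine ⟨h2 ▸ h1, ?_⟩
    rcases hk.eq_or_lt with rfl | hk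
    · exact Or.inl (h2 ▸ hA)
    · obtain ⟨l, rfl⟩ : ∃ l, k = l + 1 := ⟨k - 1, by omega⟩
      exact Or.inr ⟨l, by omega, hs l ▸ hA, fun j hj hjl => hs j ▸ hB (j + 1) (by omega) (by omega)⟩
  · rintro ⟨hB, h | ⟨k, hk, hA, hB'⟩⟩
    · refine ⟨1, le_rfl, by simpa using h, fun j h1 h2 => ?_⟩
      obtain rfl : j = 1 := by omega
      simpa using hB
    · refine ⟨k + 1, by omega, (hs k).symm ▸ hA, fun j h1 h2 => ?_⟩
      obtain ⟨l, rfl⟩ : ∃ l, j = l + 1 := ⟨j - 1, by omega⟩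
      rw [hs l]
      rcases Nat.eq_zero_or_pos l with rfl | hl
      · simpa using hB
      · exact hB' l hl (by omega)

lemma measurableSet_visits (A B : Set ℤ) (x : ℤ) : MeasurableSet {s | Visits A B x s} := by
  have h : ∀ (k : ℕ) (D : Set ℤ),
      MeasurableSet {s : ℕ → ℤ | x + ∑ i ∈ Finset.range k, s i ∈ D} := fun k D =>
    (measurable_const.add (Finset.measurable_fun_sum _ fun i _ => measurable_pi_apply i))
      (.of_discrete (s := D))
  have e : {s | Visits A B x s} = ⋃ k : ℕ, {s : ℕ → ℤ | 1 ≤ k} ∩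
      ({s | x + ∑ i ∈ Finset.range k, s i ∈ A} ∩ ⋂ j : ℕ, ⋂ _ : 1 ≤ j, ⋂ _ : j ≤ k,
        {s | x + ∑ i ∈ Finset.range j, s i ∈ B}ᶜ) := by
    ext s; simp [Visits]
  rw [e]
  exact .iUnion fun k => (MeasurableSet.const _).inter ((h k A).inter
    (.iInter fun j => .iInter fun _ => .iInter fun _ => (h j B).compl))

section
variable {Ω : Type*}

lemma hit_lt_hit_iff (X : ℕ → Ω → ℤ) (x : ℤ) (A B : Set ℤ) (ω : Ω) :
    hit X x A ω < hit X x B ω ↔ Visits A B x fun i => X i ω := by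
  constructor
  · intro h
    have hne : hit X x A ω ≠ ⊤ := h.ne_top
    obtain ⟨k, hk⟩ := WithTop.ne_top_iff_exists.1 hne
    obtain ⟨j, hj, hjA⟩ := hittingAfter_le_iff.1 (show hit X x A ω ≤ k from hk.symm.le)
    refine ⟨j, hj.1, hjA, fun i hi hij => ?_⟩
    refine notMem_of_lt_hittingAfter (u := walk X x) (n := 1) (ω := ω) ?_ hi
    refine lt_of_le_of_lt ?_ h
    rw [← hk]
    exact WithTop.coe_le_coe.2 (hij.trans hj.2)
  · rintro ⟨k, hk, hA, hB⟩
    refine lt_of_le_of_lt (hittingAfter_le_of_mem (u := walk X x) hk hA) ?_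
    by_contra hcon
    obtain ⟨j, hj, hjB⟩ := hittingAfter_le_iff.1 (not_lt.1 hcon)
    exact hB j hj.1 hj.2 hjB

variable [MeasurableSpace Ω] {P : Measure Ω} [IsProbabilityMeasure P] {X : ℕ → Ω → ℤ}

lemma map_shift_eq (hmeas : ∀ i, Measurable (X i)) (hindep : iIndepFun X P)
    (hident : ∀ i, IdentDistrib (X i) (X 0) P P) :
    P.map (fun ω i => X (i + 1) ω) = P.map (fun ω i => X i ω) := by
  have h1 := (hindep.precomp (g := fun i : ℕ => i + 1)
    (fun a b h => by simpa using h)).map_fun_eq_infinitePi_map (fun i => hmeas (i + 1))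
  rw [h1, hindep.map_fun_eq_infinitePi_map hmeas]
  congr 1
  ext1 i
  rw [(hident (i + 1)).map_eq, (hident i).map_eq]

lemma indepFun_zero_shift (hmeas : ∀ i, Measurable (X i)) (hindep : iIndepFun X P) :
    IndepFun (X 0) (fun ω i => X (i + 1) ω) P := by
  refine IndepFun.indepFun_process (hmeas 0) (fun i => hmeas (i + 1)) fun I => ?_
  have h := hindep.indepFun_finset {0} (I.map ⟨fun i => i + 1, fun a b h => by simpa using h⟩)
    (by simp) hmeas
  exact h.comp
    (φ := fun v : ({0} : Finset ℕ) → ℤ => v ⟨0, Finset.mem_singleton_self 0⟩)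
    (ψ := fun v (i : I) => v ⟨(i : ℕ) + 1, Finset.mem_map.2 ⟨i, i.2, rfl⟩⟩)
    (measurable_pi_apply (X := fun _ : ({0} : Finset ℕ) => ℤ) _)
    (measurable_pi_lambda _ fun i => measurable_pi_apply _)

/-- Conditioning on the first increment. -/
theorem real_first_step (hmeas : ∀ i, Measurable (X i)) (hindep : iIndepFun X P)
    (hident : ∀ i, IdentDistrib (X i) (X 0) P P) {T : ℤ → Set (ℕ → ℤ)}
    (hT : ∀ k, MeasurableSet (T k)) :
    P.real {ω | (fun i => X (i + 1) ω) ∈ T (X 0 ω)}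
      = ∫ k, P.real {ω | (fun i => X i ω) ∈ T k} ∂(P.map (X 0)) := by
  have hX : Measurable fun ω i => X i ω := measurable_pi_lambda _ hmeas
  have hX' : Measurable fun ω i => X (i + 1) ω := measurable_pi_lambda _ fun i => hmeas (i + 1)
  have : IsProbabilityMeasure (P.map (X 0)) := Measure.isProbabilityMeasure_map (hmeas 0).aemeasurable
  have : IsProbabilityMeasure (P.map fun ω i => X i ω) :=
    Measure.isProbabilityMeasure_map hX.aemeasurable
  have hTm : MeasurableSet {p : ℤ × (ℕ → ℤ) | p.2 ∈ T p.1} := by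
    have : {p : ℤ × (ℕ → ℤ) | p.2 ∈ T p.1} = ⋃ k : ℤ, {k} ×ˢ T k := by
      ext ⟨k, s⟩; simp
    rw [this]
    exact .iUnion fun k => (measurableSet_singleton k).prod (hT k)
  have hmap := (indepFun_iff_map_prod_eq_prod_map_map (hmeas 0).aemeasurable hX'.aemeasurable).1
    (indepFun_zero_shift hmeas hindep)
  rw [map_shift_eq hmeas hindep hident] at hmap
  have h1 : P {ω | (fun i => X (i + 1) ω) ∈ T (X 0 ω)}
      = ∫⁻ k, P {ω | (fun i => X i ω) ∈ T k} ∂(P.map (X 0)) := by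
    have : P {ω | (fun i => X (i + 1) ω) ∈ T (X 0 ω)}
        = P.map (fun ω => (X 0 ω, fun i => X (i + 1) ω)) {p : ℤ × (ℕ → ℤ) | p.2 ∈ T p.1} := by
      rw [Measure.map_apply ((hmeas 0).prodMk hX') hTm]; rfl
    rw [this, hmap, Measure.prod_apply hTm]
    refine lintegral_congr fun k => ?_
    rw [Measure.map_apply hX (by exact hT k)]; rfl
  rw [Measure.real, h1, integral_eq_lintegral_of_nonneg_ae (ae_of_all _ fun k => measureReal_nonneg)
    (measurable_of_countable _).aestronglyMeasurable]
  congr 1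
  refine lintegral_congr fun k => ?_
  rw [Measure.real, ENNReal.ofReal_toReal (measure_ne_top _ _)]

theorem probHitBefore_eq_avg (hmeas : ∀ i, Measurable (X i)) (hindep : iIndepFun X P)
    (hident : ∀ i, IdentDistrib (X i) (X 0) P P) (A B : Set ℤ) (x : ℤ) :
    probHitBefore X P x A B
      = avg (P.map (X 0)) (payoff A B fun y => probHitBefore X P y A B) x := by
  have h0 : ∀ y, probHitBefore X P y A B = P.real {ω | Visits A B y fun i => X i ω} := fun y => by
    rw [probHitBefore]; congr 1; ext ω; exact hit_lt_hit_iff X y A B ω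
  have key := real_first_step hmeas hindep hident
    (T := fun k => {s | x + k ∉ B ∧ (x + k ∈ A ∨ Visits A B (x + k) s)})
    (fun k => (MeasurableSet.const _).inter ((MeasurableSet.const _).union
      (measurableSet_visits A B (x + k))))
  have h1 : P.real {ω | Visits A B x fun i => X i ω}
      = P.real {ω | (fun i => X (i + 1) ω) ∈
        {s : ℕ → ℤ | x + X 0 ω ∉ B ∧ (x + X 0 ω ∈ A ∨ Visits A B (x + X 0 ω) s)}} := by
    congr 1; ext ω; exact visits_iff A B x fun i => X i ω
  rw [h0, h1, key, avg]
  refine integral_congr_ae (ae_of_all _ fun k => ?_)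
  simp only [payoff]
  split_ifs with hB hA
  · simp [hB]
  · simp [hB, hA]
  · rw [h0]; simp [hB, hA]

theorem real_walk_eq_ret (hmeas : ∀ i, Measurable (X i)) (hindep : iIndepFun X P)
    (hident : ∀ i, IdentDistrib (X i) (X 0) P P) (n : ℕ) (x : ℤ) :
    P.real {ω | walk X x n ω = 0} = ret (P.map (X 0)) n x := by
  induction n generalizing x with
  | zero =>
    by_cases h : x = 0 <;> simp [walk, ret, h]
  | succ n ih =>
    have key := real_first_step hmeas hindep hident
      (T := fun k => {s | x + k + ∑ i ∈ Finset.range n, s i = 0})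
      (fun k => (measurable_const.add (Finset.measurable_fun_sum _ fun i _ => measurable_pi_apply i))
        (measurableSet_singleton 0))
    have h1 : P.real {ω | walk X x (n + 1) ω = 0} = P.real {ω | (fun i => X (i + 1) ω) ∈
        {s : ℕ → ℤ | x + X 0 ω + ∑ i ∈ Finset.range n, s i = 0}} := by
      congr 1; ext ω
      simp only [walk, Set.mem_ofPred_eq, Finset.sum_range_succ', add_assoc, add_comm (X 0 ω)]
    rw [h1, key]
    refine integral_congr_ae (ae_of_all _ fun k => ?_)
    exact ih (x + k)

lemma potentialPartial_eq (hmeas : ∀ i, Measurable (X i)) (hindep : iIndepFun X P)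
    (hident : ∀ i, IdentDistrib (X i) (X 0) P P) (x : ℤ) :
    potentialPartial X P x = fun N => partialPot (P.map (X 0)) N x := by
  have h : ∀ (n : ℕ) (x : ℤ), P.real {ω | walk X 0 n ω = -x} = ret (P.map (X 0)) n x := by
    intro n x
    rw [← real_walk_eq_ret hmeas hindep hident]
    congr 1; ext ω
    simp only [walk, Set.mem_ofPred_eq]
    omega
  ext N
  simp only [potentialPartial, partialPot, green, ← Finset.sum_sub_distrib, ← h, neg_zero]

lemma potential_eq (hmeas : ∀ i, Measurable (X i)) (hindep : iIndepFun X P)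
    (hident : ∀ i, IdentDistrib (X i) (X 0) P P) : potential X P = pot (P.map (X 0)) := by
  ext x; rw [potential, potentialPartial_eq hmeas hindep hident]; rfl

/-- Irreducibility is used only to see that the support generates ℤ: a point from which 0 can be
reached is minus a sum of support points. -/
theorem centeredLaw_map (hmeas : ∀ i, Measurable (X i)) (hindep : iIndepFun X P)
    (hident : ∀ i, IdentDistrib (X i) (X 0) P P) (hirr : WalkIrreducible X P)
    (hint : Integrable (fun ω => (X 0 ω : ℝ)) P) (hmean : ∫ ω, (X 0 ω : ℝ) ∂P = 0)
    (hvar : ∫⁻ ω, ENNReal.ofReal ((X 0 ω : ℝ) ^ 2) ∂P = ⊤) : CenteredLaw (P.map (X 0)) := by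
  have hm : Measurable fun k : ℤ => (k : ℝ) := measurable_of_countable _
  refine ⟨(integrable_map_measure hm.aestronglyMeasurable (hmeas 0).aemeasurable).2 hint,
    ?_, ?_, ?_⟩
  · rw [integral_map (hmeas 0).aemeasurable hm.aestronglyMeasurable]; exact hmean
  · rw [lintegral_map (measurable_of_countable _) (hmeas 0)]; exact hvar
  · have hret : ∀ (n : ℕ) (x : ℤ), ret (P.map (X 0)) n x ≠ 0 →
        x ∈ AddSubgroup.closure {k : ℤ | P.map (X 0) {k} ≠ 0} := by
      intro n
      induction n with
      | zero => intro x hx; by_cases h : x = 0 <;> simp_all [ret]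
      | succ n ih =>
        intro x hx
        by_contra hcon
        refine hx ?_
        rw [ret, avg]
        refine integral_eq_zero_of_ae ?_
        rw [EventuallyEq, ae_iff_of_countable]
        intro k hk
        by_contra h
        have h1 := ih _ h
        have h2 := AddSubgroup.subset_closure (show k ∈ {k : ℤ | P.map (X 0) {k} ≠ 0} from hk)
        exact hcon (by simpa using sub_mem h1 h2)
    rw [eq_top_iff]
    intro y _
    obtain ⟨n, hn⟩ := hirr (-y)
    refine hret n y ?_
    rw [← real_walk_eq_ret hmeas hindep hident]
    have : {ω | walk X y n ω = 0} = {ω | walk X 0 n ω = -y} := by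
      ext ω; simp only [walk, Set.mem_ofPred_eq]; omega
    rw [this]; exact hn.ne'

lemma probHitBefore_nonneg (x : ℤ) (A B : Set ℤ) : 0 ≤ probHitBefore X P x A B :=
  measureReal_nonneg

lemma probHitBefore_le_one (x : ℤ) (A B : Set ℤ) : probHitBefore X P x A B ≤ 1 :=
  measureReal_le_one

/-- Both sides are bounded solutions of the same one-step equation. -/
lemma probHitBefore_eq_hitFirst (hmeas : ∀ i, Measurable (X i)) (hindep : iIndepFun X P)
    (hident : ∀ i, IdentDistrib (X i) (X 0) P P) (hν : CenteredLaw (P.map (X 0))) {R : ℤ}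
    (hR : R ≠ 0) (x : ℤ) : probHitBefore X P x {R} {0} = hitFirst (P.map (X 0)) R x := by
  have : IsProbabilityMeasure (P.map (X 0)) := Measure.isProbabilityMeasure_map (hmeas 0).aemeasurable
  obtain ⟨C, hC⟩ := abs_hitFirst_le hν hR
  refine payoff_unique hν (A := {R}) (B := {0}) ⟨R, by simp⟩
    (h := fun y => probHitBefore X P y {R} {0}) (C := 1) (C' := C) (fun y => ?_) hC
    (fun y => probHitBefore_eq_avg hmeas hindep hident _ _ y) (fun y => hitFirst_eq_avg hν hR y) x
  rw [abs_of_nonneg (probHitBefore_nonneg _ _ _)]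
  exact probHitBefore_le_one _ _ _

end

lemma UniformEquiv.congr {D : ℕ → Set ℤ} {p q p' q' : ℕ → ℤ → ℝ} (h : UniformEquiv D p q)
    (hp : ∀ R : ℕ, 0 < R → ∀ x, p R x = p' R x) (hq : ∀ R : ℕ, 0 < R → ∀ x, q R x = q' R x) :
    UniformEquiv D p' q' := by
  intro ε hε
  filter_upwards [h ε hε, eventually_gt_atTop 0] with R hR hR0 x hx
  rw [← hp R hR0, ← hq R hR0]
  exact hR x hx

/-! ### Truncated moments of a measure and bounds for its symbol -/

/-- `∫_0^s (y - v)⁺ dv` for `y, s ≥ 0`. -/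
def quadCap (y s : ℝ) : ℝ := if y ≤ s then y ^ 2 / 2 else y * s - s ^ 2 / 2

/-- `∫_0^s v (y - v)⁺ dv` for `y, s ≥ 0`. -/
def cubeCap (y s : ℝ) : ℝ := if y ≤ s then y ^ 3 / 6 else y * s ^ 2 / 2 - s ^ 3 / 3

lemma integral_posPart {y s : ℝ} (hy : 0 ≤ y) (hs : 0 ≤ s) :
    ∫ v in (0 : ℝ)..s, max (y - v) 0 = quadCap y s := by
  have key : ∀ r : ℝ, 0 ≤ r → r ≤ y → ∫ v in (0 : ℝ)..r, max (y - v) 0 = y * r - r ^ 2 / 2 := by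
    intro r h0 hr
    rw [intervalIntegral.integral_congr (g := fun v => y - v) fun v hv => by
      rw [Set.uIcc_of_le h0] at hv
      exact max_eq_left (by linarith [hv.2])]
    rw [intervalIntegral.integral_sub (by simp) (by simp)]
    simp; ring
  have hc : Continuous fun v : ℝ => max (y - v) 0 := by fun_prop
  rw [quadCap]
  split_ifs with h
  · rw [← intervalIntegral.integral_add_adjacent_intervals (hc.intervalIntegrable 0 y)
      (hc.intervalIntegrable y s), key y hy le_rfl,
      intervalIntegral.integral_congr (a := y) (g := fun v => 0) fun v hv => by
      rw [Set.uIcc_of_le h] at hv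
      exact max_eq_right (by linarith [hv.1])]
    simp; ring
  · exact key s hs (not_le.1 h).le

lemma integral_mul_posPart {y s : ℝ} (hy : 0 ≤ y) (hs : 0 ≤ s) :
    ∫ v in (0 : ℝ)..s, v * max (y - v) 0 = cubeCap y s := by
  have key : ∀ r : ℝ, 0 ≤ r → r ≤ y →
      ∫ v in (0 : ℝ)..r, v * max (y - v) 0 = y * r ^ 2 / 2 - r ^ 3 / 3 := by
    intro r h0 hr
    rw [intervalIntegral.integral_congr (g := fun v => y * v - v ^ 2) fun v hv => by
      rw [Set.uIcc_of_le h0] at hv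
      simp only [max_eq_left (show 0 ≤ y - v by linarith [hv.2])]; ring]
    rw [intervalIntegral.integral_sub (f := fun v => y * v) (g := fun v => v ^ 2)
      (Continuous.intervalIntegrable (by fun_prop) _ _)
      (Continuous.intervalIntegrable (by fun_prop) _ _), intervalIntegral.integral_const_mul]
    simp; ring
  have hc : Continuous fun v : ℝ => v * max (y - v) 0 := by fun_prop
  rw [cubeCap]
  split_ifs with h
  · rw [← intervalIntegral.integral_add_adjacent_intervals (hc.intervalIntegrable 0 y)
      (hc.intervalIntegrable y s), key y hy le_rfl,
      intervalIntegral.integral_congr (a := y) (g := fun v => 0) fun v hv => by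
      rw [Set.uIcc_of_le h] at hv
      simp only [max_eq_right (show y - v ≤ 0 by linarith [hv.1]), mul_zero]]
    simp; ring
  · exact key s hs (not_le.1 h).le

/-- This scaling reduces the estimates at frequency t to elementary inequalities at truncation level
1. -/
lemma sq_mul_quadCap {t : ℝ} (ht : 0 < t) (y : ℝ) : t ^ 2 * quadCap y t⁻¹ = quadCap (t * y) 1 := by
  have h : y ≤ t⁻¹ ↔ t * y ≤ 1 := by rw [← mul_le_mul_iff_right₀ ht, mul_inv_cancel₀ ht.ne']
  simp only [quadCap, h]
  split_ifs <;> field_simp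

lemma cube_mul_cubeCap {t : ℝ} (ht : 0 < t) (y : ℝ) :
    t ^ 3 * cubeCap y t⁻¹ = cubeCap (t * y) 1 := by
  have h : y ≤ t⁻¹ ↔ t * y ≤ 1 := by rw [← mul_le_mul_iff_right₀ ht, mul_inv_cancel₀ ht.ne']
  simp only [cubeCap, h]
  split_ifs <;> field_simp

lemma quadCap_nonneg {y s : ℝ} (hs : 0 ≤ s) : 0 ≤ quadCap y s := by
  rw [quadCap]; split_ifs with h
  · positivity
  · nlinarith [not_le.1 h]

lemma quadCap_le_mul {y s : ℝ} (hy : 0 ≤ y) (hs : 0 ≤ s) : quadCap y s ≤ y * s := by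
  rw [quadCap]; split_ifs with h <;> nlinarith

lemma quadCap_le_sq {y s : ℝ} : quadCap y s ≤ y ^ 2 / 2 := by
  rw [quadCap]; split_ifs with h <;> nlinarith [sq_nonneg (y - s)]

/-- `quadCap y` is concave in its second argument and zero at 0, so its quotient by s decreases. -/
lemma mul_quadCap_le {y s r : ℝ} (hy : 0 ≤ y) (hs : 0 < s) (hsr : s ≤ r) :
    s * quadCap y r ≤ r * quadCap y s := by
  simp only [quadCap]
  split_ifs with h1 h2 h2
  · have := mul_le_mul_of_nonneg_right hsr (show 0 ≤ y ^ 2 / 2 by positivity)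
    exact this
  · have h3 : y ^ 2 ≤ r * (2 * y - s) := by nlinarith [not_le.1 h2]
    have := mul_le_mul_of_nonneg_left h3 hs.le
    nlinarith
  · exact absurd (h2.trans hsr) h1
  · have : 0 ≤ r * s * (r - s) := by
      have := hs.trans_le hsr
      have := sub_nonneg.2 hsr
      positivity
    nlinarith

lemma mul_min_le_quadCap {y s : ℝ} (hs : 0 ≤ s) : y * min y s ≤ 2 * quadCap y s := by
  rw [quadCap]; split_ifs with h
  · rw [min_eq_left h]; nlinarith
  · have := not_le.1 h
    rw [min_eq_right this.le]; nlinarith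

/-- For u ≥ 0 the bracket is min(u, 1)²/2. Subtracting the positive part is what later gives `mom -
s * eta` instead of `mom` for real parts. -/
lemma one_sub_cos_le_quadCap {u : ℝ} :
    1 - Real.cos u ≤ 4 * (quadCap u 1 - max (u - 1) 0) := by
  rw [quadCap]; split_ifs with h
  · rw [max_eq_right (by linarith)]
    nlinarith [one_sub_cos_le u, sq_nonneg u]
  · have := not_le.1 h
    rw [max_eq_left (by linarith)]
    linarith [Real.neg_one_le_cos u]

lemma sub_sin_le_cubeCap {u : ℝ} (hu : 0 ≤ u) : u - Real.sin u ≤ 12 * cubeCap u 1 := by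
  rcases hu.eq_or_lt with rfl | hu
  · simp [cubeCap]
  rw [cubeCap]; split_ifs with h
  · have := Real.sin_gt_sub_cube hu
    have : 0 < u ^ 3 := by positivity
    linarith
  · have := not_le.1 h
    linarith [Real.neg_one_le_sin u]

lemma sub_sin_le_quadCap {u : ℝ} (hu : 0 ≤ u) : u - Real.sin u ≤ 4 * quadCap u 1 := by
  rcases hu.eq_or_lt with rfl | hu
  · simp [quadCap]
  rw [quadCap]; split_ifs with h
  · have := Real.sin_gt_sub_cube hu
    have : u ^ 3 ≤ u ^ 2 := pow_le_pow_of_le_one hu.le h (by norm_num)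
    nlinarith
  · have := not_le.1 h
    linarith [Real.neg_one_le_sin u]

lemma norm_one_sub_cis_le (u : ℝ) : ‖1 - cis u‖ ≤ |u| := by
  rw [norm_sub_rev, cis, mul_comm]
  exact Real.norm_exp_I_mul_ofReal_sub_one_le

lemma norm_one_sub_cis_le_two (u : ℝ) : ‖1 - cis u‖ ≤ 2 := by
  refine (norm_sub_le _ _).trans ?_
  rw [norm_cis, norm_one]; norm_num

lemma abs_mul_norm_one_sub_cis_le (u : ℝ) : |u| * ‖1 - cis u‖ ≤ 4 * quadCap |u| 1 := by
  have h1 := norm_one_sub_cis_le u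
  have h2 := norm_one_sub_cis_le_two u
  rw [quadCap]; split_ifs with h
  · nlinarith [abs_nonneg u]
  · have := not_le.1 h
    nlinarith

/-- For u ≥ 0 the two summands on the right are nonnegative; the first handles u ≤ 2 and the second
larger u. -/
lemma quadCap_le_one_sub_cos {u : ℝ} (hu : 0 ≤ u) :
    quadCap u 1 / 10 ≤ (1 - Real.cos u) + (u - Real.sin u) := by
  have hs := Real.sin_le hu
  have hc := Real.cos_le_one u
  have hcos : u ≤ Real.pi → u ^ 2 / 5 ≤ 1 - Real.cos u := fun h => by
    have h1 := Real.cos_le_one_sub_mul_cos_sq (x := u) (by rwa [abs_of_nonneg hu])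
    have h2 : (1 : ℝ) / 5 ≤ 2 / Real.pi ^ 2 := by
      rw [div_le_div_iff₀ (by norm_num) (by positivity)]
      nlinarith [Real.pi_lt_d2, Real.pi_pos]
    nlinarith [sq_nonneg u]
  rw [quadCap]; split_ifs with h
  · have := hcos (h.trans (by linarith [Real.pi_gt_three]))
    nlinarith [sq_nonneg u]
  · have h' := not_le.1 h
    rcases le_total u 2 with h2 | h2
    · have := hcos (h2.trans (by linarith [Real.pi_gt_three]))
      nlinarith
    · linarith [Real.sin_le_one u]

/-- The integrated tail `∫ (|k| - s)⁺ dκ`. -/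
def eta (κ : Measure ℤ) (s : ℝ) : ℝ := ∫ k : ℤ, max (|(k : ℝ)| - s) 0 ∂κ

/-- The integral of `eta`. -/
def mom (κ : Measure ℤ) (s : ℝ) : ℝ := ∫ v in (0 : ℝ)..s, eta κ v

/-- The integral of `v ↦ v * eta κ v`. -/
def cub (κ : Measure ℤ) (s : ℝ) : ℝ := ∫ v in (0 : ℝ)..s, v * eta κ v

/-- `∫ (1 + itk - exp (itk)) dκ`. -/
def symb (κ : Measure ℤ) (t : ℝ) : ℂ := ∫ k : ℤ, (1 + t * k * Complex.I - cis (t * k)) ∂κ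

/-- The derivative of `symb`. -/
def symbDeriv (κ : Measure ℤ) (t : ℝ) : ℂ := ∫ k : ℤ, (k * Complex.I * (1 - cis (t * k))) ∂κ

section
variable {κ : Measure ℤ} [IsFiniteMeasure κ]

lemma abs_posPart_le (y v : ℝ) : |max (|y| - v) 0| ≤ |y| + |v| := by
  have := abs_nonneg y
  have := neg_abs_le v
  rw [abs_of_nonneg (le_max_right _ _)]
  refine max_le (by linarith) (by positivity)

lemma integrable_posPart (hκ : Integrable (fun k : ℤ => (k : ℝ)) κ) (s : ℝ) :
    Integrable (fun k : ℤ => max (|(k : ℝ)| - s) 0) κ :=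
  (hκ.abs.add (integrable_const |s|)).mono' (measurable_of_countable _).aestronglyMeasurable
    (ae_of_all _ fun k => abs_posPart_le (k : ℝ) s)

lemma eta_nonneg (s : ℝ) : 0 ≤ eta κ s := integral_nonneg fun _ => le_max_right _ _

lemma continuous_eta (hκ : Integrable (fun k : ℤ => (k : ℝ)) κ) : Continuous (eta κ) := by
  refine LipschitzWith.continuous (K := Real.toNNReal (κ.real Set.univ))
    (LipschitzWith.of_dist_le_mul fun s r => ?_)
  rw [Real.dist_eq, Real.dist_eq, eta, eta,
    ← integral_sub (integrable_posPart hκ s) (integrable_posPart hκ r),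
    Real.coe_toNNReal _ measureReal_nonneg]
  have h : ∀ k : ℤ, |max (|(k : ℝ)| - s) 0 - max (|(k : ℝ)| - r) 0| ≤ |s - r| := fun k => by
    refine (abs_max_sub_max_le_abs _ _ _).trans ?_
    rw [show |(k : ℝ)| - s - (|(k : ℝ)| - r) = -(s - r) by ring, abs_neg]
  refine (abs_integral_le_integral_abs).trans ?_
  refine (integral_mono (((integrable_posPart hκ s).sub (integrable_posPart hκ r)).abs)
    (integrable_const |s - r|) h).trans ?_
  simp

lemma integrable_quadCap (hκ : Integrable (fun k : ℤ => (k : ℝ)) κ) {s : ℝ} (hs : 0 ≤ s) :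
    Integrable (fun k : ℤ => quadCap |(k : ℝ)| s) κ := by
  refine (hκ.abs.mul_const s).mono' (measurable_of_countable _).aestronglyMeasurable
    (ae_of_all _ fun k => ?_)
  rw [Real.norm_eq_abs, abs_of_nonneg (quadCap_nonneg hs)]
  exact quadCap_le_mul (abs_nonneg _) hs

lemma mom_eq (hκ : Integrable (fun k : ℤ => (k : ℝ)) κ) {s : ℝ} (hs : 0 ≤ s) :
    mom κ s = ∫ k : ℤ, quadCap |(k : ℝ)| s ∂κ := by
  simp only [mom, eta]
  rw [intervalIntegral_integral_swap]
  · exact integral_congr_ae (ae_of_all _ fun k => integral_posPart (abs_nonneg _) hs)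
  · refine Integrable.mono' (g := fun p : ℝ × ℤ => |(p.2 : ℝ)| * 1)
      (Integrable.mul_prod (f := fun _ => (1 : ℝ)) (g := fun k : ℤ => |(k : ℝ)|)
        (integrableOn_const (by simp [Set.uIoc])) hκ.abs |>.congr (ae_of_all _ fun p => by simp)) ?_ ?_
    · refine Measurable.aestronglyMeasurable ?_
      refine measurable_from_prod_countable_left fun k => ?_
      exact (by fun_prop : Measurable fun v : ℝ => max (|(k : ℝ)| - v) 0)
    · have : ∀ᵐ v : ℝ ∂(volume.restrict (Set.uIoc 0 s)), 0 ≤ v := by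
        refine (ae_restrict_mem measurableSet_uIoc).mono fun v hv => ?_
        rw [Set.uIoc_of_le hs] at hv; exact hv.1.le
      have := (Measure.quasiMeasurePreserving_fst (μ := volume.restrict (Set.uIoc 0 s))
        (ν := κ)).ae this
      filter_upwards [this] with p hp
      have := abs_nonneg (p.2 : ℝ)
      simp only [Function.uncurry, Real.norm_eq_abs, mul_one]
      rw [abs_of_nonneg (le_max_right _ _)]
      exact max_le (by linarith) this

lemma cub_eq (hκ : Integrable (fun k : ℤ => (k : ℝ)) κ) {s : ℝ} (hs : 0 ≤ s) :
    cub κ s = ∫ k : ℤ, cubeCap |(k : ℝ)| s ∂κ := by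
  simp only [cub, eta, ← integral_const_mul]
  rw [intervalIntegral_integral_swap]
  · exact integral_congr_ae (ae_of_all _ fun k => integral_mul_posPart (abs_nonneg _) hs)
  · refine Integrable.mono' (g := fun p : ℝ × ℤ => s * |(p.2 : ℝ)|)
      (Integrable.mul_prod (f := fun _ => s) (g := fun k : ℤ => |(k : ℝ)|)
        (integrableOn_const (by simp [Set.uIoc])) hκ.abs) ?_ ?_
    · refine Measurable.aestronglyMeasurable ?_
      refine measurable_from_prod_countable_left fun k => ?_
      exact (by fun_prop : Measurable fun v : ℝ => v * max (|(k : ℝ)| - v) 0)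
    · have : ∀ᵐ v : ℝ ∂(volume.restrict (Set.uIoc 0 s)), 0 ≤ v ∧ v ≤ s := by
        refine (ae_restrict_mem measurableSet_uIoc).mono fun v hv => ?_
        rw [Set.uIoc_of_le hs] at hv; exact ⟨hv.1.le, hv.2⟩
      have := (Measure.quasiMeasurePreserving_fst (μ := volume.restrict (Set.uIoc 0 s))
        (ν := κ)).ae this
      filter_upwards [this] with p hp
      have := abs_nonneg (p.2 : ℝ)
      simp only [Function.uncurry, Real.norm_eq_abs]
      rw [abs_of_nonneg (mul_nonneg hp.1 (le_max_right _ _))]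
      exact mul_le_mul hp.2 (max_le (by linarith [hp.1]) this) (le_max_right _ _) hs

lemma integrable_cubeCap (hκ : Integrable (fun k : ℤ => (k : ℝ)) κ) {s : ℝ} (hs : 0 ≤ s) :
    Integrable (fun k : ℤ => cubeCap |(k : ℝ)| s) κ := by
  refine (hκ.abs.mul_const (s ^ 2)).mono' (measurable_of_countable _).aestronglyMeasurable
    (ae_of_all _ fun k => ?_)
  have hk := abs_nonneg (k : ℝ)
  have h2 : 0 ≤ s ^ 3 := by positivity
  rw [Real.norm_eq_abs, cubeCap]; split_ifs with h
  · have h1 : |(k : ℝ)| ^ 2 ≤ s ^ 2 := pow_le_pow_left₀ hk h 2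
    rw [abs_of_nonneg (by positivity)]
    nlinarith [mul_le_mul_of_nonneg_left h1 hk, mul_nonneg hk (sq_nonneg s)]
  · have h1 : s * s ^ 2 ≤ |(k : ℝ)| * s ^ 2 :=
      mul_le_mul_of_nonneg_right (not_le.1 h).le (sq_nonneg s)
    rw [abs_le]; constructor <;> nlinarith

lemma hasDerivAt_mom (hκ : Integrable (fun k : ℤ => (k : ℝ)) κ) (s : ℝ) :
    HasDerivAt (mom κ) (eta κ s) s :=
  (continuous_eta hκ).integral_hasStrictDerivAt 0 s |>.hasDerivAt

lemma hasDerivAt_cub (hκ : Integrable (fun k : ℤ => (k : ℝ)) κ) (s : ℝ) :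
    HasDerivAt (cub κ) (s * eta κ s) s :=
  (continuous_id.mul (continuous_eta hκ)).integral_hasStrictDerivAt 0 s |>.hasDerivAt

lemma mom_nonneg {s : ℝ} (hs : 0 ≤ s) : 0 ≤ mom κ s :=
  intervalIntegral.integral_nonneg hs fun _ _ => eta_nonneg _

lemma cub_nonneg {s : ℝ} (hs : 0 ≤ s) : 0 ≤ cub κ s :=
  intervalIntegral.integral_nonneg hs fun _ hv => mul_nonneg hv.1 (eta_nonneg _)

lemma mom_mono (hκ : Integrable (fun k : ℤ => (k : ℝ)) κ) : Monotone (mom κ) :=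
  monotone_of_hasDerivAt_nonneg (hasDerivAt_mom hκ) fun s => eta_nonneg s

lemma mul_eta_le_mom (hκ : Integrable (fun k : ℤ => (k : ℝ)) κ) {s : ℝ} (hs : 0 ≤ s) :
    s * eta κ s ≤ mom κ s := by
  have : ∫ v in (0 : ℝ)..s, eta κ s = s * eta κ s := by simp
  rw [← this]
  refine intervalIntegral.integral_mono_on hs (by simp)
    ((continuous_eta hκ).intervalIntegrable _ _) fun v hv => ?_
  refine integral_mono (integrable_posPart hκ s) (integrable_posPart hκ v) fun k => ?_
  exact max_le_max (by linarith [hv.2]) le_rfl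

lemma cub_le_mul_mom (hκ : Integrable (fun k : ℤ => (k : ℝ)) κ) {s : ℝ} (hs : 0 ≤ s) :
    cub κ s ≤ s * mom κ s := by
  rw [cub, mom, ← intervalIntegral.integral_const_mul]
  refine intervalIntegral.integral_mono_on hs
    ((continuous_id.mul (continuous_eta hκ)).intervalIntegrable _ _)
    ((continuous_const.mul (continuous_eta hκ)).intervalIntegrable _ _) fun v hv => ?_
  exact mul_le_mul_of_nonneg_right hv.2 (eta_nonneg v)

/-- Equivalently s/mom(s) is nondecreasing, which is how it enters the frequency integrals. -/
lemma mul_mom_le (hκ : Integrable (fun k : ℤ => (k : ℝ)) κ) {s r : ℝ} (hs : 0 < s) (hsr : s ≤ r) :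
    s * mom κ r ≤ r * mom κ s := by
  rw [mom_eq hκ hs.le, mom_eq hκ (hs.le.trans hsr), ← integral_const_mul, ← integral_const_mul]
  exact integral_mono ((integrable_quadCap hκ (hs.le.trans hsr)).const_mul _)
    ((integrable_quadCap hκ hs.le).const_mul _) fun k => mul_quadCap_le (abs_nonneg _) hs hsr

lemma tendsto_mom_div (hκ : Integrable (fun k : ℤ => (k : ℝ)) κ) :
    Tendsto (fun s => mom κ s / s) atTop (𝓝 0) := by
  have h : Tendsto (fun s => ∫ k : ℤ, quadCap |(k : ℝ)| s / s ∂κ) atTop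
      (𝓝 (∫ k : ℤ, (0 : ℝ) ∂κ)) := by
    refine tendsto_integral_filter_of_dominated_convergence (fun k : ℤ => |(k : ℝ)|)
      (Eventually.of_forall fun s => (measurable_of_countable _).aestronglyMeasurable) ?_ hκ.abs
      (ae_of_all _ fun k => ?_)
    · filter_upwards [eventually_gt_atTop 0] with s hs
      refine ae_of_all _ fun k => ?_
      rw [Real.norm_eq_abs, abs_of_nonneg (div_nonneg (quadCap_nonneg hs.le) hs.le),
        div_le_iff₀ hs]
      exact quadCap_le_mul (abs_nonneg _) hs.le
    · refine squeeze_zero' (g := fun s => (|(k : ℝ)| ^ 2 / 2) / s) ?_ ?_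
        (tendsto_const_nhds.div_atTop tendsto_id)
      · filter_upwards [eventually_gt_atTop 0] with s hs
        exact div_nonneg (quadCap_nonneg hs.le) hs.le
      · filter_upwards [eventually_gt_atTop 0] with s hs
        gcongr; exact quadCap_le_sq
  rw [integral_zero] at h
  refine h.congr' ?_
  filter_upwards [eventually_gt_atTop 0] with s hs
  rw [integral_div, mom_eq hκ hs.le]

lemma integrable_symb (hκ : Integrable (fun k : ℤ => (k : ℝ)) κ) (t : ℝ) :
    Integrable (fun k : ℤ => (1 + t * k * Complex.I - cis (t * k) : ℂ)) κ := by
  refine ((integrable_const (2 : ℝ)).add (hκ.abs.const_mul |t|)).mono'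
    (measurable_of_countable _).aestronglyMeasurable (ae_of_all _ fun k => ?_)
  refine (norm_sub_le _ _).trans ?_
  have := norm_add_le (1 : ℂ) (t * k * Complex.I)
  have h2 : ‖(t * k * Complex.I : ℂ)‖ = |t| * |(k : ℝ)| := by
    rw [norm_mul, Complex.norm_I, mul_one, norm_mul, Complex.norm_real, Complex.norm_intCast,
      Real.norm_eq_abs]
  rw [norm_cis]
  rw [norm_one, h2] at this
  simp only [Pi.add_apply]
  linarith

lemma integrable_symbDeriv (hκ : Integrable (fun k : ℤ => (k : ℝ)) κ) (t : ℝ) :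
    Integrable (fun k : ℤ => (k * Complex.I * (1 - cis (t * k)) : ℂ)) κ := by
  refine (hκ.abs.const_mul 2).mono'
    (measurable_of_countable _).aestronglyMeasurable (ae_of_all _ fun k => ?_)
  rw [norm_mul, norm_mul, Complex.norm_I, mul_one, Complex.norm_intCast, mul_comm]
  exact mul_le_mul_of_nonneg_right (norm_one_sub_cis_le_two _) (abs_nonneg _)

lemma hasDerivAt_cis (k t : ℝ) :
    HasDerivAt (fun t : ℝ => cis (t * k)) (k * Complex.I * cis (t * k)) t := by
  have h1 : HasDerivAt (fun t : ℝ => ((t * k : ℝ) : ℂ) * Complex.I) (k * Complex.I) t := by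
    have := ((hasDerivAt_id t).mul_const k).ofReal_comp.mul_const Complex.I
    simpa using this
  have := h1.cexp
  rw [mul_comm] at this
  exact this

lemma hasDerivAt_symb (hκ : Integrable (fun k : ℤ => (k : ℝ)) κ) (t : ℝ) :
    HasDerivAt (symb κ) (symbDeriv κ t) t := by
  refine (hasDerivAt_integral_of_dominated_loc_of_deriv_le (s := Set.univ) univ_mem
    (F := fun t (k : ℤ) => (1 + t * k * Complex.I - cis (t * k) : ℂ))
    (F' := fun t (k : ℤ) => (k * Complex.I * (1 - cis (t * k)) : ℂ))
    (bound := fun k : ℤ => 2 * |(k : ℝ)|)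
    (Eventually.of_forall fun x => (measurable_of_countable _).aestronglyMeasurable)
    (integrable_symb hκ t) (measurable_of_countable _).aestronglyMeasurable
    (ae_of_all _ fun k x _ => ?_) (hκ.abs.const_mul 2) (ae_of_all _ fun k x _ => ?_)).2
  · rw [norm_mul, norm_mul, Complex.norm_I, mul_one, Complex.norm_intCast, mul_comm]
    exact mul_le_mul_of_nonneg_right (norm_one_sub_cis_le_two _) (abs_nonneg _)
  · have h1 := hasDerivAt_cis k x
    have h2 : HasDerivAt (fun t : ℝ => (1 + t * k * Complex.I : ℂ)) (k * Complex.I) x := by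
      have := (((hasDerivAt_id x).ofReal_comp.mul_const (k : ℂ)).mul_const Complex.I).const_add 1
      simpa using this
    have h3 := h2.sub h1
    rw [mul_sub, mul_one]
    simpa [Pi.sub_def] using h3

lemma continuous_symbDeriv (hκ : Integrable (fun k : ℤ => (k : ℝ)) κ) :
    Continuous (symbDeriv κ) := by
  refine continuous_of_dominated (bound := fun k : ℤ => 2 * |(k : ℝ)|)
    (fun x => (measurable_of_countable _).aestronglyMeasurable)
    (fun x => ae_of_all _ fun k => ?_) (hκ.abs.const_mul 2) (ae_of_all _ fun k => ?_)
  · rw [norm_mul, norm_mul, Complex.norm_I, mul_one, Complex.norm_intCast, mul_comm]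
    exact mul_le_mul_of_nonneg_right (norm_one_sub_cis_le_two _) (abs_nonneg _)
  · exact continuous_const.mul (continuous_const.sub
      (continuous_cis.comp (continuous_id.mul continuous_const)))

lemma symb_re (hκ : Integrable (fun k : ℤ => (k : ℝ)) κ) (t : ℝ) :
    (symb κ t).re = ∫ k : ℤ, (1 - Real.cos (t * k)) ∂κ := by
  have := integral_re (integrable_symb hκ t)
  simp only [RCLike.re_eq_complex_re] at this
  rw [symb, ← this]
  refine integral_congr_ae (ae_of_all _ fun k => ?_)
  simp [cis_re]

lemma symb_im (hκ : Integrable (fun k : ℤ => (k : ℝ)) κ) (t : ℝ) :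
    (symb κ t).im = ∫ k : ℤ, (t * k - Real.sin (t * k)) ∂κ := by
  have := integral_im (integrable_symb hκ t)
  simp only [RCLike.im_eq_complex_im] at this
  rw [symb, ← this]
  refine integral_congr_ae (ae_of_all _ fun k => ?_)
  simp [cis_im]

lemma integrable_one_sub_cos (t : ℝ) : Integrable (fun k : ℤ => 1 - Real.cos (t * k)) κ :=
  integrable_of_abs_le (C := 2) fun j => by
    have := Real.cos_le_one (t * j); have := Real.neg_one_le_cos (t * j)
    rw [abs_le]; constructor <;> linarith

lemma integrable_sub_sin (hκ : Integrable (fun k : ℤ => (k : ℝ)) κ) (t : ℝ) :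
    Integrable (fun k : ℤ => t * k - Real.sin (t * k)) κ :=
  (hκ.const_mul t).sub (integrable_of_abs_le fun _ => Real.abs_sin_le_one _)

lemma symb_re_nonneg (hκ : Integrable (fun k : ℤ => (k : ℝ)) κ) (t : ℝ) : 0 ≤ (symb κ t).re := by
  rw [symb_re hκ]; exact integral_nonneg fun k => sub_nonneg.2 (Real.cos_le_one _)

lemma symb_re_le (hκ : Integrable (fun k : ℤ => (k : ℝ)) κ) {t : ℝ} (ht : 0 < t) :
    (symb κ t).re ≤ 4 * t ^ 2 * (mom κ t⁻¹ - t⁻¹ * eta κ t⁻¹) := by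
  have ht' : 0 ≤ t⁻¹ := inv_nonneg.2 ht.le
  rw [symb_re hκ, mom_eq hκ ht', eta, ← integral_const_mul, ← integral_sub
    (integrable_quadCap hκ ht') ((integrable_posPart hκ _).const_mul _), ← integral_const_mul]
  refine integral_mono (integrable_one_sub_cos t) (((integrable_quadCap hκ ht').sub
    ((integrable_posPart hκ _).const_mul _)).const_mul _) fun k => ?_
  have h := one_sub_cos_le_quadCap (u := t * |(k : ℝ)|)
  rw [← sq_mul_quadCap ht, show t * |(k : ℝ)| = |t * k| by rw [abs_mul, abs_of_pos ht],
    Real.cos_abs] at h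
  have h2 : max (|t * (k : ℝ)| - 1) 0 = t ^ 2 * (t⁻¹ * max (|(k : ℝ)| - t⁻¹) 0) := by
    rw [abs_mul, abs_of_pos ht, ← mul_assoc, show t ^ 2 * t⁻¹ = t by field_simp,
      mul_max_of_nonneg _ _ ht.le, mul_sub, mul_inv_cancel₀ ht.ne', mul_zero]
  rw [h2] at h
  simp only
  linarith

lemma abs_sub_sin (u : ℝ) : |u - Real.sin u| = |u| - Real.sin |u| := by
  rcases le_total 0 u with h | h
  · rw [abs_of_nonneg h, abs_of_nonneg (sub_nonneg.2 (Real.sin_le h))]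
  · have := Real.sin_le (neg_nonneg.2 h)
    rw [Real.sin_neg] at this
    rw [abs_of_nonpos h, Real.sin_neg, abs_of_nonpos (by linarith)]; ring

lemma abs_symb_im_le (hκ : Integrable (fun k : ℤ => (k : ℝ)) κ) {t : ℝ} (ht : 0 < t) :
    |(symb κ t).im| ≤ 12 * t ^ 3 * cub κ t⁻¹ := by
  have ht' : 0 ≤ t⁻¹ := inv_nonneg.2 ht.le
  rw [symb_im hκ, cub_eq hκ ht', ← integral_const_mul]
  refine abs_integral_le_integral_abs.trans (integral_mono (integrable_sub_sin hκ t).abs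
    ((integrable_cubeCap hκ ht').const_mul _) fun k => ?_)
  simp only
  rw [abs_sub_sin, mul_assoc, cube_mul_cubeCap ht, abs_mul, abs_of_pos ht]
  exact sub_sin_le_cubeCap (by positivity)

lemma abs_symb_im_le_mom (hκ : Integrable (fun k : ℤ => (k : ℝ)) κ) {t : ℝ} (ht : 0 < t) :
    |(symb κ t).im| ≤ 4 * t ^ 2 * mom κ t⁻¹ := by
  have ht' : 0 ≤ t⁻¹ := inv_nonneg.2 ht.le
  rw [symb_im hκ, mom_eq hκ ht', ← integral_const_mul]
  refine abs_integral_le_integral_abs.trans (integral_mono (integrable_sub_sin hκ t).abs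
    ((integrable_quadCap hκ ht').const_mul _) fun k => ?_)
  simp only
  rw [abs_sub_sin, mul_assoc, sq_mul_quadCap ht, abs_mul, abs_of_pos ht]
  exact sub_sin_le_quadCap (by positivity)

lemma norm_symb_le (hκ : Integrable (fun k : ℤ => (k : ℝ)) κ) {t : ℝ} (ht : 0 < t) :
    ‖symb κ t‖ ≤ 8 * t ^ 2 * mom κ t⁻¹ := by
  have h1 := symb_re_le hκ ht
  have h2 := abs_symb_im_le_mom hκ ht
  have h3 : 0 ≤ t ^ 2 * (t⁻¹ * eta κ t⁻¹) := by have := eta_nonneg (κ := κ) t⁻¹; positivity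
  have h4 := Complex.norm_le_abs_re_add_abs_im (symb κ t)
  rw [abs_of_nonneg (symb_re_nonneg hκ t)] at h4
  linarith

lemma norm_symbDeriv_le (hκ : Integrable (fun k : ℤ => (k : ℝ)) κ) {t : ℝ} (ht : 0 < t) :
    ‖symbDeriv κ t‖ ≤ 4 * t * mom κ t⁻¹ := by
  have ht' : 0 ≤ t⁻¹ := inv_nonneg.2 ht.le
  rw [symbDeriv, mom_eq hκ ht', ← integral_const_mul]
  refine (norm_integral_le_integral_norm _).trans (integral_mono (integrable_symbDeriv hκ t).norm
    ((integrable_quadCap hκ ht').const_mul _) fun k => ?_)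
  simp only
  rw [norm_mul, norm_mul, Complex.norm_I, mul_one, Complex.norm_intCast]
  have h := abs_mul_norm_one_sub_cis_le (t * k)
  rw [abs_mul, abs_of_pos ht, ← sq_mul_quadCap ht] at h
  refine le_of_mul_le_mul_left ?_ ht
  calc t * (|(k : ℝ)| * ‖1 - cis (t * k)‖) = t * |(k : ℝ)| * ‖1 - cis (t * k)‖ := by ring
    _ ≤ _ := h
    _ = _ := by ring

/-- For a measure carried by the negative integers no cancellation occurs in the symbol. -/
lemma le_norm_symb (hκ : Integrable (fun k : ℤ => (k : ℝ)) κ) (hneg : ∀ᵐ k : ℤ ∂κ, k < 0) {t : ℝ}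
    (ht : 0 < t) : t ^ 2 * mom κ t⁻¹ / 20 ≤ ‖symb κ t‖ := by
  have ht' : 0 ≤ t⁻¹ := inv_nonneg.2 ht.le
  -- For k < 0 the quantity u - sin u at u = t|k| enters the imaginary part with a minus sign, so Re
  -- - Im is a sum of nonnegative terms; it is at most twice the modulus.
  have h1 : t ^ 2 * mom κ t⁻¹ / 10 ≤ (symb κ t).re - (symb κ t).im := by
    rw [symb_re hκ, symb_im hκ, mom_eq hκ ht', ← integral_const_mul, ← integral_div,
      ← integral_sub (integrable_one_sub_cos t) (integrable_sub_sin hκ t)]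
    refine integral_mono_ae (((integrable_quadCap hκ ht').const_mul _).div_const _)
      ((integrable_one_sub_cos t).sub (integrable_sub_sin hκ t)) ?_
    filter_upwards [hneg] with k hk
    have hk' : (k : ℝ) < 0 := by exact_mod_cast hk
    have h := quadCap_le_one_sub_cos (u := t * |(k : ℝ)|) (by positivity)
    rw [← sq_mul_quadCap ht, abs_of_neg hk', mul_neg, Real.cos_neg, Real.sin_neg] at h
    rw [abs_of_neg hk']
    linarith
  have h2 := Complex.re_le_norm (symb κ t)
  have h3 := Complex.abs_im_le_norm (symb κ t)
  have h4 := neg_abs_le (symb κ t).im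
  linarith

end

section
variable {κ κ' : Measure ℤ} [IsFiniteMeasure κ] [IsFiniteMeasure κ']

lemma eta_add (hκ : Integrable (fun k : ℤ => (k : ℝ)) κ)
    (hκ' : Integrable (fun k : ℤ => (k : ℝ)) κ') (s : ℝ) :
    eta (κ + κ') s = eta κ s + eta κ' s :=
  integral_add_measure (integrable_posPart hκ s) (integrable_posPart hκ' s)

lemma mom_add (hκ : Integrable (fun k : ℤ => (k : ℝ)) κ)
    (hκ' : Integrable (fun k : ℤ => (k : ℝ)) κ') (s : ℝ) :
    mom (κ + κ') s = mom κ s + mom κ' s := by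
  simp only [mom, eta_add hκ hκ']
  exact intervalIntegral.integral_add ((continuous_eta hκ).intervalIntegrable _ _)
    ((continuous_eta hκ').intervalIntegrable _ _)

lemma cub_add (hκ : Integrable (fun k : ℤ => (k : ℝ)) κ)
    (hκ' : Integrable (fun k : ℤ => (k : ℝ)) κ') (s : ℝ) :
    cub (κ + κ') s = cub κ s + cub κ' s := by
  simp only [cub, eta_add hκ hκ', mul_add]
  exact intervalIntegral.integral_add
    ((continuous_id.mul (continuous_eta hκ)).intervalIntegrable _ _)
    ((continuous_id.mul (continuous_eta hκ')).intervalIntegrable _ _)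

lemma symb_add (hκ : Integrable (fun k : ℤ => (k : ℝ)) κ)
    (hκ' : Integrable (fun k : ℤ => (k : ℝ)) κ') (t : ℝ) :
    symb (κ + κ') t = symb κ t + symb κ' t :=
  integral_add_measure (integrable_symb hκ t) (integrable_symb hκ' t)

end

/-! ### Abel summation and the Fourier representation of the potential -/

section
variable {ν : Measure ℤ} [IsProbabilityMeasure ν]

lemma one_sub_le_norm_one_sub_mul_chf {r : ℝ} (hr0 : 0 ≤ r) (t : ℝ) :
    1 - r ≤ ‖1 - r * chf ν t‖ := by
  have h1 := norm_sub_norm_le (1 : ℂ) (r * chf ν t)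
  rw [norm_one, norm_mul, Complex.norm_real, Real.norm_eq_abs, abs_of_nonneg hr0] at h1
  have h2 := mul_le_mul_of_nonneg_left (norm_chf_le (ν := ν) t) hr0
  linarith

/-- This makes a majorant for r = 1 serve for all 0 ≤ r ≤ 1, as dominated convergence requires when
r ↑ 1. -/
lemma norm_one_sub_chf_le {r : ℝ} (hr0 : 0 ≤ r) (hr1 : r ≤ 1) (t : ℝ) :
    ‖1 - chf ν t‖ ≤ 2 * ‖1 - r * chf ν t‖ := by
  have h1 := one_sub_le_norm_one_sub_mul_chf (ν := ν) hr0 t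
  have h2 : 1 - chf ν t = (1 - r * chf ν t) - ((1 - r : ℝ) : ℂ) * chf ν t := by push_cast; ring
  rw [h2]
  refine (norm_sub_le _ _).trans ?_
  rw [norm_mul, Complex.norm_real, Real.norm_eq_abs, abs_of_nonneg (by linarith)]
  have h3 := mul_le_mul_of_nonneg_left (norm_chf_le (ν := ν) t) (by linarith : 0 ≤ 1 - r)
  linarith

/-- The sine, only of first order at 0, meets only the imaginary part of z. Hence integrability of
t|Im φ|/|1 - φ|² is enough for the representation of the potential. -/
lemma abs_re_div_le (u : ℝ) (z : ℂ) :
    |((1 - cis u) / z).re| ≤ (1 - Real.cos u) / ‖z‖ + |Real.sin u| * |z.im| / ‖z‖ ^ 2 := by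
  by_cases hz : z = 0
  · simp [hz]
  have hz' : 0 < ‖z‖ := norm_pos_iff.2 hz
  have h0 := sub_nonneg.2 (Real.cos_le_one u)
  rw [Complex.div_re, ← Complex.sq_norm]
  simp only [Complex.sub_re, Complex.one_re, Complex.sub_im, Complex.one_im, cis_re, cis_im,
    zero_sub]
  refine (abs_add_le _ _).trans (add_le_add ?_ (le_of_eq ?_))
  · rw [abs_div, abs_mul, abs_of_nonneg h0, abs_of_nonneg (sq_nonneg ‖z‖),
      div_le_div_iff₀ (by positivity) hz']
    have := mul_le_mul_of_nonneg_left (Complex.abs_re_le_norm z) (mul_nonneg h0 hz'.le)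
    nlinarith
  · rw [abs_div, abs_mul, abs_neg, abs_of_nonneg (sq_nonneg ‖z‖)]

lemma hasSum_abel (x : ℤ) {r : ℝ} (hr0 : 0 ≤ r) (hr1 : r < 1) :
    HasSum (fun n => (ret ν n 0 - ret ν n x) * r ^ n)
      ((1 / Real.pi) * ∫ t in (0 : ℝ)..Real.pi, ((1 - cis (t * x)) / (1 - r * chf ν t)).re) := by
  have hterm : ∀ n, (ret ν n 0 - ret ν n x) * r ^ n = (1 / Real.pi) *
      ∫ t in (0 : ℝ)..Real.pi, ((1 - cis (t * x)) * (r * chf ν t) ^ n).re := by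
    intro n
    have hc : ∀ x : ℤ, Continuous fun t : ℝ => (cis (t * x) * chf ν t ^ n).re := fun x =>
      Complex.continuous_re.comp ((continuous_cis.comp (continuous_id.mul continuous_const)).mul
        (continuous_chf.pow n))
    rw [ret_eq_integral, ret_eq_integral, ← mul_sub, ← intervalIntegral.integral_sub
      ((hc 0).intervalIntegrable _ _) ((hc x).intervalIntegrable _ _), mul_assoc,
      ← intervalIntegral.integral_mul_const]
    congr 1
    refine intervalIntegral.integral_congr fun t _ => ?_
    rw [← Complex.sub_re, ← sub_mul, mul_pow, ← Complex.ofReal_pow, mul_comm _ (r ^ n),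
      ← Complex.re_ofReal_mul]
    congr 1
    simp [cis_zero]; ring
  simp only [hterm]
  refine HasSum.mul_left _ ?_
  refine intervalIntegral.hasSum_integral_of_dominated_convergence (fun n _ => 2 * r ^ n)
    (fun n => ?_) (fun n => ?_) ?_ ?_ ?_
  · refine Continuous.aestronglyMeasurable ?_
    exact Complex.continuous_re.comp ((continuous_const.sub (continuous_cis.comp
      (continuous_id.mul continuous_const))).mul ((continuous_const.mul continuous_chf).pow n))
  · refine ae_of_all _ fun t _ => ?_
    refine (Complex.abs_re_le_norm _).trans ?_
    rw [norm_mul, norm_pow, norm_mul, Complex.norm_real, Real.norm_eq_abs, abs_of_nonneg hr0]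
    gcongr
    · exact norm_one_sub_cis_le_two _
    · exact mul_le_of_le_one_right hr0 (norm_chf_le t)
  · exact ae_of_all _ fun t _ => (summable_geometric_of_lt_one hr0 hr1).mul_left 2
  · simp
  · refine ae_of_all _ fun t _ => ?_
    have hlt : ‖(r * chf ν t : ℂ)‖ < 1 := by
      rw [norm_mul, Complex.norm_real, Real.norm_eq_abs, abs_of_nonneg hr0]
      exact (mul_le_of_le_one_right hr0 (norm_chf_le t)).trans_lt hr1
    rw [div_eq_mul_inv]
    exact Complex.hasSum_re ((hasSum_geometric_of_norm_lt_one hlt).mul_left _)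

/-- The Fourier representation of the potential. -/
theorem pot_eq_integral (hν : CenteredLaw ν)
    (hI : IntegrableOn (fun t : ℝ => t * |(chf ν t).im| / ‖1 - chf ν t‖ ^ 2)
      (Set.Ioc 0 Real.pi)) (x : ℤ) :
    pot ν x = (1 / Real.pi) *
      ∫ t in (0 : ℝ)..Real.pi, ((1 - cis (t * x)) / (1 - chf ν t)).re := by
  have h1 : Tendsto (fun n => ∑ i ∈ Finset.range n, (ret ν i 0 - ret ν i x)) atTop
      (𝓝 (pot ν x)) := by
    refine (tendsto_add_atTop_iff_nat 1).1 ((tendsto_partialPot hν x).congr fun n => ?_)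
    simp only [partialPot, green, Finset.sum_sub_distrib]
  -- Abel's theorem applies because the series is already known to converge; it remains to compute
  -- the limit of the Abel sums.
  have h2 := Real.tendsto_tsum_powerSeries_nhdsWithin_lt h1
  refine tendsto_nhds_unique h2 ?_
  have hev : ∀ᶠ r : ℝ in 𝓝[<] 1, 0 ≤ r ∧ r < 1 := by
    filter_upwards [Ioo_mem_nhdsLT (zero_lt_one' ℝ)] with r hr using ⟨hr.1.le, hr.2⟩
  have h3 : Tendsto (fun r : ℝ => (1 / Real.pi) *
      ∫ t in (0 : ℝ)..Real.pi, ((1 - cis (t * x)) / (1 - r * chf ν t)).re) (𝓝[<] 1)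
      (𝓝 ((1 / Real.pi) *
      ∫ t in (0 : ℝ)..Real.pi, ((1 - cis (t * x)) / (1 - chf ν t)).re)) := by
    refine Tendsto.const_mul _ ?_
    refine intervalIntegral.tendsto_integral_filter_of_dominated_convergence
      (fun t => 2 * ((1 - Real.cos (t * x)) / ‖1 - chf ν t‖)
        + 4 * |(x : ℝ)| * (t * |(chf ν t).im| / ‖1 - chf ν t‖ ^ 2)) ?_ ?_ ?_ ?_
    · refine Eventually.of_forall fun r => Measurable.aestronglyMeasurable ?_
      exact Complex.measurable_re.comp ((continuous_const.sub (continuous_cis.comp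
        (continuous_id.mul continuous_const))).measurable.div
        (continuous_const.sub (continuous_const.mul continuous_chf)).measurable)
    · filter_upwards [hev] with r hr
      refine ae_of_all _ fun t ht => ?_
      rw [Set.uIoc_of_le Real.pi_pos.le] at ht
      have hne : 0 < ‖1 - chf ν t‖ :=
        norm_pos_iff.2 (sub_ne_zero.2 (chf_ne_one hν ht.1 ht.2).symm)
      have hle := norm_one_sub_chf_le (ν := ν) hr.1 hr.2.le t
      have hne' : 0 < ‖1 - r * chf ν t‖ := by linarith
      refine (abs_re_div_le _ _).trans (add_le_add ?_ ?_)
      · have hc := sub_nonneg.2 (Real.cos_le_one (t * x))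
        rw [← mul_div_assoc, div_le_div_iff₀ hne' hne]
        nlinarith
      · have him : |(1 - r * chf ν t).im| ≤ |(chf ν t).im| := by
          rw [Complex.sub_im, Complex.one_im, zero_sub, abs_neg, Complex.im_ofReal_mul, abs_mul, abs_of_nonneg hr.1]
          exact mul_le_of_le_one_left (abs_nonneg _) hr.2.le
        have hsin : |Real.sin (t * x)| ≤ t * |(x : ℝ)| := by
          refine Real.abs_sin_le_abs.trans ?_
          rw [abs_mul, abs_of_pos ht.1]
        have hsq : ‖1 - chf ν t‖ ^ 2 ≤ 4 * ‖1 - r * chf ν t‖ ^ 2 := by nlinarith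
        rw [← mul_div_assoc, div_le_div_iff₀ (by positivity) (by positivity)]
        calc |Real.sin (t * x)| * |(1 - r * chf ν t).im| * ‖1 - chf ν t‖ ^ 2
            ≤ (t * |(x : ℝ)|) * |(chf ν t).im| * (4 * ‖1 - r * chf ν t‖ ^ 2) := by
              have := ht.1; gcongr
          _ = _ := by ring
    · refine ((intervalIntegrable_fourierBound hν x).const_mul 2).add (IntervalIntegrable.const_mul ?_ _)
      rwa [intervalIntegrable_iff_integrableOn_Ioc_of_le Real.pi_pos.le]
    · refine ae_of_all _ fun t ht => ?_
      rw [Set.uIoc_of_le Real.pi_pos.le] at ht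
      have hne : 1 - (1 : ℝ) * chf ν t ≠ 0 := by
        simpa using sub_ne_zero.2 (chf_ne_one hν ht.1 ht.2).symm
      have hcont : ContinuousAt (fun r : ℝ => ((1 - cis (t * x)) / (1 - r * chf ν t)).re) 1 :=
        Complex.continuous_re.continuousAt.comp (continuousAt_const.div
          (by fun_prop) hne)
      simpa using hcont.tendsto.mono_left nhdsWithin_le_nhds
  refine h3.congr' ?_
  filter_upwards [hev] with r hr
  exact (hasSum_abel x hr.1 hr.2).tsum_eq.symm

end

/-! ### The right-continuous comparison law -/

/-- The part of `ν` on the negative integers. -/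
def negPart (ν : Measure ℤ) : Measure ℤ := ν.restrict (Set.Iio 0)

/-- The part of `ν` on the positive integers. -/
def posPart (ν : Measure ℤ) : Measure ℤ := ν.restrict (Set.Ioi 0)

/-- The mean of the negative part. -/
def negMean (ν : Measure ℤ) : ℝ := ∫ k : ℤ, -(k : ℝ) ∂(negPart ν)

/-- The atom at `1` balancing the negative part. -/
def unitAtom (ν : Measure ℤ) : Measure ℤ := ENNReal.ofReal (negMean ν) • Measure.dirac 1

/-- A right-continuous law with the same negative part as `ν`, up to a factor. -/
def rightContLaw (ν : Measure ℤ) : Measure ℤ :=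
  ENNReal.ofReal (1 / (1 + negMean ν)) • (negPart ν + unitAtom ν) +
    ENNReal.ofReal ((1 - ν.real (Set.Iio 0)) / (1 + negMean ν)) • Measure.dirac 0

section
variable {ν : Measure ℤ} [IsProbabilityMeasure ν]

instance : IsFiniteMeasure (negPart ν) := by unfold negPart; infer_instance
instance : IsFiniteMeasure (posPart ν) := by unfold posPart; infer_instance
instance : IsFiniteMeasure (unitAtom ν) := by
  unfold unitAtom; exact Measure.smul_finite _ ENNReal.ofReal_ne_top

lemma ae_negPart : ∀ᵐ k : ℤ ∂(negPart ν), k < 0 := ae_restrict_mem measurableSet_Iio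

lemma negMean_nonneg : 0 ≤ negMean ν :=
  integral_nonneg_of_ae (ae_negPart.mono fun k hk => by
    have : (k : ℝ) < 0 := by exact_mod_cast hk
    simp only [Pi.zero_apply]; linarith)

lemma integrable_negPart (hν : CenteredLaw ν) : Integrable (fun k : ℤ => (k : ℝ)) (negPart ν) :=
  hν.integrable.integrableOn

lemma integrable_posPart_law (hν : CenteredLaw ν) :
    Integrable (fun k : ℤ => (k : ℝ)) (posPart ν) := hν.integrable.integrableOn

lemma integrable_dirac_int (a : ℤ) : Integrable (fun k : ℤ => (k : ℝ)) (Measure.dirac a) :=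
  integrable_dirac (by simp)

lemma integrable_unitAtom : Integrable (fun k : ℤ => (k : ℝ)) (unitAtom ν) :=
  (integrable_dirac_int 1).smul_measure ENNReal.ofReal_ne_top

lemma negMean_pos (hν : CenteredLaw ν) : 0 < negMean ν := by
  obtain ⟨k, hk0, hk⟩ := exists_neg_supp hν
  refine lt_of_le_of_ne negMean_nonneg fun h => ?_
  have h1 := (integral_eq_zero_iff_of_nonneg_ae (ae_negPart.mono fun k hk => by
    have : (k : ℝ) < 0 := by exact_mod_cast hk
    simp only [Pi.zero_apply, Pi.neg_apply]; linarith) (integrable_negPart hν).neg).1 h.symm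
  rw [EventuallyEq, ae_iff_of_countable] at h1
  have h2 := h1 k (by
    rw [negPart, Measure.restrict_apply (measurableSet_singleton k),
      Set.inter_eq_left.2 (by simpa using hk0)]
    exact hk)
  have : (k : ℝ) < 0 := by exact_mod_cast hk0
  simp at h2
  omega

lemma measure_decomp : ν = negPart ν + posPart ν + ν.restrict {0} := by
  rw [negPart, posPart, ← Measure.restrict_union (by
    rw [Set.disjoint_left]; intro k h1 h2; simp only [Set.mem_Iio, Set.mem_Ioi] at h1 h2; omega)
    measurableSet_Ioi, ← Measure.restrict_union (by
    rw [Set.disjoint_left]; rintro k (h1 | h1) h2 <;>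
      simp only [Set.mem_Iio, Set.mem_Ioi, Set.mem_singleton_iff] at h1 h2 <;> omega)
    (measurableSet_singleton 0)]
  have : (Set.Iio (0 : ℤ) ∪ Set.Ioi 0 ∪ {0}) = Set.univ := by
    ext k; simp only [Set.mem_union, Set.mem_Iio, Set.mem_Ioi, Set.mem_singleton_iff, Set.mem_univ,
      iff_true]; omega
  rw [this, Measure.restrict_univ]

lemma integral_restrict_zero {E : Type*} [NormedAddCommGroup E] [NormedSpace ℝ E] {f : ℤ → E}
    (hf : f 0 = 0) : ∫ k, f k ∂(ν.restrict {0}) = 0 := by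
  refine integral_eq_zero_of_ae ((ae_restrict_mem (measurableSet_singleton 0)).mono fun k hk => ?_)
  rw [Set.mem_singleton_iff] at hk
  rw [hk, hf]; rfl

lemma mom_eq_add (hν : CenteredLaw ν) {s : ℝ} (hs : 0 ≤ s) :
    mom ν s = mom (negPart ν) s + mom (posPart ν) s := by
  conv_lhs => rw [measure_decomp (ν := ν)]
  have h0 : Integrable (fun k : ℤ => (k : ℝ)) (ν.restrict {0}) := hν.integrable.integrableOn
  rw [mom_add ((integrable_negPart hν).add_measure (integrable_posPart_law hν)) h0,
    mom_add (integrable_negPart hν) (integrable_posPart_law hν), mom_eq h0 hs,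
    integral_restrict_zero, add_zero]
  simp [quadCap, hs]

lemma symb_eq_add (hν : CenteredLaw ν) (t : ℝ) :
    symb ν t = symb (negPart ν) t + symb (posPart ν) t := by
  conv_lhs => rw [measure_decomp (ν := ν)]
  have h0 : Integrable (fun k : ℤ => (k : ℝ)) (ν.restrict {0}) := hν.integrable.integrableOn
  rw [symb_add ((integrable_negPart hν).add_measure (integrable_posPart_law hν)) h0,
    symb_add (integrable_negPart hν) (integrable_posPart_law hν), symb.eq_1 (ν.restrict {0}),
    integral_restrict_zero, add_zero]
  simp [cis_zero]

/-- The linear term integrates to zero for a centred law. It is kept in `symb` because the separate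
pieces of `ν` are not centred. -/
lemma symb_eq (hν : CenteredLaw ν) (t : ℝ) : symb ν t = 1 - chf ν t := by
  have h1 : Integrable (fun k : ℤ => (1 + t * k * Complex.I : ℂ)) ν :=
    (integrable_const _).add ((hν.integrable.ofReal.const_mul (t : ℂ)).mul_const Complex.I |>.congr
      (ae_of_all _ fun k => by simp))
  rw [symb, integral_sub h1 (integrable_cis t), chf]
  congr 1
  have h2 : ∫ k : ℤ, (t * k * Complex.I : ℂ) ∂ν = 0 := by
    rw [integral_mul_const, integral_const_mul]
    have : ∫ k : ℤ, (k : ℂ) ∂ν = ((∫ k : ℤ, (k : ℝ) ∂ν : ℝ) : ℂ) := by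
      rw [← integral_complex_ofReal]; simp
    rw [this, hν.mean]; simp
  rw [integral_add (integrable_const _), h2]
  · simp
  · exact ((hν.integrable.ofReal.const_mul (t : ℂ)).mul_const Complex.I).congr
      (ae_of_all _ fun k => by simp)

lemma symb_smul (κ : Measure ℤ) {r : ℝ} (hr : 0 ≤ r) (t : ℝ) :
    symb (ENNReal.ofReal r • κ) t = r * symb κ t := by
  rw [symb, integral_smul_measure, ENNReal.toReal_ofReal hr, symb, Complex.real_smul]

lemma symb_dirac_zero (t : ℝ) : symb (Measure.dirac 0) t = 0 := by
  rw [symb, integral_dirac]; simp [cis_zero]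

lemma isProbabilityMeasure_rightContLaw : IsProbabilityMeasure (rightContLaw ν) := by
  have hc := negMean_nonneg (ν := ν)
  have h1 : ν.real (Set.Iio 0) ≤ 1 := measureReal_le_one
  have h2 : 0 ≤ ν.real (Set.Iio 0) := measureReal_nonneg
  constructor
  simp only [rightContLaw, unitAtom, negPart, Measure.add_apply, Measure.smul_apply, smul_eq_mul,
    measure_univ, mul_one, Measure.restrict_apply_univ]
  rw [← ofReal_measureReal, ← ENNReal.ofReal_add h2 hc, ← ENNReal.ofReal_mul (by positivity),
    ← ENNReal.ofReal_add (by positivity) (div_nonneg (by linarith) (by positivity)),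
    ENNReal.ofReal_eq_one]
  field_simp
  ring

lemma integrable_rightContLaw (hν : CenteredLaw ν) :
    Integrable (fun k : ℤ => (k : ℝ)) (rightContLaw ν) :=
  (((integrable_negPart hν).add_measure integrable_unitAtom).smul_measure
    ENNReal.ofReal_ne_top).add_measure ((integrable_dirac_int 0).smul_measure ENNReal.ofReal_ne_top)

/-- The atom at 1 has mass `negMean ν` before normalisation, which centres the law, and it alone
generates ℤ. Infinite variance must come from the negative part. -/
theorem centeredLaw_rightContLaw (hν : CenteredLaw ν)
    (hvar : ∫⁻ k, ENNReal.ofReal ((k : ℝ) ^ 2) ∂(negPart ν) = ⊤) :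
    CenteredLaw (rightContLaw ν) := by
  have hc := negMean_pos hν
  refine ⟨integrable_rightContLaw hν, ?_, ?_, ?_⟩
  · rw [rightContLaw, integral_add_measure (((integrable_negPart hν).add_measure
      integrable_unitAtom).smul_measure ENNReal.ofReal_ne_top)
      ((integrable_dirac_int 0).smul_measure ENNReal.ofReal_ne_top), integral_smul_measure,
      integral_smul_measure, integral_add_measure (integrable_negPart hν) integrable_unitAtom,
      unitAtom, integral_smul_measure, integral_dirac, integral_dirac,
      ENNReal.toReal_ofReal hc.le]
    have : ∫ k : ℤ, (k : ℝ) ∂(negPart ν) = -negMean ν := by rw [negMean, integral_neg, neg_neg]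
    rw [this]; simp
  · rw [rightContLaw, lintegral_add_measure, lintegral_smul_measure, lintegral_add_measure, hvar]
    simp only [top_add, smul_eq_mul]
    rw [ENNReal.mul_top, top_add]
    simp only [ne_eq, ENNReal.ofReal_eq_zero, not_le]; positivity
  · rw [eq_top_iff]
    intro y _
    have h1 : (1 : ℤ) ∈ AddSubgroup.closure {k : ℤ | rightContLaw ν {k} ≠ 0} := by
      refine AddSubgroup.subset_closure ?_
      simp only [Set.mem_ofPred_eq, rightContLaw, unitAtom, Measure.add_apply, Measure.smul_apply,
        smul_eq_mul, Measure.dirac_apply_of_mem (Set.mem_singleton (1 : ℤ)), mul_one, mul_add]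
      refine ne_of_gt (lt_of_lt_of_le ?_ (le_trans le_add_self le_self_add))
      rw [← ENNReal.ofReal_mul (by positivity), ENNReal.ofReal_pos]
      positivity
    have := AddSubgroup.zsmul_mem _ h1 y
    simpa using this

/-- The mass at 0 only completes the law to a probability measure and does not contribute to the
symbol. -/
lemma symb_rightContLaw (hν : CenteredLaw ν) (t : ℝ) :
    symb (rightContLaw ν) t
      = ((1 / (1 + negMean ν) : ℝ) : ℂ) * (symb (negPart ν) t + symb (unitAtom ν) t) := by
  have hc := negMean_nonneg (ν := ν)
  have h1 : ν.real (Set.Iio 0) ≤ 1 := measureReal_le_one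
  have : IsFiniteMeasure (ENNReal.ofReal (1 / (1 + negMean ν)) • (negPart ν + unitAtom ν)) :=
    Measure.smul_finite _ ENNReal.ofReal_ne_top
  have : IsFiniteMeasure (ENNReal.ofReal ((1 - ν.real (Set.Iio 0)) / (1 + negMean ν)) •
      (Measure.dirac 0 : Measure ℤ)) := Measure.smul_finite _ ENNReal.ofReal_ne_top
  rw [rightContLaw, symb_add (((integrable_negPart hν).add_measure
      integrable_unitAtom).smul_measure ENNReal.ofReal_ne_top)
      ((integrable_dirac_int 0).smul_measure ENNReal.ofReal_ne_top),
    symb_smul _ (by positivity), symb_smul _ (div_nonneg (by linarith) (by positivity)),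
    symb_dirac_zero, symb_add (integrable_negPart hν) integrable_unitAtom, mul_zero, add_zero]

lemma rightContLaw_supp {k : ℤ} (hk : rightContLaw ν {k} ≠ 0) : k ≤ 1 := by
  by_contra! h
  refine hk ?_
  have h1 : negPart ν {k} = 0 := by
    rw [negPart, Measure.restrict_apply (measurableSet_singleton k)]
    have : ({k} ∩ Set.Iio 0 : Set ℤ) = ∅ := by
      ext j; simp only [Set.mem_inter_iff, Set.mem_singleton_iff, Set.mem_Iio,
        Set.mem_empty_iff_false, iff_false]; omega
    rw [this, measure_empty]
  have h2 : (Measure.dirac (1 : ℤ)) {k} = 0 := by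
    rw [Measure.dirac_apply' _ (measurableSet_singleton k)]
    exact Set.indicator_of_notMem (by simp only [Set.mem_singleton_iff]; omega) _
  have h3 : (Measure.dirac (0 : ℤ)) {k} = 0 := by
    rw [Measure.dirac_apply' _ (measurableSet_singleton k)]
    exact Set.indicator_of_notMem (by simp only [Set.mem_singleton_iff]; omega) _
  simp [rightContLaw, unitAtom, h1, h2, h3]

end

/-! ### Explicit antiderivatives for the frequency integrals -/

/-- An integral is bounded by the increment of a function whose derivative dominates. -/
lemma norm_integral_le_sub {E : Type*} [NormedAddCommGroup E] [NormedSpace ℝ E] {a b : ℝ}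
    (hab : a ≤ b) {f : ℝ → E} {G g : ℝ → ℝ} (hG : ContinuousOn G (Set.Icc a b))
    (hd : ∀ t ∈ Set.Ioo a b, HasDerivAt G (g t) t) (hf : ∀ t ∈ Set.Ioo a b, ‖f t‖ ≤ g t) :
    ‖∫ t in a..b, f t‖ ≤ G b - G a := by
  have hi : IntervalIntegrable g volume a b := by
    rw [intervalIntegrable_iff_integrableOn_Ioc_of_le hab]
    exact intervalIntegral.integrableOn_deriv_of_nonneg hG hd fun t ht =>
      (norm_nonneg _).trans (hf t ht)
  rw [← intervalIntegral.integral_eq_sub_of_hasDerivAt_of_le hab hG hd hi]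
  refine intervalIntegral.norm_integral_le_of_norm_le hab ?_ hi
  have : ∀ᵐ t : ℝ, t ≠ b := by simp [ae_iff]
  filter_upwards [this] with t ht hm
  exact hf t ⟨hm.1, lt_of_le_of_ne hm.2 ht⟩

lemma integrableOn_of_deriv_bound {a b : ℝ} {f : ℝ → ℝ} {G g : ℝ → ℝ}
    (hG : ContinuousOn G (Set.Icc a b))
    (hd : ∀ t ∈ Set.Ioo a b, HasDerivAt G (g t) t) (hf : ∀ t ∈ Set.Ioo a b, |f t| ≤ g t)
    (hm : AEStronglyMeasurable f (volume.restrict (Set.Ioc a b))) :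
    IntegrableOn f (Set.Ioc a b) := by
  refine (intervalIntegral.integrableOn_deriv_of_nonneg hG hd fun t ht =>
      (abs_nonneg _).trans (hf t ht)).mono' hm ?_
  have : ∀ᵐ t : ℝ ∂(volume.restrict (Set.Ioc a b)), t ≠ b :=
    ae_restrict_of_ae (by simp [ae_iff])
  filter_upwards [this, ae_restrict_mem measurableSet_Ioc] with t ht hm
  exact hf t ⟨hm.1, lt_of_le_of_ne hm.2 ht⟩

section
variable {κe κ : Measure ℤ} [IsFiniteMeasure κe] [IsFiniteMeasure κ]

/-- Minus an antiderivative of a majorant of `(cub κe + θ cub κ) / (mom κ) ^ 2` at `1 / t`. -/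
def tailAnti (κe κ : Measure ℤ) (θ s : ℝ) : ℝ :=
  mom κe s / mom κ s ^ 2 - 3 * θ / mom κ s - (cub κe s + θ * cub κ s) / (s * mom κ s ^ 2)

/-- The first term is the quantity to be integrated, with the factor 1/s² from t = 1/s. Integration
by parts against 1/s produces the rest, and the coefficient 3θ in `tailAnti` makes the last term
nonnegative when `mom κe s ≤ θ * mom κ s`. -/
def tailAntiDeriv (κe κ : Measure ℤ) (θ s : ℝ) : ℝ :=
  (cub κe s + θ * cub κ s) / (s ^ 2 * mom κ s ^ 2)
    + 2 * (cub κe s + θ * cub κ s) * eta κ s / (s * mom κ s ^ 3)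
    + 2 * eta κ s * (θ * mom κ s - mom κe s) / mom κ s ^ 3

/-- An antiderivative of a majorant of the integrated real parts. -/
def midAnti (κe κ : Measure ℤ) (θ s : ℝ) : ℝ :=
  -(s * mom κe s / mom κ s ^ 2) + 3 * θ * s / mom κ s

/-- It exceeds the target of `midAntiDeriv_ge` by 2(m - s η)(θm - m_e)/m³, with m and η the moment
and integrated tail of `κ` and m_e the moment of `κe`. This is nonnegative under the same condition.
-/
def midAntiDeriv (κe κ : Measure ℤ) (θ s : ℝ) : ℝ :=
  -(mom κe s + s * eta κe s) / mom κ s ^ 2 + 2 * s * mom κe s * eta κ s / mom κ s ^ 3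
    + 3 * θ * (mom κ s - s * eta κ s) / mom κ s ^ 2

lemma hasDerivAt_tailAnti (he : Integrable (fun k : ℤ => (k : ℝ)) κe)
    (hκ : Integrable (fun k : ℤ => (k : ℝ)) κ) (θ : ℝ) {s : ℝ} (hs : 0 < s) (hm : 0 < mom κ s) :
    HasDerivAt (tailAnti κe κ θ) (tailAntiDeriv κe κ θ s) s := by
  have h1 := hasDerivAt_mom he s
  have h2 := hasDerivAt_mom hκ s
  have h3 := hasDerivAt_cub he s
  have h4 := hasDerivAt_cub hκ s
  have h5 := ((h1.div (h2.pow 2) (pow_ne_zero 2 hm.ne')).sub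
    ((hasDerivAt_const s (3 * θ)).div h2 hm.ne')).sub
    ((h3.add (h4.const_mul θ)).div ((hasDerivAt_id s).mul (h2.pow 2)) (by simp; exact ⟨hs.ne', hm.ne'⟩))
  refine h5.congr_deriv ?_
  simp only [tailAntiDeriv, Pi.pow_apply, Pi.mul_apply, id, Pi.add_apply]
  field_simp
  ring

lemma hasDerivAt_midAnti (he : Integrable (fun k : ℤ => (k : ℝ)) κe)
    (hκ : Integrable (fun k : ℤ => (k : ℝ)) κ) (θ : ℝ) {s : ℝ} (hm : 0 < mom κ s) :
    HasDerivAt (midAnti κe κ θ) (midAntiDeriv κe κ θ s) s := by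
  have h1 := hasDerivAt_mom he s
  have h2 := hasDerivAt_mom hκ s
  have h5 := (((hasDerivAt_id s).mul h1).div (h2.pow 2) (pow_ne_zero 2 hm.ne')).neg.add
    (((hasDerivAt_id s).const_mul (3 * θ)).div h2 hm.ne')
  refine h5.congr_deriv ?_
  simp only [midAntiDeriv, Pi.pow_apply, Pi.mul_apply, id]
  field_simp
  ring

lemma hasDerivAt_comp_inv {F : ℝ → ℝ} {F' t : ℝ} (ht : 0 < t) (h : HasDerivAt F F' t⁻¹) :
    HasDerivAt (fun t => -F t⁻¹) (F' / t ^ 2) t := by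
  have := (h.comp t (hasDerivAt_inv ht.ne')).neg
  refine this.congr_deriv ?_
  field_simp

lemma tailAntiDeriv_ge {θ s : ℝ} (hθ : 0 ≤ θ) (hs : 0 < s) (hm : 0 < mom κ s)
    (h : mom κe s ≤ θ * mom κ s) :
    (cub κe s + θ * cub κ s) / (s ^ 2 * mom κ s ^ 2) ≤ tailAntiDeriv κe κ θ s := by
  have h1 := eta_nonneg (κ := κ) s
  have h2 := cub_nonneg (κ := κ) hs.le
  have h3 := cub_nonneg (κ := κe) hs.le
  have h4 := sub_nonneg.2 h
  rw [tailAntiDeriv, add_assoc]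
  exact le_add_of_nonneg_right (by positivity)

lemma midAntiDeriv_ge (hκ : Integrable (fun k : ℤ => (k : ℝ)) κ) {θ s : ℝ} (hs : 0 < s)
    (hm : 0 < mom κ s) (h : mom κe s ≤ θ * mom κ s) :
    (mom κe s - s * eta κe s + θ * (mom κ s - s * eta κ s)) / mom κ s ^ 2
      ≤ midAntiDeriv κe κ θ s := by
  have h1 := sub_nonneg.2 (mul_eta_le_mom hκ hs.le)
  have h4 := sub_nonneg.2 h
  have : midAntiDeriv κe κ θ s
      = (mom κe s - s * eta κe s + θ * (mom κ s - s * eta κ s)) / mom κ s ^ 2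
        + 2 * (mom κ s - s * eta κ s) * (θ * mom κ s - mom κe s) / mom κ s ^ 3 := by
    rw [midAntiDeriv]; field_simp; ring
  rw [this]
  exact le_add_of_nonneg_right (by positivity)

lemma neg_tailAnti_le (he : Integrable (fun k : ℤ => (k : ℝ)) κe)
    (hκ : Integrable (fun k : ℤ => (k : ℝ)) κ) {θ s : ℝ} (hθ : 0 ≤ θ) (hs : 0 < s)
    (hm : 0 < mom κ s) (h : mom κe s ≤ θ * mom κ s) :
    0 ≤ -tailAnti κe κ θ s ∧ -tailAnti κe κ θ s ≤ 5 * θ / mom κ s := by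
  have h2 := cub_nonneg (κ := κ) hs.le
  have h3 := cub_nonneg (κ := κe) hs.le
  have h0 := mom_nonneg (κ := κe) hs.le
  have h4 := cub_le_mul_mom hκ hs.le
  have h5 := cub_le_mul_mom he hs.le
  have e1 : mom κe s / mom κ s ^ 2 ≤ θ / mom κ s := by
    rw [div_le_div_iff₀ (by positivity) hm]; nlinarith
  have e2 : (cub κe s + θ * cub κ s) / (s * mom κ s ^ 2) ≤ 2 * θ / mom κ s := by
    rw [div_le_div_iff₀ (by positivity) hm]
    have : cub κe s + θ * cub κ s ≤ 2 * θ * s * mom κ s := by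
      nlinarith [mul_le_mul_of_nonneg_left h4 hθ, mul_le_mul_of_nonneg_left h hs.le]
    nlinarith [mul_le_mul_of_nonneg_right this hm.le]
  have e3 : 0 ≤ (cub κe s + θ * cub κ s) / (s * mom κ s ^ 2) := by positivity
  have e4 : 0 ≤ mom κe s / mom κ s ^ 2 := by positivity
  have e5 : 0 ≤ θ / mom κ s := by positivity
  have e6 : 3 * θ / mom κ s = 3 * (θ / mom κ s) := by ring
  have e7 : 2 * θ / mom κ s = 2 * (θ / mom κ s) := by ring
  have e8 : 5 * θ / mom κ s = 5 * (θ / mom κ s) := by ring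
  rw [tailAnti, e8]
  rw [e7] at e2
  rw [e6]
  constructor <;> linarith

lemma continuousOn_tailAnti_inv (he : Integrable (fun k : ℤ => (k : ℝ)) κe)
    (hκ : Integrable (fun k : ℤ => (k : ℝ)) κ) (hpos : ∀ s, 0 < s → 0 < mom κ s)
    (htop : Tendsto (mom κ) atTop atTop) {θ s₀ : ℝ} (hθ : 0 ≤ θ) (hs₀ : 0 < s₀)
    (h : ∀ s, s₀ ≤ s → mom κe s ≤ θ * mom κ s) (b : ℝ) :
    ContinuousOn (fun t : ℝ => -tailAnti κe κ θ t⁻¹) (Set.Icc 0 b) := by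
  intro t ht
  rcases ht.1.eq_or_lt with rfl | ht0
  -- At t = 0 the conventions for inverse and division by zero give the value 0, which is also the
  -- limit as s = 1/t → ∞.
  · have h0 : -tailAnti κe κ θ (0 : ℝ)⁻¹ = 0 := by simp [tailAnti, mom, cub]
    rw [ContinuousWithinAt, h0]
    rw [← Set.insert_eq_of_mem ht, ← Set.Ioc_insert_left (ht.1.trans ht.2), Set.insert_idem,
      nhdsWithin_insert]
    refine Tendsto.sup ?_ ?_
    · have := tendsto_pure_nhds (fun t : ℝ => -tailAnti κe κ θ t⁻¹) (0 : ℝ)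
      simpa only [h0] using this
    · have hl : Tendsto (fun t : ℝ => t⁻¹) (𝓝[Set.Ioc 0 b] 0) atTop :=
        (tendsto_inv_nhdsGT_zero (𝕜 := ℝ)).mono_left (nhdsWithin_mono _ fun x hx => hx.1)
      have h5 : Tendsto (fun s => 5 * θ / mom κ s) atTop (𝓝 0) := tendsto_const_nhds.div_atTop htop
      refine Tendsto.comp (g := fun s => -tailAnti κe κ θ s) (y := atTop) ?_ hl
      refine squeeze_zero' ?_ ?_ h5
      · filter_upwards [eventually_ge_atTop s₀] with s hs
        have := hs₀.trans_le hs
        exact (neg_tailAnti_le he hκ hθ this (hpos s this) (h s hs)).1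
      · filter_upwards [eventually_ge_atTop s₀] with s hs
        have := hs₀.trans_le hs
        exact (neg_tailAnti_le he hκ hθ this (hpos s this) (h s hs)).2
  · have hi : 0 < t⁻¹ := inv_pos.2 ht0
    exact (hasDerivAt_comp_inv ht0 (hasDerivAt_tailAnti he hκ θ hi
      (hpos _ hi))).continuousAt.continuousWithinAt

lemma div_mom_mono (hκ : Integrable (fun k : ℤ => (k : ℝ)) κ) (hpos : ∀ s, 0 < s → 0 < mom κ s)
    {s r : ℝ} (hs : 0 < s) (hsr : s ≤ r) : s / mom κ s ≤ r / mom κ r := by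
  rw [div_le_div_iff₀ (hpos s hs) (hpos r (hs.trans_le hsr))]
  exact mul_mom_le hκ hs hsr

lemma midAnti_sub_le (hκ : Integrable (fun k : ℤ => (k : ℝ)) κ)
    (hpos : ∀ s, 0 < s → 0 < mom κ s) {θ s₀ x : ℝ} (hθ : 0 ≤ θ) (hs₀ : 0 < s₀) (hx : s₀ ≤ x)
    (h : mom κe s₀ ≤ θ * mom κ s₀) :
    midAnti κe κ θ x - midAnti κe κ θ s₀ ≤ 4 * θ * (x / mom κ x) := by
  have hx0 := hs₀.trans_le hx
  have hm := hpos s₀ hs₀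
  have e1 : 0 ≤ x * mom κe x / mom κ x ^ 2 := by
    have := mom_nonneg (κ := κe) hx0.le
    positivity
  have e2 : s₀ * mom κe s₀ / mom κ s₀ ^ 2 ≤ θ * (s₀ / mom κ s₀) := by
    rw [← mul_div_assoc, div_le_div_iff₀ (by positivity) hm]
    nlinarith [mul_le_mul_of_nonneg_left h (by positivity : 0 ≤ s₀ * mom κ s₀)]
  have e3 := mul_le_mul_of_nonneg_left (div_mom_mono hκ hpos hs₀ hx) hθ
  have e4 : 0 ≤ θ * (s₀ / mom κ s₀) := by positivity
  have e5 : 3 * θ * x / mom κ x = 3 * (θ * (x / mom κ x)) := by ring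
  have e6 : 3 * θ * s₀ / mom κ s₀ = 3 * (θ * (s₀ / mom κ s₀)) := by ring
  rw [midAnti, midAnti, e5, e6]
  linarith

/-- Integrability of the function controlling the imaginary part of `1 / symb`. -/
lemma integrableOn_of_le_cub_div (hκ : Integrable (fun k : ℤ => (k : ℝ)) κ)
    (hpos : ∀ s, 0 < s → 0 < mom κ s) (htop : Tendsto (mom κ) atTop atTop) {C b : ℝ} (hC : 0 ≤ C)
    {f : ℝ → ℝ} (hm : AEStronglyMeasurable f (volume.restrict (Set.Ioc 0 b)))
    (hf : ∀ t, 0 < t → t ≤ b → |f t| ≤ C * (cub κ t⁻¹ / mom κ t⁻¹ ^ 2)) :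
    IntegrableOn f (Set.Ioc 0 b) := by
  have h1 : ∀ s, (1 : ℝ) ≤ s → mom κ s ≤ 1 * mom κ s := fun s _ => by rw [one_mul]
  -- Taking `κe = κ` and θ = 1 makes the domination hypothesis trivial.
  refine integrableOn_of_deriv_bound (G := fun t => C * -tailAnti κ κ 1 t⁻¹)
    (g := fun t => C * (tailAntiDeriv κ κ 1 t⁻¹ / t ^ 2))
    (continuousOn_const.mul (continuousOn_tailAnti_inv hκ hκ hpos htop zero_le_one one_pos h1 b))
    (fun t ht => ?_) (fun t ht => ?_) hm
  · have hi : 0 < t⁻¹ := inv_pos.2 ht.1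
    exact (hasDerivAt_comp_inv ht.1 (hasDerivAt_tailAnti hκ hκ 1 hi (hpos _ hi))).const_mul C
  · have ht0 := ht.1
    have hi : 0 < t⁻¹ := inv_pos.2 ht0
    have hmp := hpos _ hi
    refine (hf t ht0 ht.2.le).trans (mul_le_mul_of_nonneg_left ?_ hC)
    have h2 := tailAntiDeriv_ge (κe := κ) (κ := κ) zero_le_one hi hmp (by rw [one_mul])
    have hc := cub_nonneg (κ := κ) hi.le
    rw [le_div_iff₀ (by positivity)]
    refine le_trans ?_ h2
    rw [one_mul, show (cub κ t⁻¹ + cub κ t⁻¹) / (t⁻¹ ^ 2 * mom κ t⁻¹ ^ 2)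
      = 2 * (cub κ t⁻¹ / mom κ t⁻¹ ^ 2 * t ^ 2) by field_simp; ring]
    have : 0 ≤ cub κ t⁻¹ / mom κ t⁻¹ ^ 2 * t ^ 2 := by positivity
    linarith

end

/-! ### Bounds for the difference of the reciprocals of two symbols -/

/-- `w` is differentiable with derivative `dw` and obeys the bounds satisfied by `symb κ`. -/
structure SymbBound (κ : Measure ℤ) (w dw : ℝ → ℂ) : Prop where
  deriv : ∀ t, HasDerivAt w (dw t) t
  cont : Continuous dw
  norm_le : ∀ t, 0 < t → ‖w t‖ ≤ 8 * t ^ 2 * mom κ t⁻¹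
  re_le : ∀ t, 0 < t → |(w t).re| ≤ 4 * t ^ 2 * (mom κ t⁻¹ - t⁻¹ * eta κ t⁻¹)
  im_le : ∀ t, 0 < t → |(w t).im| ≤ 12 * t ^ 3 * cub κ t⁻¹
  deriv_le : ∀ t, 0 < t → ‖dw t‖ ≤ 4 * t * mom κ t⁻¹

section
variable {κ κ' : Measure ℤ} [IsFiniteMeasure κ] [IsFiniteMeasure κ'] {w w' dw dw' : ℝ → ℂ}

lemma symbBound_symb (hκ : Integrable (fun k : ℤ => (k : ℝ)) κ) :
    SymbBound κ (symb κ) (symbDeriv κ) :=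
  ⟨hasDerivAt_symb hκ, continuous_symbDeriv hκ, fun _ ht => norm_symb_le hκ ht,
    fun t ht => by rw [abs_of_nonneg (symb_re_nonneg hκ t)]; exact symb_re_le hκ ht,
    fun _ ht => abs_symb_im_le hκ ht, fun _ ht => norm_symbDeriv_le hκ ht⟩

/-- The zero function pads the parts of the total measure that do not occur in one of the two
symbols, so that both are bounded by the same measure. -/
lemma symbBound_zero (hκ : Integrable (fun k : ℤ => (k : ℝ)) κ) :
    SymbBound κ (fun _ => 0) (fun _ => 0) := by
  refine ⟨fun t => hasDerivAt_const t 0, continuous_const, fun t ht => ?_, fun t ht => ?_,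
    fun t ht => ?_, fun t ht => ?_⟩
  all_goals
    have h1 := mom_nonneg (κ := κ) (inv_nonneg.2 ht.le)
    have h2 := cub_nonneg (κ := κ) (inv_nonneg.2 ht.le)
    have h3 := sub_nonneg.2 (mul_eta_le_mom hκ (inv_nonneg.2 ht.le))
    simp only [norm_zero, Complex.zero_re, Complex.zero_im, abs_zero]
    positivity

lemma SymbBound.neg (h : SymbBound κ w dw) : SymbBound κ (fun t => -w t) (fun t => -dw t) :=
  ⟨fun t => (h.deriv t).neg, h.cont.neg, fun t ht => by rw [norm_neg]; exact h.norm_le t ht,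
    fun t ht => by rw [Complex.neg_re, abs_neg]; exact h.re_le t ht,
    fun t ht => by rw [Complex.neg_im, abs_neg]; exact h.im_le t ht,
    fun t ht => by rw [norm_neg]; exact h.deriv_le t ht⟩

lemma SymbBound.add (hκ : Integrable (fun k : ℤ => (k : ℝ)) κ)
    (hκ' : Integrable (fun k : ℤ => (k : ℝ)) κ') (h : SymbBound κ w dw)
    (h' : SymbBound κ' w' dw') :
    SymbBound (κ + κ') (fun t => w t + w' t) (fun t => dw t + dw' t) := by
  refine ⟨fun t => (h.deriv t).add (h'.deriv t), h.cont.add h'.cont, fun t ht => ?_,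
    fun t ht => ?_, fun t ht => ?_, fun t ht => ?_⟩
  · rw [mom_add hκ hκ']
    linarith [norm_add_le (w t) (w' t), h.norm_le t ht, h'.norm_le t ht]
  · rw [mom_add hκ hκ', eta_add hκ hκ', Complex.add_re]
    linarith [abs_add_le (w t).re (w' t).re, h.re_le t ht, h'.re_le t ht]
  · rw [cub_add hκ hκ', Complex.add_im]
    linarith [abs_add_le (w t).im (w' t).im, h.im_le t ht, h'.im_le t ht]
  · rw [mom_add hκ hκ']
    linarith [norm_add_le (dw t) (dw' t), h.deriv_le t ht, h'.deriv_le t ht]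

end

lemma abs_im_mul_le (a b : ℂ) : |(a * b).im| ≤ |a.im| * ‖b‖ + ‖a‖ * |b.im| := by
  rw [Complex.mul_im]
  refine (abs_add_le _ _).trans ?_
  rw [abs_mul, abs_mul, add_comm]
  gcongr
  · exact Complex.abs_re_le_norm b
  · exact Complex.abs_re_le_norm a

/-- The variant in terms of real parts is needed for the real part of a triple product, whose
factors have small real parts. -/
lemma abs_im_mul_le' (a b : ℂ) : |(a * b).im| ≤ |a.re| * ‖b‖ + ‖a‖ * |b.re| := by
  rw [Complex.mul_im]
  refine (abs_add_le _ _).trans ?_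
  rw [abs_mul, abs_mul]
  gcongr
  · exact Complex.abs_im_le_norm b
  · exact Complex.abs_im_le_norm a

lemma abs_re_mul_le (a b : ℂ) : |(a * b).re| ≤ |a.re| * ‖b‖ + ‖a‖ * |b.im| := by
  rw [Complex.mul_re]
  refine (abs_sub _ _).trans ?_
  rw [abs_mul, abs_mul]
  gcongr
  · exact Complex.abs_re_le_norm b
  · exact Complex.abs_im_le_norm a

section
variable {a w v : ℂ} {p : ℝ}

lemma norm_inv_le (hp : 0 < p) (hw : p ≤ ‖w‖) : ‖w⁻¹‖ ≤ p⁻¹ := by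
  rw [norm_inv]; exact inv_anti₀ hp hw

lemma abs_im_inv_le (hp : 0 < p) (hw : p ≤ ‖w‖) : |w⁻¹.im| ≤ |w.im| / p ^ 2 := by
  rw [Complex.inv_im, ← Complex.sq_norm, abs_div, abs_neg, abs_of_nonneg (sq_nonneg ‖w‖)]
  gcongr

lemma abs_re_inv_le (hp : 0 < p) (hw : p ≤ ‖w‖) : |w⁻¹.re| ≤ |w.re| / p ^ 2 := by
  rw [Complex.inv_re, ← Complex.sq_norm, abs_div, abs_of_nonneg (sq_nonneg ‖w‖)]
  gcongr

lemma norm_div_mul_le (hp : 0 < p) (hw : p ≤ ‖w‖) (hv : p ≤ ‖v‖) :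
    ‖a / (w * v)‖ ≤ ‖a‖ / p ^ 2 := by
  rw [norm_div, norm_mul, sq]
  gcongr

lemma abs_im_div_mul_le (hp : 0 < p) (hw : p ≤ ‖w‖) (hv : p ≤ ‖v‖) :
    |(a / (w * v)).im| ≤ |a.im| / p ^ 2 + ‖a‖ * (|w.im| + |v.im|) / p ^ 3 := by
  rw [div_eq_mul_inv, mul_inv]
  have h1 := norm_inv_le hp hw
  have h2 := norm_inv_le hp hv
  have h3 := abs_im_inv_le hp hw
  have h4 := abs_im_inv_le hp hv
  calc |(a * (w⁻¹ * v⁻¹)).im| ≤ |a.im| * ‖w⁻¹ * v⁻¹‖ + ‖a‖ * |(w⁻¹ * v⁻¹).im| := abs_im_mul_le _ _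
    _ ≤ |a.im| * (p⁻¹ * p⁻¹) + ‖a‖ * (|w.im| / p ^ 2 * p⁻¹ + p⁻¹ * (|v.im| / p ^ 2)) := by
        rw [norm_mul]
        have := (abs_im_mul_le w⁻¹ v⁻¹).trans (add_le_add
          (mul_le_mul h3 h2 (norm_nonneg _) (by positivity))
          (mul_le_mul h1 h4 (abs_nonneg _) (by positivity)))
        gcongr
    _ = _ := by field_simp

lemma abs_re_div_mul_le (hp : 0 < p) (hw : p ≤ ‖w‖) (hv : p ≤ ‖v‖) :
    |(a / (w * v)).re| ≤ |a.re| / p ^ 2 + ‖a‖ * (|w.re| + |v.re|) / p ^ 3 := by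
  rw [div_eq_mul_inv, mul_inv]
  have h1 := norm_inv_le hp hw
  have h2 := norm_inv_le hp hv
  have h3 := abs_re_inv_le hp hw
  have h4 := abs_re_inv_le hp hv
  calc |(a * (w⁻¹ * v⁻¹)).re| ≤ |a.re| * ‖w⁻¹ * v⁻¹‖ + ‖a‖ * |(w⁻¹ * v⁻¹).im| := abs_re_mul_le _ _
    _ ≤ |a.re| * (p⁻¹ * p⁻¹) + ‖a‖ * (|w.re| / p ^ 2 * p⁻¹ + p⁻¹ * (|v.re| / p ^ 2)) := by
        rw [norm_mul]
        have := (abs_im_mul_le' w⁻¹ v⁻¹).trans (add_le_add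
          (mul_le_mul h3 h2 (norm_nonneg _) (by positivity))
          (mul_le_mul h1 h4 (abs_nonneg _) (by positivity)))
        gcongr
    _ = _ := by field_simp

end

section
variable {κe κ : Measure ℤ} [IsFiniteMeasure κe] [IsFiniteMeasure κ] {w v dw dv : ℝ → ℂ} {c θ t : ℝ}

/-- Size of `1 / w - 1 / v`. -/
lemma norm_diff_inv_le (hA : SymbBound κe (fun t => v t - w t) (fun t => dv t - dw t))
    (hc : 0 < c) (ht : 0 < t) (hm : 0 < mom κ t⁻¹) (hwl : c * t ^ 2 * mom κ t⁻¹ ≤ ‖w t‖)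
    (hvl : c * t ^ 2 * mom κ t⁻¹ ≤ ‖v t‖) (hθ : mom κe t⁻¹ ≤ θ * mom κ t⁻¹) :
    ‖(v t - w t) / (w t * v t)‖ ≤ 8 / c ^ 2 * (θ / (t ^ 2 * mom κ t⁻¹)) := by
  have hp : 0 < c * t ^ 2 * mom κ t⁻¹ := by positivity
  refine (norm_div_mul_le hp hwl hvl).trans ?_
  calc ‖v t - w t‖ / (c * t ^ 2 * mom κ t⁻¹) ^ 2
      ≤ 8 * t ^ 2 * (θ * mom κ t⁻¹) / (c * t ^ 2 * mom κ t⁻¹) ^ 2 := by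
        gcongr
        exact (hA.norm_le t ht).trans (by gcongr)
    _ = _ := by field_simp

/-- Each term contains exactly one imaginary part, of `v - w`, `w` or `v`, so every term carries a
`cub` factor; this is the gain over the bound by the modulus. -/
lemma abs_im_diff_inv_le (hw : SymbBound κ w dw) (hv : SymbBound κ v dv)
    (hA : SymbBound κe (fun t => v t - w t) (fun t => dv t - dw t))
    (hc : 0 < c) (ht : 0 < t) (hm : 0 < mom κ t⁻¹) (hwl : c * t ^ 2 * mom κ t⁻¹ ≤ ‖w t‖)
    (hvl : c * t ^ 2 * mom κ t⁻¹ ≤ ‖v t‖) (hθ0 : 0 ≤ θ) (hθ : mom κe t⁻¹ ≤ θ * mom κ t⁻¹) :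
    t * |((v t - w t) / (w t * v t)).im|
      ≤ (12 / c ^ 2 + 192 / c ^ 3) * ((cub κe t⁻¹ + θ * cub κ t⁻¹) / mom κ t⁻¹ ^ 2) := by
  have hp : 0 < c * t ^ 2 * mom κ t⁻¹ := by positivity
  have h1 := cub_nonneg (κ := κ) (inv_nonneg.2 ht.le)
  have h2 := cub_nonneg (κ := κe) (inv_nonneg.2 ht.le)
  have h3 : ‖v t - w t‖ ≤ 8 * t ^ 2 * (θ * mom κ t⁻¹) := (hA.norm_le t ht).trans (by gcongr)
  have h4 := hA.im_le t ht
  have h5 := hw.im_le t ht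
  have h6 := hv.im_le t ht
  calc t * |((v t - w t) / (w t * v t)).im|
      ≤ t * (|(v t - w t).im| / (c * t ^ 2 * mom κ t⁻¹) ^ 2
          + ‖v t - w t‖ * (|(w t).im| + |(v t).im|) / (c * t ^ 2 * mom κ t⁻¹) ^ 3) := by
        gcongr; exact abs_im_div_mul_le hp hwl hvl
    _ ≤ t * (12 * t ^ 3 * cub κe t⁻¹ / (c * t ^ 2 * mom κ t⁻¹) ^ 2
          + 8 * t ^ 2 * (θ * mom κ t⁻¹) * (12 * t ^ 3 * cub κ t⁻¹ + 12 * t ^ 3 * cub κ t⁻¹)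
            / (c * t ^ 2 * mom κ t⁻¹) ^ 3) := by
        gcongr
    _ = 12 / c ^ 2 * (cub κe t⁻¹ / mom κ t⁻¹ ^ 2)
        + 192 / c ^ 3 * (θ * cub κ t⁻¹ / mom κ t⁻¹ ^ 2) := by field_simp; ring
    _ ≤ (12 / c ^ 2 + 192 / c ^ 3) * (cub κe t⁻¹ / mom κ t⁻¹ ^ 2)
        + (12 / c ^ 2 + 192 / c ^ 3) * (θ * cub κ t⁻¹ / mom κ t⁻¹ ^ 2) := by
        gcongr
        · exact le_add_of_nonneg_right (by positivity)
        · exact le_add_of_nonneg_left (by positivity)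
    _ = _ := by rw [← mul_add, add_div]

/-- As for the imaginary part, with one real part in every term, which brings the smaller quantity
`mom - s * eta`. -/
lemma abs_re_diff_inv_le (he : Integrable (fun k : ℤ => (k : ℝ)) κe)
    (hκ : Integrable (fun k : ℤ => (k : ℝ)) κ) (hw : SymbBound κ w dw) (hv : SymbBound κ v dv)
    (hA : SymbBound κe (fun t => v t - w t) (fun t => dv t - dw t))
    (hc : 0 < c) (ht : 0 < t) (hm : 0 < mom κ t⁻¹) (hwl : c * t ^ 2 * mom κ t⁻¹ ≤ ‖w t‖)
    (hvl : c * t ^ 2 * mom κ t⁻¹ ≤ ‖v t‖) (hθ0 : 0 ≤ θ) (hθ : mom κe t⁻¹ ≤ θ * mom κ t⁻¹) :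
    |((v t - w t) / (w t * v t)).re|
      ≤ (4 / c ^ 2 + 64 / c ^ 3) * ((mom κe t⁻¹ - t⁻¹ * eta κe t⁻¹
        + θ * (mom κ t⁻¹ - t⁻¹ * eta κ t⁻¹)) / mom κ t⁻¹ ^ 2 / t ^ 2) := by
  have hp : 0 < c * t ^ 2 * mom κ t⁻¹ := by positivity
  have h1 := sub_nonneg.2 (mul_eta_le_mom hκ (inv_nonneg.2 ht.le))
  have h2 := sub_nonneg.2 (mul_eta_le_mom he (inv_nonneg.2 ht.le))
  have h3 : ‖v t - w t‖ ≤ 8 * t ^ 2 * (θ * mom κ t⁻¹) := (hA.norm_le t ht).trans (by gcongr)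
  have h4 := hA.re_le t ht
  have h5 := hw.re_le t ht
  have h6 := hv.re_le t ht
  set d := mom κ t⁻¹ - t⁻¹ * eta κ t⁻¹
  set e := mom κe t⁻¹ - t⁻¹ * eta κe t⁻¹
  calc |((v t - w t) / (w t * v t)).re|
      ≤ |(v t - w t).re| / (c * t ^ 2 * mom κ t⁻¹) ^ 2
          + ‖v t - w t‖ * (|(w t).re| + |(v t).re|) / (c * t ^ 2 * mom κ t⁻¹) ^ 3 :=
        abs_re_div_mul_le hp hwl hvl
    _ ≤ 4 * t ^ 2 * e / (c * t ^ 2 * mom κ t⁻¹) ^ 2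
          + 8 * t ^ 2 * (θ * mom κ t⁻¹) * (4 * t ^ 2 * d + 4 * t ^ 2 * d)
            / (c * t ^ 2 * mom κ t⁻¹) ^ 3 := by
        gcongr
    _ = 4 / c ^ 2 * (e / mom κ t⁻¹ ^ 2 / t ^ 2)
        + 64 / c ^ 3 * (θ * d / mom κ t⁻¹ ^ 2 / t ^ 2) := by field_simp; ring
    _ ≤ (4 / c ^ 2 + 64 / c ^ 3) * (e / mom κ t⁻¹ ^ 2 / t ^ 2)
        + (4 / c ^ 2 + 64 / c ^ 3) * (θ * d / mom κ t⁻¹ ^ 2 / t ^ 2) := by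
        gcongr
        · exact le_add_of_nonneg_right (by positivity)
        · exact le_add_of_nonneg_left (by positivity)
    _ = _ := by rw [← mul_add, add_div, add_div]

/-- The derivative of `1 / w - 1 / v`. -/
def diffInvDeriv (w v dw dv : ℝ → ℂ) (t : ℝ) : ℂ :=
  (dv t - dw t) / (w t * v t)
    - (v t - w t) * (dw t / (w t * v t) / w t + dv t / (w t * v t) / v t)

lemma hasDerivAt_diff_inv (hw : HasDerivAt w (dw t) t) (hv : HasDerivAt v (dv t) t)
    (hw0 : w t ≠ 0) (hv0 : v t ≠ 0) :
    HasDerivAt (fun t => (v t - w t) / (w t * v t)) (diffInvDeriv w v dw dv t) t := by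
  have := (hv.sub hw).div (hw.mul hv) (mul_ne_zero hw0 hv0)
  refine this.congr_deriv ?_
  simp only [diffInvDeriv, Pi.sub_apply, Pi.mul_apply]
  field_simp

lemma norm_diffInvDeriv_le (hw : SymbBound κ w dw) (hv : SymbBound κ v dv)
    (hA : SymbBound κe (fun t => v t - w t) (fun t => dv t - dw t))
    (hc : 0 < c) (ht : 0 < t) (hm : 0 < mom κ t⁻¹) (hwl : c * t ^ 2 * mom κ t⁻¹ ≤ ‖w t‖)
    (hvl : c * t ^ 2 * mom κ t⁻¹ ≤ ‖v t‖) (hθ0 : 0 ≤ θ) (hθ : mom κe t⁻¹ ≤ θ * mom κ t⁻¹) :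
    ‖diffInvDeriv w v dw dv t‖
      ≤ (4 / c ^ 2 + 64 / c ^ 3) * (θ / (t ^ 3 * mom κ t⁻¹)) := by
  have hp : 0 < c * t ^ 2 * mom κ t⁻¹ := by positivity
  have h3 : ‖v t - w t‖ ≤ 8 * t ^ 2 * (θ * mom κ t⁻¹) := (hA.norm_le t ht).trans (by gcongr)
  have h4 : ‖dv t - dw t‖ ≤ 4 * t * (θ * mom κ t⁻¹) := (hA.deriv_le t ht).trans (by gcongr)
  have h5 := hw.deriv_le t ht
  have h6 := hv.deriv_le t ht
  have e1 : ‖(dv t - dw t) / (w t * v t)‖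
      ≤ 4 * t * (θ * mom κ t⁻¹) / (c * t ^ 2 * mom κ t⁻¹) ^ 2 :=
    (norm_div_mul_le hp hwl hvl).trans (by gcongr)
  have e2 : ‖dw t / (w t * v t) / w t‖
      ≤ 4 * t * mom κ t⁻¹ / (c * t ^ 2 * mom κ t⁻¹) ^ 2 / (c * t ^ 2 * mom κ t⁻¹) := by
    rw [norm_div]
    have := (norm_div_mul_le (a := dw t) hp hwl hvl).trans
      (div_le_div_of_nonneg_right h5 (by positivity))
    gcongr
  have e3 : ‖dv t / (w t * v t) / v t‖
      ≤ 4 * t * mom κ t⁻¹ / (c * t ^ 2 * mom κ t⁻¹) ^ 2 / (c * t ^ 2 * mom κ t⁻¹) := by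
    rw [norm_div]
    have := (norm_div_mul_le (a := dv t) hp hwl hvl).trans
      (div_le_div_of_nonneg_right h6 (by positivity))
    gcongr
  calc ‖diffInvDeriv w v dw dv t‖
      ≤ ‖(dv t - dw t) / (w t * v t)‖ + ‖v t - w t‖ * (‖dw t / (w t * v t) / w t‖
        + ‖dv t / (w t * v t) / v t‖) := by
        refine (norm_sub_le _ _).trans (add_le_add le_rfl ?_)
        rw [norm_mul]
        gcongr
        exact norm_add_le _ _
    _ ≤ 4 * t * (θ * mom κ t⁻¹) / (c * t ^ 2 * mom κ t⁻¹) ^ 2 + 8 * t ^ 2 * (θ * mom κ t⁻¹) *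
        (4 * t * mom κ t⁻¹ / (c * t ^ 2 * mom κ t⁻¹) ^ 2 / (c * t ^ 2 * mom κ t⁻¹)
        + 4 * t * mom κ t⁻¹ / (c * t ^ 2 * mom κ t⁻¹) ^ 2 / (c * t ^ 2 * mom κ t⁻¹)) := by
        gcongr
    _ = _ := by field_simp; ring

end

/-! ### The Fourier integral of the difference of reciprocals -/

/-- Two symbols of size `t ^ 2 * mom κ (1 / t)` whose difference is governed by `κe`. -/
structure SymbPair (κe κ : Measure ℤ) (w v dw dv : ℝ → ℂ) (c : ℝ) : Prop where
  int_e : Integrable (fun k : ℤ => (k : ℝ)) κe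
  int : Integrable (fun k : ℤ => (k : ℝ)) κ
  left : SymbBound κ w dw
  right : SymbBound κ v dv
  diff : SymbBound κe (fun t => v t - w t) (fun t => dv t - dw t)
  c_pos : 0 < c
  mom_pos : ∀ s, 0 < s → 0 < mom κ s
  mom_top : Tendsto (mom κ) atTop atTop
  le_left : ∀ t, 0 < t → t ≤ Real.pi → c * t ^ 2 * mom κ t⁻¹ ≤ ‖w t‖
  le_right : ∀ t, 0 < t → t ≤ Real.pi → c * t ^ 2 * mom κ t⁻¹ ≤ ‖v t‖

section
variable {κe κ : Measure ℤ} [IsFiniteMeasure κe] [IsFiniteMeasure κ] {w v dw dv : ℝ → ℂ} {c : ℝ}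

namespace SymbPair

lemma left_ne (h : SymbPair κe κ w v dw dv c) {t : ℝ} (ht : 0 < t) (hπ : t ≤ Real.pi) :
    w t ≠ 0 := by
  have := h.mom_pos _ (inv_pos.2 ht)
  have hc := h.c_pos
  exact norm_pos_iff.1 (lt_of_lt_of_le (by positivity) (h.le_left t ht hπ))

lemma right_ne (h : SymbPair κe κ w v dw dv c) {t : ℝ} (ht : 0 < t) (hπ : t ≤ Real.pi) :
    v t ≠ 0 := by
  have := h.mom_pos _ (inv_pos.2 ht)
  have hc := h.c_pos
  exact norm_pos_iff.1 (lt_of_lt_of_le (by positivity) (h.le_right t ht hπ))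

lemma hasDerivAt (h : SymbPair κe κ w v dw dv c) {t : ℝ} (ht : 0 < t) (hπ : t ≤ Real.pi) :
    HasDerivAt (fun t => (v t - w t) / (w t * v t)) (diffInvDeriv w v dw dv t) t :=
  hasDerivAt_diff_inv (h.left.deriv t) (h.right.deriv t) (h.left_ne ht hπ) (h.right_ne ht hπ)

lemma continuousOn (h : SymbPair κe κ w v dw dv c) :
    ContinuousOn (fun t => (v t - w t) / (w t * v t)) (Set.Ioc 0 Real.pi) := fun _ ht =>
  (h.hasDerivAt ht.1 ht.2).continuousAt.continuousWithinAt

lemma continuousOn_deriv (h : SymbPair κe κ w v dw dv c) :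
    ContinuousOn (diffInvDeriv w v dw dv) (Set.Ioc 0 Real.pi) := by
  have hw : Continuous w := continuous_iff_continuousAt.2 fun t => (h.left.deriv t).continuousAt
  have hv : Continuous v := continuous_iff_continuousAt.2 fun t => (h.right.deriv t).continuousAt
  have h1 := h.left.cont
  have h2 := h.right.cont
  have hw0 : ∀ t ∈ Set.Ioc 0 Real.pi, w t ≠ 0 := fun t ht => h.left_ne ht.1 ht.2
  have hv0 : ∀ t ∈ Set.Ioc 0 Real.pi, v t ≠ 0 := fun t ht => h.right_ne ht.1 ht.2
  have hwv0 : ∀ t ∈ Set.Ioc 0 Real.pi, w t * v t ≠ 0 := fun t ht => mul_ne_zero (hw0 t ht) (hv0 t ht)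
  unfold diffInvDeriv
  exact ((h2.sub h1).continuousOn.div (hw.mul hv).continuousOn hwv0).sub
    ((hv.sub hw).continuousOn.mul
      (((h1.continuousOn.div (hw.mul hv).continuousOn hwv0).div hw.continuousOn hw0).add
        ((h2.continuousOn.div (hw.mul hv).continuousOn hwv0).div hv.continuousOn hv0)))

lemma continuousOn_integrand (h : SymbPair κe κ w v dw dv c) (y : ℝ) :
    ContinuousOn (fun t => ((1 - cis (t * y)) * ((v t - w t) / (w t * v t))).re)
      (Set.Ioc 0 Real.pi) :=
  Complex.continuous_re.comp_continuousOn ((continuous_const.sub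
    (continuous_cis.comp (continuous_id.mul continuous_const))).continuousOn.mul h.continuousOn)

/-- The contribution of frequencies below `1 / |y|`. -/
theorem near (h : SymbPair κe κ w v dw dv c) {θ s₀ : ℝ} (hθ : 0 ≤ θ) (hs₀ : 1 ≤ s₀)
    (hdom : ∀ s, s₀ ≤ s → mom κe s ≤ θ * mom κ s) {x y : ℝ} (hx : s₀ ≤ x) (hxy : |y| = x) :
    IntegrableOn (fun t => ((1 - cis (t * y)) * ((v t - w t) / (w t * v t))).re) (Set.Ioc 0 x⁻¹) ∧
    |∫ t in (0 : ℝ)..x⁻¹, ((1 - cis (t * y)) * ((v t - w t) / (w t * v t))).re|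
      ≤ (8 / c ^ 2 + 5 * (12 / c ^ 2 + 192 / c ^ 3)) * θ * (x / mom κ x) := by
  have hs0 : 0 < s₀ := by linarith
  have hx0 : 0 < x := by linarith
  have hc := h.c_pos
  have hmx := h.mom_pos x hx0
  have hxπ : x⁻¹ ≤ Real.pi := (inv_le_one_of_one_le₀ (hs₀.trans hx)).trans
    (by linarith [Real.pi_gt_three])
  set K := 12 / c ^ 2 + 192 / c ^ 3 with hK
  -- The linear term dominates the product of 1 - cos with the modulus, and the term in `tailAnti`
  -- the product of the first-order factor with the imaginary part.
  set G : ℝ → ℝ := fun t => 8 / c ^ 2 * x ^ 2 * (θ / mom κ x) * t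
    + x * K * -tailAnti κe κ θ t⁻¹ with hG
  have hGc : ContinuousOn G (Set.Icc 0 x⁻¹) :=
    (continuous_const.mul continuous_id).continuousOn.add (continuousOn_const.mul
      (continuousOn_tailAnti_inv h.int_e h.int h.mom_pos h.mom_top hθ hs0 hdom _))
  have hGd : ∀ t ∈ Set.Ioo 0 x⁻¹, HasDerivAt G (8 / c ^ 2 * x ^ 2 * (θ / mom κ x)
      + x * K * (tailAntiDeriv κe κ θ t⁻¹ / t ^ 2)) t := fun t ht => by
    have hi : 0 < t⁻¹ := inv_pos.2 ht.1
    have h1 := (hasDerivAt_comp_inv ht.1 (hasDerivAt_tailAnti h.int_e h.int θ hi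
      (h.mom_pos _ hi))).const_mul (x * K)
    have h2 := (hasDerivAt_id t).const_mul (8 / c ^ 2 * x ^ 2 * (θ / mom κ x))
    rw [mul_one] at h2
    exact h2.add h1
  have hf : ∀ t ∈ Set.Ioo 0 x⁻¹,
      |((1 - cis (t * y)) * ((v t - w t) / (w t * v t))).re| ≤ 8 / c ^ 2 * x ^ 2 * (θ / mom κ x)
      + x * K * (tailAntiDeriv κe κ θ t⁻¹ / t ^ 2) := fun t ht => by
    have ht0 := ht.1
    have hi : 0 < t⁻¹ := inv_pos.2 ht0
    have hmt := h.mom_pos _ hi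
    have htπ : t ≤ Real.pi := ht.2.le.trans hxπ
    have hxt : x ≤ t⁻¹ := (le_inv_comm₀ hx0 ht0).2 ht.2.le
    have hd := hdom _ (hx.trans hxt)
    have e1 := norm_diff_inv_le h.diff hc ht0 hmt (h.le_left t ht0 htπ) (h.le_right t ht0 htπ) hd
    have e2 := abs_im_diff_inv_le h.left h.right h.diff hc ht0 hmt (h.le_left t ht0 htπ)
      (h.le_right t ht0 htπ) hθ hd
    have e3 := tailAntiDeriv_ge (κe := κe) (κ := κ) hθ hi hmt hd
    have e4 : (cub κe t⁻¹ + θ * cub κ t⁻¹) / mom κ t⁻¹ ^ 2 ≤ tailAntiDeriv κe κ θ t⁻¹ / t ^ 2 := by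
      rw [le_div_iff₀ (by positivity)]
      refine le_trans (le_of_eq ?_) e3
      field_simp
    set E := (v t - w t) / (w t * v t)
    have hn : ‖1 - cis (t * y)‖ ≤ t * x := by
      refine (norm_one_sub_cis_le _).trans_eq ?_
      rw [abs_mul, abs_of_pos ht0, hxy]
    have hr : |(1 - cis (t * y)).re| ≤ (t * x) ^ 2 := by
      rw [Complex.sub_re, Complex.one_re, cis_re,
        abs_of_nonneg (sub_nonneg.2 (Real.cos_le_one _)), ← hxy]
      refine (one_sub_cos_le _).trans ?_
      rw [mul_pow, mul_pow, sq_abs]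
      nlinarith [mul_nonneg (sq_nonneg t) (sq_nonneg y)]
    -- The crude bound tx times the modulus is of order xθ/(t m(1/t)), which need not be integrable
    -- at 0. Hence the first-order factor is paired with the imaginary part only.
    refine (abs_re_mul_le _ _).trans (add_le_add ?_ ?_)
    · calc |(1 - cis (t * y)).re| * ‖E‖
          ≤ (t * x) ^ 2 * (8 / c ^ 2 * (θ / (t ^ 2 * mom κ t⁻¹))) := by gcongr
        _ = 8 / c ^ 2 * x ^ 2 * (θ / mom κ t⁻¹) := by field_simp
        _ ≤ _ := by
          gcongr
          exact mom_mono h.int hxt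
    · calc ‖1 - cis (t * y)‖ * |E.im| ≤ t * x * |E.im| := by gcongr
        _ = x * (t * |E.im|) := by ring
        _ ≤ x * (K * (tailAntiDeriv κe κ θ t⁻¹ / t ^ 2)) := by
          have := e2.trans (mul_le_mul_of_nonneg_left e4 (by positivity))
          gcongr
        _ = _ := by ring
  refine ⟨integrableOn_of_deriv_bound hGc hGd hf (ContinuousOn.aestronglyMeasurable
    ((h.continuousOn_integrand y).mono (Set.Ioc_subset_Ioc_right hxπ)) measurableSet_Ioc), ?_⟩
  refine (norm_integral_le_sub
    (f := fun t => ((1 - cis (t * y)) * ((v t - w t) / (w t * v t))).re)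
    (inv_nonneg.2 hx0.le) hGc hGd hf).trans ?_
  have h0 : G 0 = 0 := by simp [hG, tailAnti, mom, cub]
  have h1 := (neg_tailAnti_le h.int_e h.int hθ hx0 hmx (hdom x hx)).2
  rw [h0, sub_zero]
  simp only [hG, inv_inv]
  calc 8 / c ^ 2 * x ^ 2 * (θ / mom κ x) * x⁻¹ + x * K * -tailAnti κe κ θ x
      ≤ 8 / c ^ 2 * x ^ 2 * (θ / mom κ x) * x⁻¹ + x * K * (5 * θ / mom κ x) := by gcongr
    _ = _ := by field_simp

/-- The contribution of intermediate frequencies: the part without oscillation. -/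
theorem middle_re (h : SymbPair κe κ w v dw dv c) {θ s₀ : ℝ} (hθ : 0 ≤ θ) (hs₀ : 1 ≤ s₀)
    (hdom : ∀ s, s₀ ≤ s → mom κe s ≤ θ * mom κ s) {x : ℝ} (hx : s₀ ≤ x) :
    |∫ t in x⁻¹..s₀⁻¹, ((v t - w t) / (w t * v t)).re|
      ≤ 4 * (4 / c ^ 2 + 64 / c ^ 3) * θ * (x / mom κ x) := by
  have hs0 : 0 < s₀ := by linarith
  have hx0 : 0 < x := by linarith
  have hc := h.c_pos
  have hsπ : s₀⁻¹ ≤ Real.pi := (inv_le_one_of_one_le₀ hs₀).trans (by linarith [Real.pi_gt_three])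
  have hd : ∀ t, 0 < t → HasDerivAt
      (fun t => (4 / c ^ 2 + 64 / c ^ 3) * -midAnti κe κ θ t⁻¹)
      ((4 / c ^ 2 + 64 / c ^ 3) * (midAntiDeriv κe κ θ t⁻¹ / t ^ 2)) t := fun t ht =>
    (hasDerivAt_comp_inv ht (hasDerivAt_midAnti h.int_e h.int θ
      (h.mom_pos _ (inv_pos.2 ht)))).const_mul _
  -- The modulus alone would give θ ∫ ds/m(s), which can exceed the order of x/m(x) when m is nearly
  -- linear; the bound by `mom - s * eta` integrates exactly.
  refine (norm_integral_le_sub (f := fun t => ((v t - w t) / (w t * v t)).re)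
    (inv_anti₀ hs0 hx) (fun t ht =>
    (hd t ((inv_pos.2 hx0).trans_le ht.1)).continuousAt.continuousWithinAt)
    (fun t ht => hd t ((inv_pos.2 hx0).trans ht.1)) fun t ht => ?_).trans ?_
  · have ht0 := (inv_pos.2 hx0).trans ht.1
    have hi := inv_pos.2 ht0
    have hmt := h.mom_pos _ hi
    have htπ : t ≤ Real.pi := ht.2.le.trans hsπ
    have hst : s₀ ≤ t⁻¹ := (le_inv_comm₀ hs0 ht0).2 ht.2.le
    refine (abs_re_diff_inv_le h.int_e h.int h.left h.right h.diff hc ht0 hmt (h.le_left t ht0 htπ)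
      (h.le_right t ht0 htπ) hθ (hdom _ hst)).trans ?_
    have := midAntiDeriv_ge (κe := κe) h.int hi hmt (hdom _ hst)
    gcongr
  · have := midAnti_sub_le (κe := κe) h.int h.mom_pos hθ hs0 hx (hdom s₀ le_rfl)
    simp only [inv_inv]
    calc _ = (4 / c ^ 2 + 64 / c ^ 3) * (midAnti κe κ θ x - midAnti κe κ θ s₀) := by ring
      _ ≤ (4 / c ^ 2 + 64 / c ^ 3) * (4 * θ * (x / mom κ x)) := by gcongr
      _ = _ := by ring

/-- The contribution of intermediate frequencies: the oscillating part. -/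
theorem middle_osc (h : SymbPair κe κ w v dw dv c) {θ s₀ : ℝ} (hθ : 0 ≤ θ) (hs₀ : 1 ≤ s₀)
    (hdom : ∀ s, s₀ ≤ s → mom κe s ≤ θ * mom κ s) {x y : ℝ} (hx : s₀ ≤ x) (hxy : |y| = x) :
    ‖∫ t in x⁻¹..s₀⁻¹, cis (t * y) * ((v t - w t) / (w t * v t))‖
      ≤ (2 * (8 / c ^ 2) + (4 / c ^ 2 + 64 / c ^ 3)) * θ * (x / mom κ x) := by
  have hs0 : 0 < s₀ := by linarith
  have hx0 : 0 < x := by linarith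
  have hc := h.c_pos
  have hmx := h.mom_pos x hx0
  have hms := h.mom_pos s₀ hs0
  have hy0 : y ≠ 0 := by rintro rfl; simp at hxy; linarith
  have hyI : (y * Complex.I : ℂ) ≠ 0 := by simp [hy0]
  have hnI : ‖(y * Complex.I : ℂ)‖ = x := by simp [hxy]
  have hsπ : s₀⁻¹ ≤ Real.pi := (inv_le_one_of_one_le₀ hs₀).trans (by linarith [Real.pi_gt_three])
  have hle : x⁻¹ ≤ s₀⁻¹ := inv_anti₀ hs0 hx
  have hix : 0 < x⁻¹ := inv_pos.2 hx0
  have hsub : Set.uIcc x⁻¹ s₀⁻¹ ⊆ Set.Ioc 0 Real.pi := by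
    rw [Set.uIcc_of_le hle]
    exact fun t ht => ⟨hix.trans_le ht.1, ht.2.trans hsπ⟩
  set E : ℝ → ℂ := fun t => (v t - w t) / (w t * v t) with hE
  set dE : ℝ → ℂ := diffInvDeriv w v dw dv with hdE
  have hcis : Continuous fun t : ℝ => cis (t * y) :=
    continuous_cis.comp (continuous_id.mul continuous_const)
  have hi1 : IntervalIntegrable (fun t => cis (t * y) * E t) volume x⁻¹ s₀⁻¹ :=
    (hcis.continuousOn.mul (h.continuousOn.mono hsub)).intervalIntegrable
  have hi2 : IntervalIntegrable (fun t => cis (t * y) * dE t / (y * Complex.I)) volume x⁻¹ s₀⁻¹ :=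
    ((hcis.continuousOn.mul (h.continuousOn_deriv.mono hsub)).div_const _).intervalIntegrable
  -- Integration by parts gains a factor 1/x from the oscillation, at the cost of boundary values
  -- and the derivative of the reciprocal difference.
  have hd : ∀ t ∈ Set.uIcc x⁻¹ s₀⁻¹, HasDerivAt (fun t => cis (t * y) * E t / (y * Complex.I))
      (cis (t * y) * E t + cis (t * y) * dE t / (y * Complex.I)) t := fun t ht => by
    have h1 := ((hasDerivAt_cis y t).mul (h.hasDerivAt (hsub ht).1 (hsub ht).2)).div_const
      (y * Complex.I)
    refine h1.congr_deriv ?_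
    rw [add_div]
    congr 1
    rw [mul_assoc, mul_div_cancel_left₀ _ hyI]
  have hibp := intervalIntegral.integral_eq_sub_of_hasDerivAt hd (hi1.add hi2)
  rw [intervalIntegral.integral_add hi1 hi2] at hibp
  have hEle : ∀ t ∈ Set.Icc x⁻¹ s₀⁻¹, ‖E t‖ ≤ 8 / c ^ 2 * θ * (x * (x / mom κ x)) := by
    intro t ht
    have ht0 := hix.trans_le ht.1
    have hi := inv_pos.2 ht0
    have hmt := h.mom_pos _ hi
    have htπ : t ≤ Real.pi := ht.2.trans hsπ
    have hst : s₀ ≤ t⁻¹ := (le_inv_comm₀ hs0 ht0).2 ht.2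
    have htx : t⁻¹ ≤ x := inv_le_of_inv_le₀ hx0 ht.1
    refine (norm_diff_inv_le h.diff hc ht0 hmt (h.le_left t ht0 htπ) (h.le_right t ht0 htπ)
      (hdom _ hst)).trans ?_
    have e1 := div_mom_mono h.int h.mom_pos hi htx
    calc 8 / c ^ 2 * (θ / (t ^ 2 * mom κ t⁻¹))
        = 8 / c ^ 2 * θ * (t⁻¹ * (t⁻¹ / mom κ t⁻¹)) := by field_simp
      _ ≤ _ := by gcongr
  have hdEle : ‖∫ t in x⁻¹..s₀⁻¹, cis (t * y) * dE t / (y * Complex.I)‖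
      ≤ (4 / c ^ 2 + 64 / c ^ 3) * θ * (x / mom κ x) := by
    -- Monotonicity of s/m(s) lets x/m(x) be taken out of the integral, leaving t⁻², whose integral
    -- over this range is at most x.
    set B := (4 / c ^ 2 + 64 / c ^ 3) * θ * (x / mom κ x) / x with hB
    have hB0 : 0 ≤ B := by positivity
    have hd : ∀ t, 0 < t → HasDerivAt (fun t : ℝ => B * -t⁻¹) (B * (t ^ 2)⁻¹) t := fun t ht => by
      have := (hasDerivAt_inv ht.ne').neg.const_mul B
      rwa [neg_neg] at this
    refine (norm_integral_le_sub hle (fun t ht =>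
      (hd t (hix.trans_le ht.1)).continuousAt.continuousWithinAt)
      (fun t ht => hd t (hix.trans ht.1)) fun t ht => ?_).trans ?_
    · have ht0 := hix.trans ht.1
      have hi := inv_pos.2 ht0
      have hmt := h.mom_pos _ hi
      have htπ : t ≤ Real.pi := ht.2.le.trans hsπ
      have hst : s₀ ≤ t⁻¹ := (le_inv_comm₀ hs0 ht0).2 ht.2.le
      have htx : t⁻¹ ≤ x := inv_le_of_inv_le₀ hx0 ht.1.le
      have e1 := div_mom_mono h.int h.mom_pos hi htx
      have e2 := norm_diffInvDeriv_le h.left h.right h.diff hc ht0 hmt (h.le_left t ht0 htπ)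
        (h.le_right t ht0 htπ) hθ (hdom _ hst)
      rw [norm_div, norm_mul, norm_cis, one_mul, hnI, hB, div_mul_eq_mul_div]
      gcongr
      refine e2.trans ?_
      calc (4 / c ^ 2 + 64 / c ^ 3) * (θ / (t ^ 3 * mom κ t⁻¹))
          = (4 / c ^ 2 + 64 / c ^ 3) * θ * (t⁻¹ / mom κ t⁻¹) * (t ^ 2)⁻¹ := by field_simp
        _ ≤ _ := by gcongr
    · rw [inv_inv, inv_inv]
      calc B * -s₀ - B * -x = B * x - B * s₀ := by ring
        _ ≤ B * x := by
          have : 0 ≤ B * s₀ := by positivity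
          linarith
        _ = _ := by rw [hB]; field_simp
  have hb : ∀ t ∈ Set.Icc x⁻¹ s₀⁻¹, ‖cis (t * y) * E t / (y * Complex.I)‖
      ≤ 8 / c ^ 2 * θ * (x / mom κ x) := fun t ht => by
    rw [norm_div, norm_mul, norm_cis, one_mul, hnI, div_le_iff₀ hx0]
    refine (hEle t ht).trans_eq (by ring)
  have hfin : ∫ t in x⁻¹..s₀⁻¹, cis (t * y) * E t
      = cis (s₀⁻¹ * y) * E s₀⁻¹ / (y * Complex.I) - cis (x⁻¹ * y) * E x⁻¹ / (y * Complex.I)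
        - ∫ t in x⁻¹..s₀⁻¹, cis (t * y) * dE t / (y * Complex.I) := by
    rw [← hibp]; ring
  rw [hfin]
  refine (norm_sub_le _ _).trans ?_
  have h1 := norm_sub_le (cis (s₀⁻¹ * y) * E s₀⁻¹ / (y * Complex.I))
    (cis (x⁻¹ * y) * E x⁻¹ / (y * Complex.I))
  have h2 := hb s₀⁻¹ ⟨hle, le_rfl⟩
  have h3 := hb x⁻¹ ⟨le_rfl, hle⟩
  calc _ ≤ 8 / c ^ 2 * θ * (x / mom κ x) + 8 / c ^ 2 * θ * (x / mom κ x)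
        + (4 / c ^ 2 + 64 / c ^ 3) * θ * (x / mom κ x) := by
        gcongr
        exact h1.trans (add_le_add h2 h3)
    _ = _ := by ring

/-- The Fourier integral of the difference of the reciprocals is `o(x / mom κ x)`. -/
theorem exists_integral_le (h : SymbPair κe κ w v dw dv c)
    (hdom : ∀ θ : ℝ, 0 < θ → ∃ s₀, ∀ s, s₀ ≤ s → mom κe s ≤ θ * mom κ s) {δ : ℝ} (hδ : 0 < δ) :
    ∃ s₀ C : ℝ, ∀ x y : ℝ, s₀ ≤ x → |y| = x →
      |∫ t in (0 : ℝ)..Real.pi, ((1 - cis (t * y)) * ((v t - w t) / (w t * v t))).re|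
        ≤ δ * (x / mom κ x) + C := by
  have hc := h.c_pos
  -- K adds the constants of the three estimates, so θ = δ/K gives a total of δ x/m(x). Frequencies
  -- above 1/s₀ contribute a constant by continuity.
  set K := (8 / c ^ 2 + 5 * (12 / c ^ 2 + 192 / c ^ 3)) + 4 * (4 / c ^ 2 + 64 / c ^ 3)
    + (2 * (8 / c ^ 2) + (4 / c ^ 2 + 64 / c ^ 3)) with hK
  have hK0 : 0 < K := by positivity
  obtain ⟨s₁, hs₁⟩ := hdom (δ / K) (by positivity)
  set s₀ := max s₁ 1 with hs₀
  have hs1 : 1 ≤ s₀ := le_max_right _ _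
  have hs0 : 0 < s₀ := by linarith
  have hdom' : ∀ s, s₀ ≤ s → mom κe s ≤ δ / K * mom κ s := fun s hs =>
    hs₁ s ((le_max_left _ _).trans hs)
  have hsπ : s₀⁻¹ ≤ Real.pi := (inv_le_one_of_one_le₀ hs1).trans (by linarith [Real.pi_gt_three])
  have his : 0 < s₀⁻¹ := inv_pos.2 hs0
  obtain ⟨B, hB⟩ := (isCompact_Icc (a := s₀⁻¹) (b := Real.pi)).exists_bound_of_continuousOn
    (h.continuousOn.mono fun t ht => ⟨his.trans_le ht.1, ht.2⟩)
  refine ⟨s₀, 2 * B * |Real.pi - s₀⁻¹|, fun x y hx hxy => ?_⟩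
  have hx0 : 0 < x := by linarith
  have hix : 0 < x⁻¹ := inv_pos.2 hx0
  have hle : x⁻¹ ≤ s₀⁻¹ := inv_anti₀ hs0 hx
  have hθ : 0 ≤ δ / K := by positivity
  obtain ⟨i1, n1⟩ := h.near hθ hs1 hdom' hx hxy
  have n2 := h.middle_re hθ hs1 hdom' hx
  have n3 := h.middle_osc hθ hs1 hdom' hx hxy
  set E : ℝ → ℂ := fun t => (v t - w t) / (w t * v t) with hE
  set f : ℝ → ℝ := fun t => ((1 - cis (t * y)) * E t).re with hf
  have hfc : ContinuousOn f (Set.Ioc 0 Real.pi) := h.continuousOn_integrand y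
  have j1 : IntervalIntegrable f volume 0 x⁻¹ :=
    (intervalIntegrable_iff_integrableOn_Ioc_of_le hix.le).2 i1
  have hsub2 : Set.uIcc x⁻¹ s₀⁻¹ ⊆ Set.Ioc 0 Real.pi := by
    rw [Set.uIcc_of_le hle]; exact fun t ht => ⟨hix.trans_le ht.1, ht.2.trans hsπ⟩
  have hsub3 : Set.uIcc s₀⁻¹ Real.pi ⊆ Set.Ioc 0 Real.pi := by
    rw [Set.uIcc_of_le hsπ]; exact fun t ht => ⟨his.trans_le ht.1, ht.2⟩
  have j2 : IntervalIntegrable f volume x⁻¹ s₀⁻¹ := (hfc.mono hsub2).intervalIntegrable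
  have j3 : IntervalIntegrable f volume s₀⁻¹ Real.pi := (hfc.mono hsub3).intervalIntegrable
  have hcis : Continuous fun t : ℝ => cis (t * y) :=
    continuous_cis.comp (continuous_id.mul continuous_const)
  have k1 : IntervalIntegrable E volume x⁻¹ s₀⁻¹ := (h.continuousOn.mono hsub2).intervalIntegrable
  have k2 : IntervalIntegrable (fun t => cis (t * y) * E t) volume x⁻¹ s₀⁻¹ :=
    (hcis.continuousOn.mul (h.continuousOn.mono hsub2)).intervalIntegrable
  have e2 : ∫ t in x⁻¹..s₀⁻¹, f t = (∫ t in x⁻¹..s₀⁻¹, (E t).re)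
      - (∫ t in x⁻¹..s₀⁻¹, cis (t * y) * E t).re := by
    have r1 : (∫ t in x⁻¹..s₀⁻¹, cis (t * y) * E t).re
        = ∫ t in x⁻¹..s₀⁻¹, (cis (t * y) * E t).re :=
      (Complex.reCLM.intervalIntegral_comp_comm k2).symm
    have k1' : IntervalIntegrable (fun t => (E t).re) volume x⁻¹ s₀⁻¹ :=
      (Complex.continuous_re.comp_continuousOn (h.continuousOn.mono hsub2)).intervalIntegrable
    have k2' : IntervalIntegrable (fun t => (cis (t * y) * E t).re) volume x⁻¹ s₀⁻¹ :=
      (Complex.continuous_re.comp_continuousOn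
        (hcis.continuousOn.mul (h.continuousOn.mono hsub2))).intervalIntegrable
    rw [r1, ← intervalIntegral.integral_sub k1' k2']
    refine intervalIntegral.integral_congr fun t _ => ?_
    simp only [hf, sub_mul, one_mul, Complex.sub_re]
  have n4 : |∫ t in s₀⁻¹..Real.pi, f t| ≤ 2 * B * |Real.pi - s₀⁻¹| := by
    refine intervalIntegral.norm_integral_le_of_norm_le_const (f := f) fun t ht => ?_
    rw [Set.uIoc_of_le hsπ] at ht
    refine (Complex.abs_re_le_norm _).trans ?_
    rw [norm_mul]
    exact mul_le_mul (norm_one_sub_cis_le_two _) (hB t ⟨ht.1.le, ht.2⟩) (norm_nonneg _) zero_le_two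
  rw [← intervalIntegral.integral_add_adjacent_intervals (j1.trans j2) j3,
    ← intervalIntegral.integral_add_adjacent_intervals j1 j2, e2]
  have n3' := (Complex.abs_re_le_norm _).trans n3
  have hsum : δ * (x / mom κ x) = (8 / c ^ 2 + 5 * (12 / c ^ 2 + 192 / c ^ 3)) * (δ / K)
      * (x / mom κ x) + 4 * (4 / c ^ 2 + 64 / c ^ 3) * (δ / K) * (x / mom κ x)
      + (2 * (8 / c ^ 2) + (4 / c ^ 2 + 64 / c ^ 3)) * (δ / K) * (x / mom κ x) := by
    rw [← add_mul, ← add_mul, ← add_mul, ← add_mul, ← hK, mul_div_cancel₀ _ hK0.ne']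
  rw [hsum]
  have t1 := abs_add_le ((∫ t in (0 : ℝ)..x⁻¹, f t) + ((∫ t in x⁻¹..s₀⁻¹, (E t).re)
      - (∫ t in x⁻¹..s₀⁻¹, cis (t * y) * E t).re)) (∫ t in s₀⁻¹..Real.pi, f t)
  have t2 := abs_add_le (∫ t in (0 : ℝ)..x⁻¹, f t) ((∫ t in x⁻¹..s₀⁻¹, (E t).re)
      - (∫ t in x⁻¹..s₀⁻¹, cis (t * y) * E t).re)
  have t3 := abs_sub (∫ t in x⁻¹..s₀⁻¹, (E t).re) (∫ t in x⁻¹..s₀⁻¹, cis (t * y) * E t).re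
  linarith

end SymbPair
end

/-! ### Negligible right tail: the potential on the negative half-line -/

section
variable {ν : Measure ℤ} [IsProbabilityMeasure ν]

lemma intervalIntegrable_pot_integrand (hν : CenteredLaw ν)
    (hI : IntegrableOn (fun t : ℝ => t * |(chf ν t).im| / ‖1 - chf ν t‖ ^ 2)
      (Set.Ioc 0 Real.pi)) (x : ℤ) :
    IntervalIntegrable (fun t : ℝ => ((1 - cis (t * x)) / (1 - chf ν t)).re) volume 0
      Real.pi := by
  have hb := (intervalIntegrable_fourierBound hν x).1
  rw [intervalIntegrable_iff_integrableOn_Ioc_of_le Real.pi_pos.le]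
  refine (hb.add (hI.const_mul |(x : ℝ)|)).mono' (Measurable.aestronglyMeasurable ?_) ?_
  · exact Complex.measurable_re.comp ((continuous_const.sub (continuous_cis.comp
      (continuous_id.mul continuous_const))).measurable.div
      (continuous_const.sub continuous_chf).measurable)
  · refine (ae_restrict_mem measurableSet_Ioc).mono fun t ht => ?_
    refine (abs_re_div_le _ _).trans (add_le_add le_rfl ?_)
    simp only
    rw [Complex.sub_im, Complex.one_im, zero_sub, abs_neg, ← mul_div_assoc]
    have hsin : |Real.sin (t * x)| ≤ |(x : ℝ)| * t := by
      refine Real.abs_sin_le_abs.trans ?_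
      rw [abs_mul, abs_of_pos ht.1, mul_comm]
    rw [← mul_assoc]
    gcongr

lemma integrableOn_im_div {κ : Measure ℤ} [IsFiniteMeasure κ] {w dw : ℝ → ℂ} {c : ℝ}
    (hκ : Integrable (fun k : ℤ => (k : ℝ)) κ) (hw : SymbBound κ w dw)
    (hpos : ∀ s, 0 < s → 0 < mom κ s) (htop : Tendsto (mom κ) atTop atTop) (hc : 0 < c)
    (hle : ∀ t, 0 < t → t ≤ Real.pi → c * t ^ 2 * mom κ t⁻¹ ≤ ‖w t‖) :
    IntegrableOn (fun t : ℝ => t * |(w t).im| / ‖w t‖ ^ 2) (Set.Ioc 0 Real.pi) := by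
  have hwc : Continuous w := continuous_iff_continuousAt.2 fun t => (hw.deriv t).continuousAt
  refine integrableOn_of_le_cub_div hκ hpos htop (C := 12 / c ^ 2) (by positivity)
    (Measurable.aestronglyMeasurable ?_) fun t ht htπ => ?_
  · exact (measurable_id.mul (Complex.continuous_im.comp hwc).abs.measurable).div
      (hwc.norm.pow 2).measurable
  · have hm := hpos _ (inv_pos.2 ht)
    rw [abs_of_nonneg (by positivity)]
    calc t * |(w t).im| / ‖w t‖ ^ 2
        ≤ t * (12 * t ^ 3 * cub κ t⁻¹) / (c * t ^ 2 * mom κ t⁻¹) ^ 2 := by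
          have h1 := hw.im_le t ht
          have h2 := hle t ht htπ
          have h3 := cub_nonneg (κ := κ) (inv_nonneg.2 ht.le)
          gcongr
      _ = _ := by field_simp

/-- The bound near 0 is given; on the remaining compact interval w is bounded away from 0 and the
moment is bounded. -/
lemma exists_mul_mom_le_norm {κ : Measure ℤ} [IsFiniteMeasure κ] {w : ℝ → ℂ}
    (hκ : Integrable (fun k : ℤ => (k : ℝ)) κ) (hw : Continuous w)
    (hpos : ∀ s, 0 < s → 0 < mom κ s) (hne : ∀ t, 0 < t → t ≤ Real.pi → w t ≠ 0) {t₀ c : ℝ}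
    (ht₀ : 0 < t₀) (hc : 0 < c)
    (hle : ∀ t, 0 < t → t ≤ t₀ → c * t ^ 2 * mom κ t⁻¹ ≤ ‖w t‖) :
    ∃ c' > 0, c' ≤ c ∧ ∀ t, 0 < t → t ≤ Real.pi → c' * t ^ 2 * mom κ t⁻¹ ≤ ‖w t‖ := by
  by_cases hπ : Real.pi ≤ t₀
  · exact ⟨c, hc, le_rfl, fun t h0 h1 => hle t h0 (h1.trans hπ)⟩
  obtain ⟨t1, ht1, hmin⟩ := (isCompact_Icc (a := t₀) (b := Real.pi)).exists_isMinOn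
    ⟨t₀, le_rfl, (not_le.1 hπ).le⟩ hw.norm.continuousOn
  have h1 : 0 < ‖w t1‖ := norm_pos_iff.2 (hne t1 (ht₀.trans_le ht1.1) ht1.2)
  have hm := hpos _ (inv_pos.2 ht₀)
  have hπ0 := Real.pi_pos
  refine ⟨min c (‖w t1‖ / (Real.pi ^ 2 * mom κ t₀⁻¹)), by positivity, min_le_left _ _,
    fun t h0 hπ => ?_⟩
  have hmt := hpos _ (inv_pos.2 h0)
  rcases le_total t t₀ with htd | htd
  · refine le_trans ?_ (hle t h0 htd)
    gcongr; exact min_le_left _ _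
  · refine le_trans ?_ (hmin ⟨htd, hπ⟩ : ‖w t1‖ ≤ _)
    calc min c (‖w t1‖ / (Real.pi ^ 2 * mom κ t₀⁻¹)) * t ^ 2 * mom κ t⁻¹
        ≤ ‖w t1‖ / (Real.pi ^ 2 * mom κ t₀⁻¹) * Real.pi ^ 2 * mom κ t₀⁻¹ := by
          gcongr
          · exact min_le_right _ _
          · exact mom_mono hκ (inv_anti₀ ht₀ htd)
      _ = ‖w t1‖ := by rw [mul_assoc, div_mul_cancel₀ _ (by positivity)]

lemma tendsto_mom (hν : CenteredLaw ν) : Tendsto (mom ν) atTop atTop := by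
  refine tendsto_atTop.2 fun b => ?_
  obtain ⟨n, hn⟩ := exists_truncated_variance_ge hν (2 * b)
  filter_upwards [eventually_ge_atTop (n : ℝ)] with s hs
  refine le_trans ?_ (mom_mono hν.integrable hs)
  have hn0 : (0 : ℝ) ≤ n := Nat.cast_nonneg n
  rw [mom_eq hν.integrable hn0]
  have h1 : ∫ k in Set.Icc (-n : ℤ) n, (k : ℝ) ^ 2 ∂ν
      = ∫ k in Set.Icc (-n : ℤ) n, 2 * quadCap |(k : ℝ)| n ∂ν := by
    refine setIntegral_congr_fun measurableSet_Icc fun k hk => ?_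
    have : |(k : ℝ)| ≤ n := by
      rw [abs_le]; exact ⟨by exact_mod_cast hk.1, by exact_mod_cast hk.2⟩
    simp only [quadCap, if_pos this, sq_abs]; ring
  have h2 : ∫ k in Set.Icc (-n : ℤ) n, quadCap |(k : ℝ)| n ∂ν ≤ ∫ k : ℤ, quadCap |(k : ℝ)| n ∂ν :=
    setIntegral_le_integral (integrable_quadCap hν.integrable hn0)
      (ae_of_all _ fun k => quadCap_nonneg hn0)
  rw [h1, integral_const_mul] at hn
  linarith

lemma mom_unitAtom {s : ℝ} (hs : 0 ≤ s) : mom (unitAtom ν) s = negMean ν * quadCap 1 s := by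
  rw [mom_eq integrable_unitAtom hs, unitAtom, integral_smul_measure, integral_dirac,
    ENNReal.toReal_ofReal negMean_nonneg]
  simp

/-- The part of the comparison measure that is negligible when the right tail is. -/
def errMeas (ν : Measure ℤ) : Measure ℤ := posPart ν + unitAtom ν

/-- A measure dominating both `ν` and the comparison law outside `0`. -/
def totMeas (ν : Measure ℤ) : Measure ℤ := negPart ν + errMeas ν

instance : IsFiniteMeasure (errMeas ν) := by unfold errMeas; infer_instance
instance : IsFiniteMeasure (totMeas ν) := by unfold totMeas; infer_instance

lemma integrable_errMeas (hν : CenteredLaw ν) : Integrable (fun k : ℤ => (k : ℝ)) (errMeas ν) :=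
  (integrable_posPart_law hν).add_measure integrable_unitAtom

lemma integrable_totMeas (hν : CenteredLaw ν) : Integrable (fun k : ℤ => (k : ℝ)) (totMeas ν) :=
  (integrable_negPart hν).add_measure (integrable_errMeas hν)

lemma mom_errMeas (hν : CenteredLaw ν) (s : ℝ) :
    mom (errMeas ν) s = mom (posPart ν) s + mom (unitAtom ν) s :=
  mom_add (integrable_posPart_law hν) integrable_unitAtom s

lemma mom_totMeas (hν : CenteredLaw ν) (s : ℝ) :
    mom (totMeas ν) s = mom (negPart ν) s + mom (errMeas ν) s :=
  mom_add (integrable_negPart hν) (integrable_errMeas hν) s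

lemma mom_totMeas' (hν : CenteredLaw ν) {s : ℝ} (hs : 0 ≤ s) :
    mom (totMeas ν) s = mom ν s + negMean ν * quadCap 1 s := by
  rw [mom_totMeas hν, mom_errMeas hν, mom_eq_add hν hs, mom_unitAtom hs]; ring

lemma mom_totMeas_pos (hν : CenteredLaw ν) {s : ℝ} (hs : 0 < s) : 0 < mom (totMeas ν) s := by
  rw [mom_totMeas' hν hs.le]
  have h1 : 0 < quadCap 1 s := by
    rw [quadCap]; split_ifs with h
    · norm_num
    · nlinarith [not_le.1 h]
  have := mom_nonneg (κ := ν) hs.le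
  have := negMean_pos hν
  positivity

lemma mom_le_mom_totMeas (hν : CenteredLaw ν) {s : ℝ} (hs : 0 ≤ s) :
    mom ν s ≤ mom (totMeas ν) s := by
  rw [mom_totMeas' hν hs]
  exact le_add_of_nonneg_right (mul_nonneg negMean_nonneg (quadCap_nonneg hs))

lemma tendsto_mom_totMeas (hν : CenteredLaw ν) : Tendsto (mom (totMeas ν)) atTop atTop :=
  tendsto_atTop_mono' _ ((eventually_ge_atTop 0).mono fun _ hs => mom_le_mom_totMeas hν hs)
    (tendsto_mom hν)

/-- The atom at 1 adds only a bounded moment, which is negligible since the moment of `ν` tends to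
infinity. -/
lemma mom_errMeas_le (hν : CenteredLaw ν)
    (hR : ∀ θ : ℝ, 0 < θ → ∀ᶠ s in atTop, mom (posPart ν) s ≤ θ * mom ν s) {θ : ℝ} (hθ : 0 < θ) :
    ∃ s₀, ∀ s, s₀ ≤ s → mom (errMeas ν) s ≤ θ * mom (totMeas ν) s := by
  refine eventually_atTop.1 ?_
  filter_upwards [hR (θ / 2) (half_pos hθ), eventually_ge_atTop 0,
    (tendsto_mom hν).eventually_ge_atTop (negMean ν / θ)] with s h1 hs h2
  have h3 : quadCap 1 s ≤ 1 / 2 := quadCap_le_sq.trans (by norm_num)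
  have h4 := mom_le_mom_totMeas hν hs
  rw [div_le_iff₀ hθ] at h2
  rw [mom_errMeas hν, mom_unitAtom hs]
  nlinarith [mul_le_mul_of_nonneg_left h3 (negMean_nonneg (ν := ν)),
    mul_le_mul_of_nonneg_left h4 hθ.le]

/-- If the negative part had finite variance its moment would be bounded, and with m_+ ≤ m/2 so
would be m. -/
lemma lintegral_sq_negPart (hν : CenteredLaw ν)
    (hR : ∀ θ : ℝ, 0 < θ → ∀ᶠ s in atTop, mom (posPart ν) s ≤ θ * mom ν s) :
    ∫⁻ k, ENNReal.ofReal ((k : ℝ) ^ 2) ∂(negPart ν) = ⊤ := by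
  by_contra hcon
  have hi : Integrable (fun k : ℤ => (k : ℝ) ^ 2) (negPart ν) := by
    refine ⟨(measurable_of_countable _).aestronglyMeasurable, ?_⟩
    rw [hasFiniteIntegral_iff_ofReal (ae_of_all _ fun k => sq_nonneg _)]
    exact lt_top_iff_ne_top.2 hcon
  obtain ⟨s, h1, hs, h2⟩ := ((hR (1 / 2) (by norm_num)).and ((eventually_ge_atTop 0).and
    ((tendsto_mom hν).eventually_gt_atTop (∫ k : ℤ, (k : ℝ) ^ 2 ∂(negPart ν))))).exists
  have h3 : mom (negPart ν) s ≤ (∫ k : ℤ, (k : ℝ) ^ 2 ∂(negPart ν)) / 2 := by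
    rw [mom_eq (integrable_negPart hν) hs, ← integral_div]
    refine integral_mono (integrable_quadCap (integrable_negPart hν) hs) (hi.div_const 2) fun k => ?_
    have := quadCap_le_sq (y := |(k : ℝ)|) (s := s)
    rwa [sq_abs] at this
  rw [mom_eq_add hν hs] at h1 h2
  linarith

theorem exists_symbPair (hν : CenteredLaw ν)
    (hR : ∀ θ : ℝ, 0 < θ → ∀ᶠ s in atTop, mom (posPart ν) s ≤ θ * mom ν s) :
    ∃ dw dv c, SymbPair (errMeas ν) (totMeas ν) (symb ν)
      (fun t => symb (negPart ν) t + symb (unitAtom ν) t) dw dv c := by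
  have hn := integrable_negPart hν
  have hp := integrable_posPart_law hν
  have hu := integrable_unitAtom (ν := ν)
  have he := integrable_errMeas hν
  have ht := integrable_totMeas hν
  have hpos : ∀ s, 0 < s → 0 < mom (totMeas ν) s := fun s hs => mom_totMeas_pos hν hs
  have b1 := (symbBound_symb hn).add hn he ((symbBound_symb hp).add hp hu (symbBound_zero hu))
  have b2 := (symbBound_symb hn).add hn he ((symbBound_zero hp).add hp hu (symbBound_symb hu))
  have b3 := (symbBound_symb hp).neg.add hp hu (symbBound_symb hu)
  have e1 : (fun t => symb (negPart ν) t + (symb (posPart ν) t + 0)) = symb ν := by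
    ext t; rw [symb_eq_add hν, add_zero]
  simp only [e1] at b1
  simp only [zero_add] at b2
  have b4 : SymbBound (errMeas ν)
      (fun t => (symb (negPart ν) t + symb (unitAtom ν) t) - symb ν t)
      (fun t => (symbDeriv (negPart ν) t + symbDeriv (unitAtom ν) t)
        - (symbDeriv (negPart ν) t + (symbDeriv (posPart ν) t + 0))) := by
    have h1 : (fun t => (symb (negPart ν) t + symb (unitAtom ν) t) - symb ν t)
        = fun t => -symb (posPart ν) t + symb (unitAtom ν) t := by
      ext t; rw [symb_eq_add hν]; ring
    have h2 : (fun t => (symbDeriv (negPart ν) t + symbDeriv (unitAtom ν) t)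
        - (symbDeriv (negPart ν) t + (symbDeriv (posPart ν) t + 0)))
        = fun t => -symbDeriv (posPart ν) t + symbDeriv (unitAtom ν) t := by ext t; ring
    rw [h1, h2]; exact b3
  -- Any θ with (1 - θ)/20 - 8θ ≥ 1/40 would do: the negative part, without cancellation, must
  -- dominate the error part of the symbol.
  obtain ⟨s₁, hs₁⟩ := mom_errMeas_le hν hR (θ := 1 / 1000) (by norm_num)
  set s₀ := max s₁ 1 with hs₀
  have hs0 : 0 < s₀ := lt_of_lt_of_le one_pos (le_max_right _ _)
  have hlow : ∀ t, 0 < t → t ≤ s₀⁻¹ → t ^ 2 * mom (negPart ν) t⁻¹ / 20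
      - 8 * t ^ 2 * mom (errMeas ν) t⁻¹ ≥ 1 / 40 * t ^ 2 * mom (totMeas ν) t⁻¹ := by
    intro t h0 h1
    have h2 : s₁ ≤ t⁻¹ := (le_max_left s₁ 1).trans ((le_inv_comm₀ hs0 h0).2 h1)
    have h3 := hs₁ _ h2
    have h4 := mom_totMeas hν t⁻¹
    have h5 := hpos _ (inv_pos.2 h0)
    have h6 : 0 < t ^ 2 := by positivity
    have h7 : mom (negPart ν) t⁻¹ / 20 - 8 * mom (errMeas ν) t⁻¹
      ≥ 1 / 40 * mom (totMeas ν) t⁻¹ := by linarith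
    nlinarith
  have hle : ∀ t, 0 < t → mom (posPart ν) t⁻¹ ≤ mom (errMeas ν) t⁻¹
      ∧ mom (unitAtom ν) t⁻¹ ≤ mom (errMeas ν) t⁻¹ := fun t h0 => by
    have h1 := mom_nonneg (κ := posPart ν) (inv_nonneg.2 h0.le)
    have h2 := mom_nonneg (κ := unitAtom ν) (inv_nonneg.2 h0.le)
    rw [mom_errMeas hν]; constructor <;> linarith
  have hw : ∀ t, 0 < t → t ≤ s₀⁻¹ → 1 / 40 * t ^ 2 * mom (totMeas ν) t⁻¹ ≤ ‖symb ν t‖ := by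
    intro t h0 h1
    refine (hlow t h0 h1).le.trans ?_
    rw [symb_eq_add hν]
    have h2 := le_norm_symb hn ae_negPart h0
    have h3 := norm_symb_le hp h0
    have h4 := mul_le_mul_of_nonneg_left (hle t h0).1 (by positivity : 0 ≤ 8 * t ^ 2)
    have h5 := norm_sub_le_norm_add (symb (negPart ν) t) (symb (posPart ν) t)
    linarith
  have hv : ∀ t, 0 < t → t ≤ s₀⁻¹ → 1 / 40 * t ^ 2 * mom (totMeas ν) t⁻¹
      ≤ ‖symb (negPart ν) t + symb (unitAtom ν) t‖ := by
    intro t h0 h1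
    refine (hlow t h0 h1).le.trans ?_
    have h2 := le_norm_symb hn ae_negPart h0
    have h3 := norm_symb_le hu h0
    have h4 := mul_le_mul_of_nonneg_left (hle t h0).2 (by positivity : 0 ≤ 8 * t ^ 2)
    have h5 := norm_sub_le_norm_add (symb (negPart ν) t) (symb (unitAtom ν) t)
    linarith
  have hrc := centeredLaw_rightContLaw hν (lintegral_sq_negPart hν hR)
  have := isProbabilityMeasure_rightContLaw (ν := ν)
  have hwne : ∀ t, 0 < t → t ≤ Real.pi → symb ν t ≠ 0 := fun t h0 h1 => by
    rw [symb_eq hν]; exact sub_ne_zero.2 (chf_ne_one hν h0 h1).symm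
  -- The second symbol is a positive multiple of 1 minus the characteristic function of the
  -- comparison law.
  have hvne : ∀ t, 0 < t → t ≤ Real.pi → symb (negPart ν) t + symb (unitAtom ν) t ≠ 0 :=
    fun t h0 h1 h => by
      have h2 := symb_rightContLaw hν t
      rw [h, mul_zero, symb_eq hrc] at h2
      exact chf_ne_one hrc h0 h1 (sub_eq_zero.1 h2).symm
  obtain ⟨c1, hc1, -, hw'⟩ := exists_mul_mom_le_norm ht
    (continuous_iff_continuousAt.2 fun t => (b1.deriv t).continuousAt) hpos hwne
    (inv_pos.2 hs0) (by norm_num) hw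
  obtain ⟨c2, hc2, hc21, hv'⟩ := exists_mul_mom_le_norm ht
    (continuous_iff_continuousAt.2 fun t => (b2.deriv t).continuousAt) hpos hvne
    (inv_pos.2 hs0) (by norm_num) hv
  refine ⟨_, _, min c1 c2, he, ht, b1, b2, b4, lt_min hc1 hc2, hpos, tendsto_mom_totMeas hν,
    fun t h0 h1 => ?_, fun t h0 h1 => ?_⟩
  · refine le_trans ?_ (hw' t h0 h1)
    have := hpos _ (inv_pos.2 h0)
    gcongr; exact min_le_left _ _
  · refine le_trans ?_ (hv' t h0 h1)
    have := hpos _ (inv_pos.2 h0)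
    gcongr; exact min_le_right _ _

/-- When the right tail is negligible, the potential is small on the negative half-line. -/
theorem exists_pot_neg_le (hν : CenteredLaw ν)
    (hR : ∀ θ : ℝ, 0 < θ → ∀ᶠ s in atTop, mom (posPart ν) s ≤ θ * mom ν s) {δ : ℝ} (hδ : 0 < δ) :
    ∃ C : ℝ, ∀ᶠ n : ℕ in atTop, pot ν (-n) ≤ δ * (n / mom (totMeas ν) n) + C := by
  obtain ⟨dw, dv, c, hS⟩ := exists_symbPair hν hR
  have hrc := centeredLaw_rightContLaw hν (lintegral_sq_negPart hν hR)
  have hprob := isProbabilityMeasure_rightContLaw (ν := ν)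
  set v : ℝ → ℂ := fun t => symb (negPart ν) t + symb (unitAtom ν) t with hv
  set l : ℝ := 1 / (1 + negMean ν) with hl
  have hl0 : 0 < l := by have := negMean_nonneg (ν := ν); positivity
  have hchf : ∀ t, 1 - chf (rightContLaw ν) t = (l : ℂ) * v t := fun t => by
    rw [← symb_eq hrc, symb_rightContLaw hν]
  have hchf' : ∀ t, 1 - chf ν t = symb ν t := fun t => (symb_eq hν t).symm
  have him : ∀ t, |(chf ν t).im| = |(symb ν t).im| := fun t => by
    rw [← hchf', Complex.sub_im, Complex.one_im, zero_sub, abs_neg]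
  have him' : ∀ t, |(chf (rightContLaw ν) t).im| = l * |(v t).im| := fun t => by
    have : (chf (rightContLaw ν) t).im = -((l : ℂ) * v t).im := by
      rw [← hchf, Complex.sub_im, Complex.one_im, zero_sub, neg_neg]
    rw [this, abs_neg, Complex.im_ofReal_mul, abs_mul, abs_of_pos hl0]
  have i1 : IntegrableOn (fun t : ℝ => t * |(chf ν t).im| / ‖1 - chf ν t‖ ^ 2)
      (Set.Ioc 0 Real.pi) := by
    simp only [him, hchf']
    exact integrableOn_im_div hS.int hS.left hS.mom_pos hS.mom_top hS.c_pos hS.le_left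
  have i2 : IntegrableOn (fun t : ℝ => t * |(chf (rightContLaw ν) t).im|
      / ‖1 - chf (rightContLaw ν) t‖ ^ 2) (Set.Ioc 0 Real.pi) := by
    have h := (integrableOn_im_div hS.int hS.right hS.mom_pos hS.mom_top hS.c_pos
      hS.le_right).const_mul (l⁻¹)
    refine IntegrableOn.congr_fun h (fun t _ => ?_) measurableSet_Ioc
    simp only [him', hchf, norm_mul, Complex.norm_real, Real.norm_eq_abs, abs_of_pos hl0]
    field_simp
  obtain ⟨s₀, C, hC⟩ := hS.exists_integral_le (fun θ hθ => mom_errMeas_le hν hR hθ)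
    (mul_pos hδ Real.pi_pos)
  refine ⟨C / Real.pi, ?_⟩
  filter_upwards [eventually_ge_atTop ⌈s₀⌉₊] with n hn
  have hn' : s₀ ≤ n := (Nat.le_ceil s₀).trans (by exact_mod_cast hn)
  have h1 := pot_eq_integral hν i1 (-n)
  have h2 := pot_eq_integral hrc i2 (-n)
  rw [pot_neg_eq_zero_of_rightContinuous hrc (fun k hk => rightContLaw_supp hk)] at h2
  have j1 := intervalIntegrable_pot_integrand hν i1 (-n)
  have j2 := intervalIntegrable_pot_integrand hrc i2 (-n)
  have hπ := Real.pi_pos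
  -- The potential of the right-continuous law is zero at -n, so its Fourier integral can be
  -- subtracted freely; the multiple l turns the integrand into 1/w - 1/v.
  have h3 : ∫ t in (0 : ℝ)..Real.pi, ((1 - cis (t * ((-n : ℤ) : ℝ)))
      / (1 - chf (rightContLaw ν) t)).re = 0 := by
    have : (1 / Real.pi : ℝ) ≠ 0 := by positivity
    exact (mul_eq_zero.1 h2.symm).resolve_left this
  have h4 : pot ν (-n) = (1 / Real.pi) * ∫ t in (0 : ℝ)..Real.pi,
      ((1 - cis (t * ((-n : ℤ) : ℝ))) * ((v t - symb ν t) / (symb ν t * v t))).re := by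
    have h5 : pot ν (-n) = (1 / Real.pi) * ((∫ t in (0 : ℝ)..Real.pi,
        ((1 - cis (t * ((-n : ℤ) : ℝ))) / (1 - chf ν t)).re) - l * ∫ t in (0 : ℝ)..Real.pi,
        ((1 - cis (t * ((-n : ℤ) : ℝ))) / (1 - chf (rightContLaw ν) t)).re) := by
      rw [h3, mul_zero, sub_zero, h1]
    rw [h5, ← intervalIntegral.integral_const_mul,
      ← intervalIntegral.integral_sub j1 (j2.const_mul l)]
    congr 1
    refine intervalIntegral.integral_congr_ae (ae_of_all _ fun t ht => ?_)
    rw [Set.uIoc_of_le hπ.le] at ht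
    have n1 := hS.left_ne ht.1 ht.2
    have n2 := hS.right_ne ht.1 ht.2
    have n3 : (l : ℂ) ≠ 0 := by exact_mod_cast hl0.ne'
    rw [hchf, hchf', ← Complex.re_ofReal_mul, ← Complex.sub_re]
    congr 1
    field_simp
  have h6 := hC n ((-n : ℤ) : ℝ) hn' (by simp)
  rw [h4]
  calc (1 / Real.pi) * ∫ t in (0 : ℝ)..Real.pi,
      ((1 - cis (t * ((-n : ℤ) : ℝ))) * ((v t - symb ν t) / (symb ν t * v t))).re
      ≤ (1 / Real.pi) * (δ * Real.pi * (n / mom (totMeas ν) n) + C) := by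
        gcongr
        exact (le_abs_self _).trans h6
    _ = _ := by field_simp

end

/-! ### Lower bound on the positive half-line and the ratio a(-n)/a(n) -/

/-- Cut k into ⌊|k|/N⌋ + 1 pieces of modulus at most N. -/
lemma le_of_subadditive {f : ℤ → ℝ} (hf : ∀ x y, f (x + y) ≤ f x + f y) {N : ℕ} (hN : 0 < N)
    {A : ℝ} (hA : ∀ k : ℤ, |k| ≤ N → f k ≤ A) (hA0 : 0 ≤ A) (k : ℤ) :
    f k ≤ A * (|(k : ℝ)| / N + 1) := by
  have key : ∀ (j : ℕ) (k : ℤ), |k| ≤ (j + 1) * N → f k ≤ A * (j + 1) := by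
    intro j
    induction j with
    | zero => intro k hk; simpa using hA k (by simpa using hk)
    | succ j ih =>
      intro k hk
      push_cast at hk ⊢
      have hstep : ∀ l m : ℤ, k = l + m → |l| ≤ (j + 1) * N → |m| ≤ N →
          f k ≤ A * (j + 1 + 1) := fun l m hkl hl hm => by
        have h1 := hf l m
        rw [hkl]
        linarith [ih l hl, hA m hm]
      have e : ((j : ℤ) + 1 + 1) * N = (j + 1) * N + N := by ring
      rw [e] at hk
      rcases le_total 0 k with h | h
      · rw [abs_of_nonneg h] at hk
        by_cases hkN : k ≤ N
        · exact hstep 0 k (by ring) (by simp) (by rwa [abs_of_nonneg h])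
        · exact hstep (k - N) N (by ring) (by rw [abs_of_nonneg (by omega)]; linarith) (by simp)
      · rw [abs_of_nonpos h] at hk
        by_cases hkN : -k ≤ N
        · exact hstep 0 k (by ring) (by simp) (by rwa [abs_of_nonpos h])
        · exact hstep (k + N) (-N) (by ring) (by rw [abs_of_nonpos (by omega)]; linarith) (by simp)
  have hN' : (0 : ℝ) < N := by exact_mod_cast hN
  set j := ⌊|(k : ℝ)| / N⌋₊ with hj
  have h1 : |(k : ℝ)| / N < j + 1 := Nat.lt_floor_add_one _
  have h2 : (j : ℝ) ≤ |(k : ℝ)| / N := Nat.floor_le (by positivity)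
  rw [div_lt_iff₀ hN'] at h1
  refine (key j k ?_).trans (mul_le_mul_of_nonneg_left (by linarith) hA0)
  exact_mod_cast h1.le

section
variable {ν : Measure ℤ} [IsProbabilityMeasure ν]

lemma truncMoment_le_mom (hν : CenteredLaw ν) {s : ℝ} (hs : 0 ≤ s) :
    truncMoment ν s ≤ 2 * mom ν s := by
  rw [truncMoment, mom_eq hν.integrable hs, ← integral_const_mul]
  exact integral_mono (integrable_truncMoment hν.integrable hs)
    ((integrable_quadCap hν.integrable hs).const_mul 2) fun k => mul_min_le_quadCap hs

/-- A bound for the potential on `[-3N, 3N]` is at least of order `N / mom ν N`. -/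
lemma le_mul_mom_of_pot_le (hν : CenteredLaw ν) {N : ℕ} (hN : 0 < N) {A : ℝ}
    (hA : ∀ k : ℤ, |k| ≤ 3 * N → pot ν k ≤ A) : (N : ℝ) ≤ 8 * A * mom ν N := by
  have hA0 : 0 ≤ A := (pot_nonneg hν 0).trans (hA 0 (by simp))
  have hsub := le_of_subadditive (pot_add_le hν) hN (fun k hk => hA k (by omega)) hA0
  have h := le_truncMoment_of_isPot hν (linGrowth_pot hν) (avg_pot hν) hN (M := A)
    (fun x hx => by rw [abs_of_nonneg (pot_nonneg hν x)]; exact hA x hx) fun x k => by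
      have h1 := pot_add_le hν x k
      have h2 := pot_add_le hν (x + k) (-k)
      rw [add_neg_cancel_right] at h2
      have h3 := hsub (-k)
      push_cast at h3
      rw [abs_neg] at h3
      rw [abs_le]
      constructor <;> linarith [hsub k]
  have h2 := mul_le_mul_of_nonneg_left (truncMoment_le_mom hν (Nat.cast_nonneg N))
    (by positivity : 0 ≤ 4 * A)
  linarith

lemma tendsto_div_mom_totMeas (hν : CenteredLaw ν) :
    Tendsto (fun n : ℕ => (n : ℝ) / mom (totMeas ν) n) atTop atTop := by
  have h1 := (tendsto_mom_div (integrable_totMeas hν)).comp tendsto_natCast_atTop_atTop (α := ℕ)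
  have h2 : Tendsto (fun n : ℕ => mom (totMeas ν) n / n) atTop (𝓝[>] 0) := by
    refine tendsto_nhdsWithin_iff.2 ⟨h1, ?_⟩
    filter_upwards [eventually_gt_atTop 0] with n hn
    have hn' : (0 : ℝ) < n := by exact_mod_cast hn
    exact div_pos (mom_totMeas_pos hν hn') hn'
  refine h2.inv_tendsto_nhdsGT_zero.congr fun n => ?_
  simp

/-- Lower bound for the potential on the positive half-line. -/
theorem eventually_le_pot (hν : CenteredLaw ν)
    (hR : ∀ θ : ℝ, 0 < θ → ∀ᶠ s in atTop, mom (posPart ν) s ≤ θ * mom ν s) :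
    ∀ᶠ n : ℕ in atTop, 1 / 100 * ((n : ℝ) / mom (totMeas ν) n) ≤ pot ν n := by
  obtain ⟨C, hC⟩ := exists_pot_neg_le hν hR (δ := 1 / 400) (by norm_num)
  obtain ⟨n₀, hn₀⟩ := eventually_atTop.1 hC
  obtain ⟨D, hD⟩ : ∃ D : ℝ, ∀ m : ℕ, m < n₀ → pot ν (-m) ≤ D := by
    obtain ⟨D, hD⟩ := ((Finset.range n₀).image fun m : ℕ => pot ν (-m)).bddAbove
    exact ⟨D, fun m hm => hD (Finset.mem_coe.2 (Finset.mem_image_of_mem _ (Finset.mem_range.2 hm)))⟩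
  have hq := tendsto_div_mom_totMeas hν
  filter_upwards [eventually_ge_atTop 6,
    hq.eventually_ge_atTop (400 * (|C| + |D|))] with n hn6 hbig
  have hn0 : (0 : ℝ) < n := by exact_mod_cast (by omega : 0 < n)
  have hmn := mom_totMeas_pos hν hn0
  set q := (n : ℝ) / mom (totMeas ν) n with hqd
  have hq0 : 0 < q := by positivity
  -- s/m(s) is nondecreasing and at most doubles from n to 2n, which turns 1/400 into 1/200; D
  -- covers the finitely many small m.
  have hneg : ∀ m : ℕ, m ≤ 2 * n → pot ν (-m) ≤ 1 / 200 * q + (|C| + |D|) := by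
    intro m hm
    by_cases hm0 : m < n₀
    · have := hD m hm0
      linarith [le_abs_self D, abs_nonneg C]
    · rcases Nat.eq_zero_or_pos m with rfl | hm1
      · have : pot ν (-((0 : ℕ) : ℤ)) = 0 := by simpa using pot_zero hν
        rw [this]; positivity
      have h1 := hn₀ m (not_lt.1 hm0)
      have hm1' : (0 : ℝ) < m := by exact_mod_cast hm1
      have h2 : (m : ℝ) / mom (totMeas ν) m ≤ 2 * q := by
        have hm2 : (m : ℝ) ≤ 2 * n := by exact_mod_cast hm
        refine (div_mom_mono (integrable_totMeas hν) (fun s hs => mom_totMeas_pos hν hs) hm1'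
          hm2).trans ?_
        rw [hqd, ← mul_div_assoc]
        have := mom_mono (integrable_totMeas hν) (by linarith : (n : ℝ) ≤ 2 * n)
        gcongr
      linarith [le_abs_self C, abs_nonneg D]
  -- Then |k| ≤ 3N ≤ n puts n - k in [0, 2n], so a(k) ≤ a(n) + a(k - n) bounds a on the whole window
  -- by a(n) up to a small error.
  set N := n / 3 with hN
  have hN0 : 0 < N := by omega
  have hA : ∀ k : ℤ, |k| ≤ 3 * N → pot ν k ≤ pot ν n + (1 / 200 * q + (|C| + |D|)) := by
    intro k hk
    have h1 := pot_sub_le hν k n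
    rw [abs_le] at hk
    obtain ⟨m, hm⟩ : ∃ m : ℕ, (m : ℤ) = n - k := ⟨(n - k).toNat, by omega⟩
    have h2 := hneg m (by omega)
    rw [hm, neg_sub] at h2
    linarith
  have h1 := le_mul_mom_of_pot_le hν hN0 hA
  have hNn : (n : ℝ) ≤ 6 * N := by exact_mod_cast (by omega : n ≤ 6 * N)
  have hNn' : (N : ℝ) ≤ n := by exact_mod_cast (by omega : N ≤ n)
  set A := pot ν n + (1 / 200 * q + (|C| + |D|)) with hAd
  have hA0 : 0 ≤ A := (pot_nonneg hν 0).trans (hA 0 (by simp))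
  have h2 : mom ν N ≤ mom (totMeas ν) n :=
    (mom_le_mom_totMeas hν (Nat.cast_nonneg N)).trans (mom_mono (integrable_totMeas hν) hNn')
  -- 48 = 6 · 8, from n ≤ 6N and the tent estimate. Since the errors in A are at most 3q/400, this
  -- leaves a(n) ≥ q/100.
  have h3 : q ≤ 48 * A := by
    rw [hqd, div_le_iff₀ hmn]
    nlinarith [mul_le_mul_of_nonneg_left h2 hA0]
  linarith

theorem negPotNegligible_of_mom (hν : CenteredLaw ν)
    (hR : ∀ θ : ℝ, 0 < θ → ∀ᶠ s in atTop, mom (posPart ν) s ≤ θ * mom ν s) :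
    NegPotNegligible ν := by
  have hlow := eventually_le_pot hν hR
  have hq := tendsto_div_mom_totMeas hν
  refine ⟨?_, ?_⟩
  · filter_upwards [hlow, hq.eventually_gt_atTop 0] with n h1 h2
    exact ne_of_gt (by linarith)
  · rw [Metric.tendsto_atTop']
    intro ε hε
    -- Since n/m(n) ≤ 100 a(n), both ε/400 times n/m(n) and the constant C cost at most ε a(n)/4.
    obtain ⟨C, hC⟩ := exists_pot_neg_le hν hR (δ := ε / 400) (by positivity)
    obtain ⟨n₀, hn₀⟩ := eventually_atTop.1 ((hlow.and hC).and
      (hq.eventually_gt_atTop (400 * |C| / ε)))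
    refine ⟨n₀, fun n hn => ?_⟩
    obtain ⟨⟨h1, h2⟩, h3⟩ := hn₀ n hn.le
    have hq0 : 0 < (n : ℝ) / mom (totMeas ν) n := lt_of_le_of_lt (by positivity) h3
    have hp : 0 < pot ν n := by linarith
    rw [div_lt_iff₀ hε] at h3
    rw [Real.dist_eq, sub_zero, abs_div, abs_of_nonneg (pot_nonneg hν _), abs_of_pos hp,
      div_lt_iff₀ hp]
    nlinarith [le_abs_self C]

end

/-! ### The tail integrals m_± as truncated moments -/

section
variable {Ω : Type*} [MeasurableSpace Ω] {P : Measure Ω} [IsProbabilityMeasure P]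

/-- Layer-cake formula for the positive part of Y - t, after translating the variable by t. -/
lemma tailInt_eq {Y : Ω → ℝ} (hY : Integrable Y P) (t : ℝ) :
    tailInt Y P t = ∫ ω, max (Y ω - t) 0 ∂P := by
  have hi : Integrable (fun ω => max (Y ω - t) 0) P := (hY.sub (integrable_const t)).pos_part
  rw [hi.integral_eq_integral_meas_lt (ae_of_all _ fun ω => le_max_right _ _), tailInt,
    ← (measurePreserving_add_left volume t).setIntegral_preimage_emb (measurableEmbedding_addLeft t)
      (fun y => P.real {ω | y < Y ω}) (Set.Ioi t)]
  have : (fun x => t + x) ⁻¹' Set.Ioi t = Set.Ioi 0 := by ext x; simp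
  rw [this]
  refine setIntegral_congr_fun measurableSet_Ioi fun u hu => ?_
  have hu' : (0 : ℝ) < u := hu
  congr 1
  ext ω
  simp only [Set.mem_ofPred_eq, lt_max_iff, not_lt.2 hu'.le, or_false, lt_sub_iff_add_lt, add_comm]

lemma eta_restrict (ν : Measure ℤ) {D : Set ℤ} {g : ℤ → ℝ} {s : ℝ} (hs : 0 ≤ s)
    (h1 : ∀ k ∈ D, |(k : ℝ)| = g k) (h2 : ∀ k ∉ D, g k ≤ 0) :
    eta (ν.restrict D) s = ∫ k, max (g k - s) 0 ∂ν := by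
  rw [eta, ← integral_indicator (MeasurableSet.of_discrete)]
  refine integral_congr_ae (ae_of_all _ fun k => ?_)
  by_cases hk : k ∈ D
  · simp only [Set.indicator_of_mem hk, h1 k hk]
  · simp only [Set.indicator_of_notMem hk]
    exact (max_eq_right (by linarith [h2 k hk])).symm

/-- The pair (g, D) is (k, positive half-line) for m_+ and (-k, negative half-line) for m_-; outside
D the positive part vanishes. -/
lemma doubleTailInt_eq {X : Ω → ℤ} (hX : Measurable X) {g : ℤ → ℝ}
    (hg : Integrable (fun ω => g (X ω)) P) {D : Set ℤ} (h1 : ∀ k ∈ D, |(k : ℝ)| = g k)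
    (h2 : ∀ k ∉ D, g k ≤ 0) {s : ℝ} (hs : 0 ≤ s) :
    doubleTailInt (fun ω => g (X ω)) P s = mom ((P.map X).restrict D) s := by
  rw [doubleTailInt, mom]
  refine intervalIntegral.integral_congr fun t ht => ?_
  rw [Set.uIcc_of_le hs] at ht
  rw [tailInt_eq hg, eta_restrict _ ht.1 h1 h2,
    integral_map hX.aemeasurable (measurable_of_countable _).aestronglyMeasurable]

theorem negPotNegligible_of_rightTailNegligible {X : ℕ → Ω → ℤ} (hmeas : Measurable (X 0))
    (hν : CenteredLaw (P.map (X 0))) (hint : Integrable (fun ω => (X 0 ω : ℝ)) P)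
    (h : RightTailNegligible X P) : NegPotNegligible (P.map (X 0)) := by
  have hprob : IsProbabilityMeasure (P.map (X 0)) :=
    Measure.isProbabilityMeasure_map hmeas.aemeasurable
  refine negPotNegligible_of_mom hν fun θ hθ => ?_
  filter_upwards [h.eventually (gt_mem_nhds hθ), eventually_ge_atTop 0,
    (tendsto_mom hν).eventually_gt_atTop 0] with s h1 hs h2
  have e1 : mPlus X P s = mom (posPart (P.map (X 0))) s :=
    doubleTailInt_eq hmeas (g := fun k => (k : ℝ)) hint
      (fun k hk => abs_of_pos (by exact_mod_cast hk))
      (fun k hk => by exact_mod_cast not_lt.1 hk) hs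
  have e2 : mMinus X P s = mom (negPart (P.map (X 0))) s :=
    doubleTailInt_eq hmeas (g := fun k => -(k : ℝ)) hint.neg
      (fun k hk => abs_of_neg (by exact_mod_cast hk))
      (fun k hk => neg_nonpos.2 (by exact_mod_cast not_lt.1 hk)) hs
  rw [e1, e2, add_comm, ← mom_eq_add hν hs, div_lt_iff₀ h2] at h1
  exact h1.le

end
end PotentialWalk

end

theorem mainTheorem8 {Ω : Type*} [MeasurableSpace Ω] (P : Measure Ω) [IsProbabilityMeasure P]
    (X : ℕ → Ω → ℤ)
    (hmeas : ∀ i, Measurable (X i))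
    (hindep : iIndepFun X P)
    (hident : ∀ i, IdentDistrib (X i) (X 0) P P)
    (hirr : PotentialWalk.WalkIrreducible X P)
    (hint : Integrable (fun ω => (X 0 ω : ℝ)) P)
    (hmean : ∫ ω, (X 0 ω : ℝ) ∂P = 0)
    (hvar : ∫⁻ ω, ENNReal.ofReal ((X 0 ω : ℝ) ^ 2) ∂P = ⊤) :
    -- the series defining the potential function converges
    (∀ x : ℤ, Tendsto (PotentialWalk.potentialPartial X P x) atTop
      (𝓝 (PotentialWalk.potential X P x))) ∧
    -- (i)
    (PotentialWalk.PotentialRatioVanishes X P →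
      PotentialWalk.UniformEquiv (fun _ => Set.univ)
        (fun R x => PotentialWalk.probHitBefore X P x (Set.Iic 0) {(R : ℤ)})
        (fun R x => PotentialWalk.probHitBefore X P x {0} {(R : ℤ)})) ∧
    -- (ii), followed by the asymptotic monotonicity
    (PotentialWalk.RightTailNegligible X P →
      PotentialWalk.PotentialRatioVanishes X P ∧
      PotentialWalk.UniformEquiv (fun R => Set.Ico 0 (R : ℤ))
        (fun R x => PotentialWalk.probHitBefore X P x (Set.Ici (R : ℤ)) {0})
        (fun R x => PotentialWalk.probHitBefore X P x {(R : ℤ)} {0}) ∧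
      PotentialWalk.UniformEquiv (fun R => Set.Ico 0 (R : ℤ))
        (fun R x => PotentialWalk.probHitBefore X P x {(R : ℤ)} {0})
        (fun R x => PotentialWalk.potentialDagger X P x / PotentialWalk.potential X P (R : ℤ)) ∧
      ∃ f : ℕ → ℝ, StrictMono f ∧
        (fun n : ℕ => PotentialWalk.potentialBar X P (n : ℤ)) ~[atTop] f) := by
  have hν := PotentialWalk.centeredLaw_map hmeas hindep hident hirr hint hmean hvar
  have hpot := PotentialWalk.potential_eq hmeas hindep hident
  have hprob : IsProbabilityMeasure (P.map (X 0)) :=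
    Measure.isProbabilityMeasure_map (hmeas 0).aemeasurable
  have hratio : PotentialWalk.PotentialRatioVanishes X P
      ↔ PotentialWalk.NegPotNegligible (P.map (X 0)) := by
    rw [PotentialWalk.PotentialRatioVanishes, hpot]; rfl
  have hhit : ∀ R : ℕ, 0 < R → ∀ x : ℤ, PotentialWalk.hitFirst (P.map (X 0)) R x
      = PotentialWalk.probHitBefore X P x {(R : ℤ)} {0} := fun R hR x =>
    (PotentialWalk.probHitBefore_eq_hitFirst hmeas hindep hident hν
      (by exact_mod_cast hR.ne') x).symm
  have havg := PotentialWalk.probHitBefore_eq_avg hmeas hindep hident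
  refine ⟨fun x => ?_, fun h => ?_, fun h => ?_⟩
  · rw [PotentialWalk.potentialPartial_eq hmeas hindep hident, hpot]
    exact PotentialWalk.tendsto_partialPot hν x
  · exact (hratio.1 h).hitLeftRay_equiv hν
      (g := fun R x => PotentialWalk.probHitBefore X P x (Set.Iic 0) {(R : ℤ)})
      (f := fun R x => PotentialWalk.probHitBefore X P x {0} {(R : ℤ)})
      (fun R x => PotentialWalk.probHitBefore_nonneg x _ _)
      (fun R x => PotentialWalk.probHitBefore_le_one x _ _) (fun R x => havg _ _ x)
      (fun R x => PotentialWalk.probHitBefore_nonneg x _ _)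
      (fun R x => PotentialWalk.probHitBefore_le_one x _ _) (fun R x => havg _ _ x)
  · have hr := PotentialWalk.negPotNegligible_of_rightTailNegligible (hmeas 0) hν hint h
    refine ⟨hratio.2 hr, ?_, ?_, ?_⟩
    · exact (hr.hitRay_equiv hν
        (h := fun R x => PotentialWalk.probHitBefore X P x (Set.Ici (R : ℤ)) {0})
        (fun R x => PotentialWalk.probHitBefore_nonneg x _ _)
        (fun R x => PotentialWalk.probHitBefore_le_one x _ _) (fun R x => havg _ _ x)).congr
        (fun R _ x => rfl) hhit
    · refine (hr.hitFirst_equiv hν).congr hhit fun R _ x => ?_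
      rw [PotentialWalk.potentialDagger, hpot]; rfl
    · obtain ⟨f, hf, hf'⟩ := hr.exists_strictMono_equiv hν
      refine ⟨f, hf, ?_⟩
      have : (fun n : ℕ => PotentialWalk.potentialBar X P (n : ℤ))
          = fun n : ℕ => PotentialWalk.potSum (P.map (X 0)) n / 2 := by
        ext n; rw [PotentialWalk.potentialBar, hpot]; rfl
      rw [this]; exact hf'
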